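/- A prederivator is a strict 2-functor $\mathscr D$ from the 2-category of small categories to the 2-category of (large) categories which reverses the direction of functors and preserves the direction of natural transformations; for a functor $u$ one writes $u^*=\mathscr D(u)$. Morphisms of prederivators are pseudo-natural transformations and 2-morphisms are modifications; adjunctions and isomorphisms of morphisms are taken in the resulting 2-category. A derivator is a prederivator $\mathscr D$ such that (Der1) for every small family $(A_i)$ the functor $\mathscr D(\coprod_i A_i)\to\prod_i\mathscr D(A_i)$ is an equivalence; (Der2) a morphism $f$ of $\mathscr D(A)$ is an isomorphism if $a^*f\in\mathscr D(\mathbb 1)$ is an isomorphism for every object $a\in A$; (Der3) every $u^*$ has a left adjoint and a right adjoint; (Der4) these adjoints are computed pointwise, i.e. for $u\colon A\to C$ and $c\in C$ the canonical mates $q_!p^*\to c^*u_!$ (for the slice category $(u/c)$ with its projections $p\colon(u/c)\to A$ and $q\colon(u/c)\to\mathbb 1$) and $c^*u_*\to q_*p^*$ (for $(c/u)$ with its projections $p\colon(c/u)\to A$ and $q\colon(c/u)\to\mathbb 1$) are isomorphisms. It is pointed if $\mathscr D(\mathbb 1)$ has a zero object. For a small category $A$ let $\mathscr D^A(M)=\mathscr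 D(A\times M)$; a functor $u\colon A\to B$ induces a restriction morphism $u^*\colon\mathscr D^B\to\mathscr D^A$, and the Kan extension morphisms $u_!,u_*\colon\mathscr D^A\to\mathscr D^B$ are the left and the right adjoint of $u^*$. Let $[1]=(0<1)$, let $0^*,1^*\colon\mathscr D^{[1]}\to\mathscr D$ be the evaluations and $\pi^*\colon\mathscr D\to\mathscr D^{[1]}$ the constant morphism morphism, and let $1_!$ and $0_*$ denote the left adjoint of $1^*$ and the right adjoint of $0^*$. Let $\square=[1]\times[1]$, let $\ulcorner=\square-\{(1,1)\}$ and $\lrcorner=\square-\{(0,0)\}$ with inclusions $i_\ulcorner,i_\lrcorner$ into $\square$, let $i\colon[1]\to\ulcorner$ classify $(0,0)\to(1,0)$ and $j\colon[1]\to\lrcorner$ classify $(1,0)\to(1,1)$. The cone and the fiber morphism are $$C=(1,1)^*\circ(i_\ulcorner)_!\circ i_*,\qquad F=(0,0)^*\circ(i_\lrcorner)_*\circ j_!\colon\ \mathscr D^{[1]}\to\mathscr D .$$ **Proposition.** Let $\mathscr D$ be a derivator. The Kan extension morphisms above, and hence $C$ and $F$, exist, and there is an adjoint 5-tuple of morphisms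 of derivators $$1_!\dashv 1^*\dashv\pi^*\dashv 0^*\dashv 0_*.$$ The derivator $\mathscr D$ is pointed if and only if this adjoint 5-tuple extends to an adjoint 7-tuple, i.e. if and only if $1_!$ has a left adjoint and $0_*$ has a right adjoint. If $\mathscr D$ is pointed, then $$C\dashv 1_!\dashv 1^*\dashv\pi^*\dashv 0^*\dashv 0_*\dashv F$$ is such an extension, and every extension is of this form: its outer left and outer right morphisms are isomorphic to $C$ and $F$, respectively. -/

import Mathlib

open CategoryTheory Bicategory Opposite
open scoped Pseudofunctor.StrongTrans

universe u v w w₁ w₂ v₁ v₂ u₁ u₂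

set_option linter.checkUnivs false in
/-- A prederivator: a strict 2-functor from small categories to (large) categories which reverses
the direction of functors and keeps the direction of natural transformations. Morphisms of
prederivators are pseudo-natural transformations and 2-morphisms are modifications, that is, the
2-category of prederivators is a full sub-bicategory of Mathlib's bicategory of pseudofunctors
(reached through `toPseudofunctor`). -/
abbrev Prederivator := StrictPseudofunctor (Cat.{u, u})ᵒᵖ Cat.{v, w}

namespace Prederivator

/-! ### Strictly natural transformations of strict 2-functors -/

/-- A strictly 2-natural transformation, as a pseudo-natural one. -/
def strictTrans {B : Type u₁} [Bicategory.{w₁, v₁} B] {C : Type u₂} [Bicategory.{w₂, v₂} C]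
    [Bicategory.Strict C]
    (F G : StrictPseudofunctor B C) (app : ∀ a : B, F.obj a ⟶ G.obj a)
    (nat : ∀ {a b : B} (f : a ⟶ b), F.map f ≫ app b = app a ≫ G.map f)
    (nat₂ : ∀ {a b : B} {f g : a ⟶ b} (η : f ⟶ g),
      F.map₂ η ▷ app b ≫ eqToHom (nat g) = eqToHom (nat f) ≫ app a ◁ G.map₂ η) :
    F.toPseudofunctor.StrongTrans G.toPseudofunctor where
  app := app
  naturality f := eqToIso (nat f)
  naturality_naturality η := nat₂ η
  naturality_id a := by
    simp [F.mapId_eq_eqToIso, G.mapId_eq_eqToIso, Strict.leftUnitor_eqToIso,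
      Strict.rightUnitor_eqToIso]
  naturality_comp f g := by
    simp [F.mapComp_eq_eqToIso, G.mapComp_eq_eqToIso, Strict.associator_eqToIso]

lemma map_square {B : Type u₁} [Bicategory.{w₁, v₁} B] {C : Type u₂} [Bicategory.{w₂, v₂} C]
    (D : StrictPseudofunctor B C) {a b a' b' : B} {f : a ⟶ b} {f' : a' ⟶ b'}
    {x : a ⟶ a'} {y : b ⟶ b'} (h : f ≫ y = x ≫ f') :
    D.map f ≫ D.map y = D.map x ≫ D.map f' := by
  rw [← D.map_comp, ← D.map_comp, h]

lemma strict_square {B : Type u₁} [Bicategory.{w₁, v₁} B] {C : Type u₂} [Bicategory.{w₂, v₂} C]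
    (D : StrictPseudofunctor B C) {a b a' b' : B} {f g : a ⟶ b} {f' g' : a' ⟶ b'}
    {x : a ⟶ a'} {y : b ⟶ b'} (hf : f ≫ y = x ≫ f') (hg : g ≫ y = x ≫ g')
    (η : f ⟶ g) (η' : f' ⟶ g')
    (h : η ▷ y ≫ eqToHom hg = eqToHom hf ≫ x ◁ η')
    (hf' : D.map f ≫ D.map y = D.map x ≫ D.map f')
    (hg' : D.map g ≫ D.map y = D.map x ≫ D.map g') :
    D.map₂ η ▷ D.map y ≫ eqToHom hg' = eqToHom hf' ≫ D.map x ◁ D.map₂ η' := by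
  have h' := congrArg D.map₂ h
  simp only [D.map₂_comp, D.map₂_whisker_right, D.map₂_whisker_left, D.mapComp_eq_eqToIso,
    PrelaxFunctor.map₂_eqToHom, eqToIso.hom, eqToIso.inv, Category.assoc, eqToHom_trans,
    eqToHom_trans_assoc] at h'
  have h'' := congrArg (fun t => eqToHom (D.map_comp f y).symm ≫ t ≫ eqToHom (D.map_comp x g')) h'
  simpa using h''

/-! ### Shifted prederivators -/

/-- The natural transformation `A × η`. -/
def prodTrans (A : Cat.{u, u}) {M N : Cat.{u, u}} {f g : M ⟶ N} (η : f ⟶ g) :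
    (Functor.prod (𝟭 A) f.toFunctor).toCatHom ⟶ (Functor.prod (𝟭 A) g.toFunctor).toCatHom :=
  NatTrans.toCatHom₂ (NatTrans.prod (𝟙 (𝟭 A)) η.toNatTrans)

lemma prodTrans_comp (A : Cat.{u, u}) {M N : Cat.{u, u}} {f g h : M ⟶ N} (η : f ⟶ g) (θ : g ⟶ h) :
    prodTrans A (η ≫ θ) = prodTrans A η ≫ prodTrans A θ :=
  Cat.Hom₂.ext (NatTrans.ext (funext fun _ => Prod.ext (Category.id_comp _).symm rfl))

/-- The strict 2-functor `A × -` on small categories. -/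
def prodWith (A : Cat.{u, u}) : StrictPseudofunctor (Cat.{u, u})ᵒᵖ (Cat.{u, u})ᵒᵖ :=
  StrictPseudofunctor.mk'
  { obj := fun M => op (Cat.of (A × M.unop))
    map := fun f => (Functor.prod (𝟭 A) f.unop.toFunctor).toCatHom.op
    map₂ := fun η => Bicategory.Opposite.op2 (prodTrans A η.unop2)
    map₂_id := fun _ => rfl
    map₂_comp := fun η θ => congrArg Bicategory.Opposite.op2 (prodTrans_comp A η.unop2 θ.unop2)
    map_id := fun _ => rfl
    map_comp := fun _ _ => rfl
    map₂_whisker_left := fun _ _ _ _ =>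
      ((Category.id_comp _).trans (Category.comp_id _)).symm
    map₂_whisker_right := fun _ _ =>
      ((Category.id_comp _).trans (Category.comp_id _)).symm
    map₂_left_unitor := fun _ => (Category.id_comp _).symm
    map₂_right_unitor := fun _ => (Category.id_comp _).symm
    map₂_associator := fun _ _ _ => ((Category.id_comp _).trans (Category.comp_id _)).symm }

lemma prodTrans_exchange {A B M N : Cat.{u, u}} (p : A ⟶ B) {f g : N ⟶ M} (η : f ⟶ g) :
    @Eq ((Functor.prod p.toFunctor (𝟭 N)).toCatHom ≫ (Functor.prod (𝟭 B) f.toFunctor).toCatHom ⟶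
        (Functor.prod p.toFunctor (𝟭 N)).toCatHom ≫ (Functor.prod (𝟭 B) g.toFunctor).toCatHom)
      ((Functor.prod p.toFunctor (𝟭 N)).toCatHom ◁ prodTrans B η)
      (prodTrans A η ▷ (Functor.prod p.toFunctor (𝟭 M)).toCatHom) :=
  Cat.Hom₂.ext (NatTrans.ext (funext fun z : A × N =>
    Prod.ext (p.toFunctor.map_id z.1).symm rfl))

variable (D : Prederivator.{u, v, w})

/-- The shifted prederivator `D^A`, with `D^A(M) = D(A × M)`. -/
def shift (A : Cat.{u, u}) : Prederivator.{u, v, w} :=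
  StrictPseudofunctor.comp (prodWith A) D

/-- The restriction morphism `p^* : D^B ⟶ D^A` along `p : A ⟶ B`, with components
`(p × M)^* : D(B × M) ⥤ D(A × M)`. -/
def restr {A B : Cat.{u, u}} (p : A ⟶ B) :
    (D.shift B).toPseudofunctor ⟶ (D.shift A).toPseudofunctor :=
  strictTrans (D.shift B) (D.shift A)
    (fun M => D.map (Functor.prod p.toFunctor (𝟭 M.unop)).toCatHom.op)
    (fun {M N} f => map_square D (f := (prodWith B).map f) (f' := (prodWith A).map f)
      (x := (Functor.prod p.toFunctor (𝟭 M.unop)).toCatHom.op)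
      (y := (Functor.prod p.toFunctor (𝟭 N.unop)).toCatHom.op) rfl)
    (fun {M N f g} η => strict_square D
      (f := (prodWith B).map f) (g := (prodWith B).map g)
      (f' := (prodWith A).map f) (g' := (prodWith A).map g)
      (x := (Functor.prod p.toFunctor (𝟭 M.unop)).toCatHom.op)
      (y := (Functor.prod p.toFunctor (𝟭 N.unop)).toCatHom.op) rfl rfl
      ((prodWith B).map₂ η) ((prodWith A).map₂ η)
      ((Category.comp_id _).trans (Eq.trans
        (congrArg Opposite.op2 (prodTrans_exchange p η.unop2)) (Category.id_comp _).symm)) _ _)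

/-- The evaluation morphism `a^* : D^A ⟶ D`, with components `D(A × M) ⥤ D(M)` given by
restriction along `m ↦ (a, m)`. -/
def ev {A : Cat.{u, u}} (a : A) :
    (D.shift A).toPseudofunctor ⟶ D.toPseudofunctor :=
  strictTrans (D.shift A) D
    (fun M => D.map (CategoryTheory.Prod.sectR a M.unop).toCatHom.op)
    (fun {M N} f => map_square D (f := (prodWith A).map f) (f' := f)
      (x := (CategoryTheory.Prod.sectR a M.unop).toCatHom.op) (y := (CategoryTheory.Prod.sectR a N.unop).toCatHom.op) rfl)
    (fun {M N f g} η => strict_square D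
      (f := (prodWith A).map f) (g := (prodWith A).map g) (f' := f) (g' := g)
      (x := (CategoryTheory.Prod.sectR a M.unop).toCatHom.op) (y := (CategoryTheory.Prod.sectR a N.unop).toCatHom.op)
      rfl rfl ((prodWith A).map₂ η) η
      ((Category.comp_id _).trans (Category.id_comp _).symm) _ _)

/-- The constant diagram morphism `π_A^* : D ⟶ D^A`, with components `D(M) ⥤ D(A × M)` given by
restriction along the projection. -/
def const (A : Cat.{u, u}) :
    D.toPseudofunctor ⟶ (D.shift A).toPseudofunctor :=
  strictTrans D (D.shift A)
    (fun M => D.map (CategoryTheory.Prod.snd A M.unop).toCatHom.op)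
    (fun {M N} f => map_square D (f := f) (f' := (prodWith A).map f)
      (x := (CategoryTheory.Prod.snd A M.unop).toCatHom.op)
      (y := (CategoryTheory.Prod.snd A N.unop).toCatHom.op) rfl)
    (fun {M N f g} η => strict_square D
      (f := f) (g := g) (f' := (prodWith A).map f) (g' := (prodWith A).map g)
      (x := (CategoryTheory.Prod.snd A M.unop).toCatHom.op)
      (y := (CategoryTheory.Prod.snd A N.unop).toCatHom.op)
      rfl rfl η ((prodWith A).map₂ η)
      ((Category.comp_id _).trans (Category.id_comp _).symm) _ _)

/-! ### Derivators -/

/-- The value `D(A)` at a small category `A`. -/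
abbrev val (A : Type u) [Category.{u} A] : Cat.{v, w} := D.obj (op (Cat.of A))

section

variable {A B C E : Type u} [Category.{u} A] [Category.{u} B] [Category.{u} C] [Category.{u} E]

/-- The restriction functor `f^* : D(B) ⥤ D(A)`. -/
abbrev res (f : A ⥤ B) : D.val B ⥤ D.val A := (D.map f.toCatHom.op).toFunctor

/-- The transformation `p^* f^* ⟶ q^* g^*` induced by a square `α : f p ⟶ g q` (functors are
composed from right to left in this sentence). -/
def resSquare {p : E ⥤ A} {q : E ⥤ B} {f : A ⥤ C} {g : B ⥤ C} (α : p ⋙ f ⟶ q ⋙ g) :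
    D.res f ⋙ D.res p ⟶ D.res g ⋙ D.res q :=
  ((D.mapComp f.toCatHom.op p.toCatHom.op).inv ≫
    D.map₂ (Bicategory.Opposite.op2 (NatTrans.toCatHom₂ α)) ≫
    (D.mapComp g.toCatHom.op q.toCatHom.op).hom).toNatTrans

/-- The mate `q_! p^* ⟶ g^* f_!` of the transformation induced by a square `α : f p ⟶ g q`, for
given left adjoints `f_!` and `q_!` of the restriction functors. -/
def leftMate {p : E ⥤ A} {q : E ⥤ B} {f : A ⥤ C} {g : B ⥤ C} (α : p ⋙ f ⟶ q ⋙ g)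
    {lf : D.val A ⥤ D.val C} {lq : D.val E ⥤ D.val B}
    (adjf : CategoryTheory.Adjunction lf (D.res f))
    (adjq : CategoryTheory.Adjunction lq (D.res q)) :
    D.res p ⋙ lq ⟶ lf ⋙ D.res g :=
  ((CategoryTheory.mateEquiv adjf adjq).symm (TwoSquare.mk _ _ _ _ (D.resSquare α))).natTrans

/-- The mate `f^* g_* ⟶ p_* q^*` of the transformation induced by a square `α : f p ⟶ g q`, for
given right adjoints `g_*` and `p_*` of the restriction functors. -/
def rightMate {p : E ⥤ A} {q : E ⥤ B} {f : A ⥤ C} {g : B ⥤ C} (α : p ⋙ f ⟶ q ⋙ g)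
    {rg : D.val B ⥤ D.val C} {rp : D.val E ⥤ D.val A}
    (adjg : CategoryTheory.Adjunction (D.res g) rg)
    (adjp : CategoryTheory.Adjunction (D.res p) rp) :
    rg ⋙ D.res f ⟶ D.res q ⋙ rp :=
  (CategoryTheory.mateEquiv adjg adjp (TwoSquare.mk _ _ _ _ (D.resSquare α))).natTrans

end

/-- The axioms of a derivator. -/
structure IsDerivator : Prop where
  /-- Coproducts of categories are sent to products (up to equivalence). -/
  der1 : ∀ (I : Type u) (A : I → Type u) [∀ i, Category.{u} (A i)],
    (Functor.pi' fun i => D.res (CategoryTheory.Sigma.incl (C := A) i)).IsEquivalence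
  /-- Isomorphisms are detected pointwise. -/
  der2 : ∀ (A : Type u) [Category.{u} A] {X Y : D.val A} (f : X ⟶ Y),
    (∀ a : A, IsIso ((D.res (Functor.fromPUnit.{u} a)).map f)) → IsIso f
  /-- Restriction functors have adjoints on both sides. -/
  der3 : ∀ {A B : Type u} [Category.{u} A] [Category.{u} B] (f : A ⥤ B),
    (D.res f).IsRightAdjoint ∧ (D.res f).IsLeftAdjoint
  /-- Left Kan extensions are computed pointwise, via the categories `(f / c)`. -/
  der4_left : ∀ {A C : Type u} [Category.{u} A] [Category.{u} C] (f : A ⥤ C) (c : C)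
    (lf : D.val A ⥤ D.val C)
    (lq : D.val (Comma f (Functor.fromPUnit.{u} c)) ⥤ D.val (Discrete PUnit.{u + 1}))
    (adjf : CategoryTheory.Adjunction lf (D.res f))
    (adjq : CategoryTheory.Adjunction lq (D.res (Comma.snd f (Functor.fromPUnit.{u} c)))),
    IsIso (D.leftMate (Comma.natTrans f (Functor.fromPUnit.{u} c)) adjf adjq)
  /-- Right Kan extensions are computed pointwise, via the categories `(c / g)`. -/
  der4_right : ∀ {B C : Type u} [Category.{u} B] [Category.{u} C] (g : B ⥤ C) (c : C)
    (rg : D.val B ⥤ D.val C)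
    (rp : D.val (Comma (Functor.fromPUnit.{u} c) g) ⥤ D.val (Discrete PUnit.{u + 1}))
    (adjg : CategoryTheory.Adjunction (D.res g) rg)
    (adjp : CategoryTheory.Adjunction (D.res (Comma.fst (Functor.fromPUnit.{u} c) g)) rp),
    IsIso (D.rightMate (Comma.natTrans (Functor.fromPUnit.{u} c) g) adjg adjp)

/-- A derivator is pointed if its underlying category, the value at the terminal category, has a
zero object. -/
def IsPointed : Prop := Limits.HasZeroObject (D.val (Discrete PUnit.{u + 1}))

/-- A left Kan extension morphism `p_! : D^A ⟶ D^B`: a left adjoint of `p^*` in the 2-category of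
prederivators (field `left`, with the adjunction `adj`). -/
abbrev LeftKan {A B : Cat.{u, u}} (p : A ⟶ B) := Bicategory.LeftAdjoint (D.restr p)

/-- A right Kan extension morphism `p_* : D^A ⟶ D^B`: a right adjoint of `p^*` in the 2-category
of prederivators (field `right`, with the adjunction `adj`). -/
abbrev RightKan {A B : Cat.{u, u}} (p : A ⟶ B) := Bicategory.RightAdjoint (D.restr p)

/-! ### The shapes -/

/-- A (universe-zero) preordered set as a small category. -/
abbrev poset (P : Type) [Preorder P] : Cat.{u, u} := Cat.of (ULift.{u} P)

/-- A monotone map as a functor. -/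
def posetMap {P Q : Type} [Preorder P] [Preorder Q] (f : P → Q) (hf : Monotone f) :
    poset.{u} P ⟶ poset.{u} Q :=
  (Monotone.functor (f := fun x : ULift.{u} P => (ULift.up (f x.down) : ULift.{u} Q))
    (fun _ _ h => hf h)).toCatHom

/-- The category `[1] = (0 < 1)`. -/
abbrev arrow : Cat.{u, u} := poset.{u} (Fin 2)

/-- The square `[1] × [1]`. -/
abbrev square : Cat.{u, u} := poset.{u} (Fin 2 × Fin 2)

/-- The span `⌜`: the square without its final corner `(1,1)`. -/
abbrev span : Cat.{u, u} := poset.{u} {x : Fin 2 × Fin 2 // x ≠ (1, 1)}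

/-- The cospan `⌟`: the square without its initial corner `(0,0)`. -/
abbrev cospan : Cat.{u, u} := poset.{u} {x : Fin 2 × Fin 2 // x ≠ (0, 0)}

/-- The inclusion of the span into the square. -/
def spanIncl : span.{u} ⟶ square.{u} := posetMap Subtype.val (fun _ _ h => h)

/-- The inclusion of the cospan into the square. -/
def cospanIncl : cospan.{u} ⟶ square.{u} := posetMap Subtype.val (fun _ _ h => h)

/-- The functor `[1] ⟶ ⌜` classifying the horizontal morphism `(0,0) ⟶ (1,0)`. -/
def arrowToSpan : arrow.{u} ⟶ span.{u} :=
  posetMap (fun k => ⟨(k, 0), by simp⟩) (fun _ _ h => ⟨h, le_rfl⟩)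

/-- The functor `[1] ⟶ ⌟` classifying the vertical morphism `(1,0) ⟶ (1,1)`. -/
def arrowToCospan : arrow.{u} ⟶ cospan.{u} :=
  posetMap (fun k => ⟨(1, k), by simp⟩) (fun _ _ h => ⟨le_rfl, h⟩)

/-! ### Cones, fibers, and adjoint tuples -/

/-- The Kan extension morphisms that enter the construction of the cone morphism: right Kan
extension along `[1] ⟶ ⌜` and left Kan extension along `⌜ ⟶ [1] × [1]`. -/
structure ConeData where
  /-- right Kan extension along `[1] ⟶ ⌜` -/
  toSpan : D.RightKan arrowToSpan.{u}
  /-- left Kan extension along `⌜ ⟶ [1] × [1]` -/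
  toSquare : D.LeftKan spanIncl.{u}

/-- The cone morphism `C : D^[1] ⟶ D`: extend `x ⟶ y` to a span by a terminal object, form the
cocartesian square, and evaluate at `(1,1)`. -/
def ConeData.cone {D : Prederivator.{u, v, w}} (c : D.ConeData) :
    (D.shift arrow.{u}).toPseudofunctor ⟶ D.toPseudofunctor :=
  c.toSpan.right ≫ c.toSquare.left ≫ D.ev (A := square.{u}) (ULift.up (1, 1))

/-- The Kan extension morphisms that enter the construction of the fiber morphism: left Kan
extension along `[1] ⟶ ⌟` and right Kan extension along `⌟ ⟶ [1] × [1]`. -/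
structure FiberData where
  /-- left Kan extension along `[1] ⟶ ⌟` -/
  toCospan : D.LeftKan arrowToCospan.{u}
  /-- right Kan extension along `⌟ ⟶ [1] × [1]` -/
  toSquare : D.RightKan cospanIncl.{u}

/-- The fiber morphism `F : D^[1] ⟶ D`: extend `x ⟶ y` to a cospan by an initial object, form the
cartesian square, and evaluate at `(0,0)`. -/
def FiberData.fiber {D : Prederivator.{u, v, w}} (f : D.FiberData) :
    (D.shift arrow.{u}).toPseudofunctor ⟶ D.toPseudofunctor :=
  f.toCospan.left ≫ f.toSquare.right ≫ D.ev (A := square.{u}) (ULift.up (0, 0))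

/-- The evaluation `0^* : D^[1] ⟶ D`. -/
abbrev ev₀ : (D.shift arrow.{u}).toPseudofunctor ⟶ D.toPseudofunctor :=
  D.ev (A := arrow.{u}) (ULift.up 0)

/-- The evaluation `1^* : D^[1] ⟶ D`. -/
abbrev ev₁ : (D.shift arrow.{u}).toPseudofunctor ⟶ D.toPseudofunctor :=
  D.ev (A := arrow.{u}) (ULift.up 1)

/-- The adjoint 5-tuple `1_! ⊣ 1^* ⊣ π^* ⊣ 0^* ⊣ 0_*` of morphisms between `D` and `D^[1]`. The
three middle morphisms are the restriction morphisms; the outer ones are the left Kan extension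
along `1` and the right Kan extension along `0`, i.e. adjoints of `1^*` and of `0^*`. -/
structure AdjointFiveTuple where
  /-- the left Kan extension morphism `1_!` -/
  lan₁ : D.toPseudofunctor ⟶ (D.shift arrow.{u}).toPseudofunctor
  /-- the right Kan extension morphism `0_*` -/
  ran₀ : D.toPseudofunctor ⟶ (D.shift arrow.{u}).toPseudofunctor
  /-- `1_! ⊣ 1^*` -/
  adjLan₁ : Bicategory.Adjunction lan₁ D.ev₁
  /-- `1^* ⊣ π^*` -/
  adjEv₁ : Bicategory.Adjunction D.ev₁ (D.const arrow.{u})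
  /-- `π^* ⊣ 0^*` -/
  adjConst : Bicategory.Adjunction (D.const arrow.{u}) D.ev₀
  /-- `0^* ⊣ 0_*` -/
  adjEv₀ : Bicategory.Adjunction D.ev₀ ran₀

/-- An extension of an adjoint 5-tuple to an adjoint 7-tuple
`outerLeft ⊣ 1_! ⊣ 1^* ⊣ π^* ⊣ 0^* ⊣ 0_* ⊣ outerRight`. -/
structure AdjointFiveTuple.Extension {D : Prederivator.{u, v, w}} (T : D.AdjointFiveTuple) where
  /-- the additional left adjoint -/
  outerLeft : (D.shift arrow.{u}).toPseudofunctor ⟶ D.toPseudofunctor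
  /-- the additional right adjoint -/
  outerRight : (D.shift arrow.{u}).toPseudofunctor ⟶ D.toPseudofunctor
  /-- `outerLeft ⊣ 1_!` -/
  adjOuterLeft : Bicategory.Adjunction outerLeft T.lan₁
  /-- `0_* ⊣ outerRight` -/
  adjOuterRight : Bicategory.Adjunction T.ran₀ outerRight

end Prederivator

/-! An adjunction between pseudo-natural transformations with values in `Cat` is a family of
adjunctions whose units and counits are modifications, and half of this data is enough. A
modification with universal components is the unit of an adjunction (`nonempty_adjunction_of_unit`,
dually `nonempty_adjunction_of_counit`), and componentwise adjoints with invertible Beck-Chevalley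
mates assemble into an adjoint morphism (`nonempty_leftAdjoint`, `nonempty_rightAdjoint`).

Existence of Kan extension morphisms: the Beck-Chevalley condition for `p × M` and `f : N ⥤ M` is
checked at the objects of `B × N` by Der2 and Der4. The slice of `p × M` over `(b, m)` has `(p / b)`
as a reflective subcategory, whatever `m` is, so the slices for `N` and for `M` compute the same
extension. Pasting with the comma squares gives `isLan_baseChange_prod`. The inner adjunctions of
the 5-tuple come from the projection of `[1] × M`, which is adjoint to the inclusions at the
terminal object 1 and at the initial object 0. The outer ones are Kan extensions along a point.

If `1_!` has a left adjoint, then it preserves terminal objects, and so does `0^*`. Hence `0^* 1_!`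
of a terminal object is terminal. It is also initial, because the slice of `1` over `0` is empty and
Der1 for the empty family makes Kan extensions from an empty category initial. So `D` is pointed.

Conversely, let `D` be pointed, so that `1_! X` is `0 → X`. For `f` in `D^[1]` let `Y` be the
cocartesian square on `i_* f`; its value at `(0,1)` is zero and its lower row is `0 → C f`. Then
maps `C f → X` are maps from the lower row of `Y` to `1_! X`, hence maps from `Y` to the square
pulled back from `1_! X` along the first projection, hence maps of spans out of `i_* f`. The target
span also vanishes at `(0,1)`, so these are maps `f → 1_! X`. `bijective_cone_unit` is this chain in
formal terms. Its hypotheses are isomorphisms checked pointwise, by full faithfulness along the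
image of a Kan extension and by vanishing at the remaining corner. The fiber is dual, and uniqueness
of adjoints gives the last claim. -/

namespace CategoryTheory

/-! ### Adjunctions from universal arrows. -/

section UniversalArrows

variable {C : Type u₁} [Category.{v₁} C] {D : Type u₂} [Category.{v₂} D]

/-- A family of universal arrows is the unit of an adjunction. -/
noncomputable def Adjunction.ofUniversalUnit {F : C ⥤ D} {G : D ⥤ C} (η : 𝟭 C ⟶ F ⋙ G)
    (h : ∀ X Y, Function.Bijective fun φ : F.obj X ⟶ Y => η.app X ≫ G.map φ) : F ⊣ G :=
  Adjunction.mkOfHomEquiv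
    { homEquiv := fun X Y => Equiv.ofBijective _ (h X Y)
      homEquiv_naturality_left_symm := fun {X' X Y} f g => by
        apply (h _ _).1
        have h₁ := (Equiv.ofBijective _ (h X Y)).apply_symm_apply g
        have h₂ := (Equiv.ofBijective _ (h X' Y)).apply_symm_apply (f ≫ g)
        have h₃ := η.naturality f
        simp only [Equiv.ofBijective_apply, Functor.id_map, Functor.comp_map] at h₁ h₂ h₃
        simp only [Functor.map_comp, ← reassoc_of% h₃, h₁, h₂]
      homEquiv_naturality_right := fun f g => by simp }

@[simp]
lemma Adjunction.ofUniversalUnit_unit {F : C ⥤ D} {G : D ⥤ C} (η : 𝟭 C ⟶ F ⋙ G)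
    (h : ∀ X Y, Function.Bijective fun φ : F.obj X ⟶ Y => η.app X ≫ G.map φ) :
    (Adjunction.ofUniversalUnit η h).unit = η := by
  ext X
  simp [Adjunction.ofUniversalUnit]

/-- A family of couniversal arrows is the counit of an adjunction. -/
noncomputable def Adjunction.ofUniversalCounit {F : C ⥤ D} {G : D ⥤ C} (κ : G ⋙ F ⟶ 𝟭 D)
    (h : ∀ X Y, Function.Bijective fun φ : X ⟶ G.obj Y => F.map φ ≫ κ.app Y) : F ⊣ G :=
  Adjunction.mkOfHomEquiv
    { homEquiv := fun X Y => (Equiv.ofBijective _ (h X Y)).symm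
      homEquiv_naturality_left_symm := fun f g => by simp
      homEquiv_naturality_right := fun {X Y Y'} f g => by
        apply (h _ _).1
        have h₁ := (Equiv.ofBijective _ (h X Y)).apply_symm_apply f
        have h₂ := (Equiv.ofBijective _ (h X Y')).apply_symm_apply (f ≫ g)
        have h₃ := κ.naturality g
        simp only [Equiv.ofBijective_apply, Functor.id_map, Functor.comp_map] at h₁ h₂ h₃
        simp only [Functor.map_comp, Category.assoc, h₃, reassoc_of% h₁, h₂] }

@[simp]
lemma Adjunction.ofUniversalCounit_counit {F : C ⥤ D} {G : D ⥤ C} (κ : G ⋙ F ⟶ 𝟭 D)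
    (h : ∀ X Y, Function.Bijective fun φ : X ⟶ G.obj Y => F.map φ ≫ κ.app Y) :
    (Adjunction.ofUniversalCounit κ h).counit = κ := by
  ext X
  simp [Adjunction.ofUniversalCounit]

end UniversalArrows

lemma inv_comp_eq_comp_inv {C : Type*} [Category* C] {W X Y Z : C} (s : W ≅ X) {x : X ⟶ Z}
    {y : W ⟶ Y} {t : Y ⟶ Z} [IsIso t] (h : s.hom ≫ x = y ≫ t) : s.inv ≫ y = x ≫ inv t := by
  rw [Iso.inv_comp_eq, ← Category.assoc, h, Category.assoc, IsIso.hom_inv_id, Category.comp_id]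

/-! ### Mates at a single object and their coherence. -/

section Mates

variable {C₁ : Type*} [Category* C₁] {C₂ : Type*} [Category* C₂] {C₃ : Type*} [Category* C₃]
  {D₁ : Type*} [Category* D₁] {D₂ : Type*} [Category* D₂] {D₃ : Type*} [Category* D₃]
  {l₁ : C₁ ⥤ D₁} {r₁ : D₁ ⥤ C₁} {l₂ : C₂ ⥤ D₂} {r₂ : D₂ ⥤ C₂} {l₃ : C₃ ⥤ D₃} {r₃ : D₃ ⥤ C₃}
  (adj₁ : l₁ ⊣ r₁) (adj₂ : l₂ ⊣ r₂) (adj₃ : l₃ ⊣ r₃)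

namespace Adjunction

/-- This lets a componentwise adjunction be upgraded once its unit is known to be a modification:
the modification axiom for the counit follows from the triangle identities. The proof transposes
along `adj₂` and cancels `ν`. -/
lemma counit_compatible_of_unit {p : C₁ ⥤ C₂} {q : D₁ ⥤ D₂} (μ : p ⋙ l₂ ≅ l₁ ⋙ q)
    (ν : q ⋙ r₂ ≅ r₁ ⋙ p)
    (h : ∀ X, adj₂.unit.app (p.obj X) ≫ r₂.map (μ.hom.app X) ≫ ν.hom.app (l₁.obj X) =
      p.map (adj₁.unit.app X)) (Y : D₁) :
    l₂.map (ν.hom.app Y) ≫ μ.hom.app (r₁.obj Y) ≫ q.map (adj₁.counit.app Y) =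
      adj₂.counit.app (q.obj Y) := by
  have e₂ := adj₂.unit.naturality (ν.hom.app Y)
  have e₃ := ν.hom.naturality (adj₁.counit.app Y)
  have e₄ := h (r₁.obj Y)
  apply (adj₂.homEquiv _ _).injective
  simp only [Functor.id_map, Functor.comp_map, Functor.comp_obj, Functor.id_obj] at e₂ e₃ e₄
  simp only [homEquiv_unit, Functor.map_comp, Functor.comp_obj, Functor.id_obj,
    right_triangle_components]
  rw [← cancel_mono (ν.hom.app Y)]
  simp only [Category.assoc, e₃, ← reassoc_of% e₂, reassoc_of% e₄]
  simp only [Functor.comp_obj, ← Functor.map_comp, right_triangle_components]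
  simp

lemma unit_compatible_of_counit {p : C₁ ⥤ C₂} {q : D₁ ⥤ D₂} (μ : p ⋙ l₂ ≅ l₁ ⋙ q)
    (ν : q ⋙ r₂ ≅ r₁ ⋙ p)
    (h : ∀ Y, l₂.map (ν.hom.app Y) ≫ μ.hom.app (r₁.obj Y) ≫ q.map (adj₁.counit.app Y) =
      adj₂.counit.app (q.obj Y)) (X : C₁) :
    adj₂.unit.app (p.obj X) ≫ r₂.map (μ.hom.app X) ≫ ν.hom.app (l₁.obj X) =
      p.map (adj₁.unit.app X) := by
  have e₂ := adj₂.counit.naturality (μ.hom.app X)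
  have e₃ := μ.hom.naturality (adj₁.unit.app X)
  have e₄ := h (l₁.obj X)
  simp only [Functor.id_map, Functor.comp_map, Functor.comp_obj, Functor.id_obj] at e₂ e₃ e₄
  rw [← cancel_mono (ν.inv.app _)]
  apply (adj₂.homEquiv _ _).symm.injective
  have e₅ : l₂.map (ν.inv.app (l₁.obj X)) ≫ l₂.map (ν.hom.app (l₁.obj X)) = 𝟙 _ := by
    rw [← Functor.map_comp, Iso.inv_hom_id_app, Functor.map_id]
  simp only [homEquiv_counit, Functor.map_comp, Functor.comp_obj, Functor.id_obj, Category.assoc,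
    Iso.hom_inv_id_app, Category.comp_id, e₂, left_triangle_components_assoc]
  simp only [← e₄, reassoc_of% e₅, reassoc_of% e₃]
  simp only [← Functor.map_comp, left_triangle_components]
  simp

/-- The mate of a natural isomorphism between right adjoints, at an object. -/
def leftMateAt {p : C₁ ⥤ C₂} {q : D₁ ⥤ D₂} (ν : q ⋙ r₂ ≅ r₁ ⋙ p) (X : C₁) :
    l₂.obj (p.obj X) ⟶ q.obj (l₁.obj X) :=
  (adj₂.homEquiv _ _).symm (p.map (adj₁.unit.app X) ≫ ν.inv.app (l₁.obj X))

@[simp]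
lemma unit_leftMateAt {p : C₁ ⥤ C₂} {q : D₁ ⥤ D₂} (ν : q ⋙ r₂ ≅ r₁ ⋙ p) (X : C₁) :
    adj₂.unit.app (p.obj X) ≫ r₂.map (leftMateAt adj₁ adj₂ ν X) =
      p.map (adj₁.unit.app X) ≫ ν.inv.app (l₁.obj X) := by
  simp [← homEquiv_unit, leftMateAt]

@[simp]
lemma unit_leftMateAt_assoc {p : C₁ ⥤ C₂} {q : D₁ ⥤ D₂} (ν : q ⋙ r₂ ≅ r₁ ⋙ p) (X : C₁) {Z : C₂}
    (g : r₂.obj (q.obj (l₁.obj X)) ⟶ Z) :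
    adj₂.unit.app (p.obj X) ≫ r₂.map (leftMateAt adj₁ adj₂ ν X) ≫ g =
      p.map (adj₁.unit.app X) ≫ ν.inv.app (l₁.obj X) ≫ g := by
  rw [← Category.assoc, unit_leftMateAt, Category.assoc]

lemma leftMateAt_naturality {p : C₁ ⥤ C₂} {q : D₁ ⥤ D₂} (ν : q ⋙ r₂ ≅ r₁ ⋙ p) {X Y : C₁}
    (f : X ⟶ Y) :
    l₂.map (p.map f) ≫ leftMateAt adj₁ adj₂ ν Y =
      leftMateAt adj₁ adj₂ ν X ≫ q.map (l₁.map f) := by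
  apply (adj₂.homEquiv _ _).injective
  have h := ν.inv.naturality (l₁.map f)
  have e := congrArg p.map (adj₁.unit.naturality f)
  simp only [Functor.comp_map, Functor.id_map, Functor.map_comp] at h e
  simp [homEquiv_unit, ← h, reassoc_of% e]

/-- Together with `leftMateAt_id` and `leftMateAt_comp`, this provides the axioms of a strong
transformation for a family of left adjoints. Each axiom is inherited from the corresponding one for
the right adjoints, by transposing both sides. -/
lemma leftMateAt_naturality₂ {p p' : C₁ ⥤ C₂} {q q' : D₁ ⥤ D₂} (ν : q ⋙ r₂ ≅ r₁ ⋙ p)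
    (ν' : q' ⋙ r₂ ≅ r₁ ⋙ p') (θ : p ⟶ p') (τ : q ⟶ q')
    (h : ∀ Y, r₂.map (τ.app Y) ≫ ν'.hom.app Y = ν.hom.app Y ≫ θ.app (r₁.obj Y)) (X : C₁) :
    l₂.map (θ.app X) ≫ leftMateAt adj₁ adj₂ ν' X =
      leftMateAt adj₁ adj₂ ν X ≫ τ.app (l₁.obj X) := by
  apply (adj₂.homEquiv _ _).injective
  have h' : ν.inv.app (l₁.obj X) ≫ r₂.map (τ.app (l₁.obj X)) =
      θ.app (r₁.obj (l₁.obj X)) ≫ ν'.inv.app (l₁.obj X) := by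
    rw [← cancel_mono (ν'.hom.app _), Category.assoc, h]
    simp
  have h₂ := θ.naturality (adj₁.unit.app X)
  simp only [Functor.comp_obj, Functor.id_obj] at h₂
  simp [homEquiv_unit, h', reassoc_of% h₂]

lemma leftMateAt_id {p : C₁ ⥤ C₁} {q : D₁ ⥤ D₁} (ν : q ⋙ r₁ ≅ r₁ ⋙ p) (θ : p ⟶ 𝟭 C₁)
    (τ : q ⟶ 𝟭 D₁)
    (h : ∀ Y, ν.hom.app Y ≫ θ.app (r₁.obj Y) = r₁.map (τ.app Y)) (X : C₁) :
    leftMateAt adj₁ adj₁ ν X ≫ τ.app (l₁.obj X) = l₁.map (θ.app X) := by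
  apply (adj₁.homEquiv _ _).injective
  have h₂ := θ.naturality (adj₁.unit.app X)
  simp only [Functor.comp_obj, Functor.id_obj, Functor.id_map] at h₂
  simp [homEquiv_unit, ← h, h₂]

lemma leftMateAt_comp {p : C₁ ⥤ C₂} {q : D₁ ⥤ D₂} {p' : C₂ ⥤ C₃} {q' : D₂ ⥤ D₃} {p'' : C₁ ⥤ C₃}
    {q'' : D₁ ⥤ D₃} (ν : q ⋙ r₂ ≅ r₁ ⋙ p) (ν' : q' ⋙ r₃ ≅ r₂ ⋙ p')
    (ν'' : q'' ⋙ r₃ ≅ r₁ ⋙ p'') (θ : p'' ⟶ p ⋙ p') (τ : q'' ⟶ q ⋙ q')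
    (h : ∀ Y, ν''.hom.app Y ≫ θ.app (r₁.obj Y) =
      r₃.map (τ.app Y) ≫ ν'.hom.app (q.obj Y) ≫ p'.map (ν.hom.app Y)) (X : C₁) :
    leftMateAt adj₁ adj₃ ν'' X ≫ τ.app (l₁.obj X) =
      l₃.map (θ.app X) ≫ leftMateAt adj₂ adj₃ ν' (p.obj X) ≫
        q'.map (leftMateAt adj₁ adj₂ ν X) := by
  apply (adj₃.homEquiv _ _).injective
  have h' : ν''.inv.app (l₁.obj X) ≫ r₃.map (τ.app (l₁.obj X)) =
      θ.app (r₁.obj (l₁.obj X)) ≫ p'.map (ν.inv.app (l₁.obj X)) ≫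
        ν'.inv.app (q.obj (l₁.obj X)) := by
    rw [← cancel_epi (ν''.hom.app _), reassoc_of% h, Iso.hom_inv_id_app_assoc,
      ← Functor.map_comp_assoc, Iso.hom_inv_id_app]
    simp
  have h₂ := θ.naturality (adj₁.unit.app X)
  have h₃ := ν'.inv.naturality (leftMateAt adj₁ adj₂ ν X)
  have e := congrArg p'.map (unit_leftMateAt adj₁ adj₂ ν X)
  simp only [Functor.comp_obj, Functor.id_obj, Functor.comp_map, Functor.map_comp] at h₂ h₃ e
  simp [homEquiv_unit, h', reassoc_of% h₂, ← h₃, reassoc_of% e]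

/-- The mate of a natural isomorphism between left adjoints, at an object. -/
def rightMateAt {p : C₁ ⥤ C₂} {q : D₁ ⥤ D₂} (μ : p ⋙ l₂ ≅ l₁ ⋙ q) (Y : D₁) :
    p.obj (r₁.obj Y) ⟶ r₂.obj (q.obj Y) :=
  adj₂.homEquiv _ _ (μ.hom.app (r₁.obj Y) ≫ q.map (adj₁.counit.app Y))

@[simp]
lemma rightMateAt_counit {p : C₁ ⥤ C₂} {q : D₁ ⥤ D₂} (μ : p ⋙ l₂ ≅ l₁ ⋙ q) (Y : D₁) :
    l₂.map (rightMateAt adj₁ adj₂ μ Y) ≫ adj₂.counit.app (q.obj Y) =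
      μ.hom.app (r₁.obj Y) ≫ q.map (adj₁.counit.app Y) := by
  simp [← homEquiv_counit, rightMateAt]

@[simp]
lemma rightMateAt_counit_assoc {p : C₁ ⥤ C₂} {q : D₁ ⥤ D₂} (μ : p ⋙ l₂ ≅ l₁ ⋙ q) (Y : D₁) {Z : D₂}
    (g : q.obj Y ⟶ Z) :
    l₂.map (rightMateAt adj₁ adj₂ μ Y) ≫ adj₂.counit.app (q.obj Y) ≫ g =
      μ.hom.app (r₁.obj Y) ≫ q.map (adj₁.counit.app Y) ≫ g := by
  rw [← Category.assoc, rightMateAt_counit, Category.assoc]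

lemma rightMateAt_naturality {p : C₁ ⥤ C₂} {q : D₁ ⥤ D₂} (μ : p ⋙ l₂ ≅ l₁ ⋙ q) {X Y : D₁}
    (f : X ⟶ Y) :
    p.map (r₁.map f) ≫ rightMateAt adj₁ adj₂ μ Y =
      rightMateAt adj₁ adj₂ μ X ≫ r₂.map (q.map f) := by
  apply (adj₂.homEquiv _ _).symm.injective
  have h := μ.hom.naturality (r₁.map f)
  have e := congrArg q.map (adj₁.counit.naturality f)
  simp only [Functor.comp_map, Functor.id_map, Functor.map_comp] at h e
  simp [homEquiv_counit, reassoc_of% h, e]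

lemma rightMateAt_naturality₂ {p p' : C₁ ⥤ C₂} {q q' : D₁ ⥤ D₂} (μ : p ⋙ l₂ ≅ l₁ ⋙ q)
    (μ' : p' ⋙ l₂ ≅ l₁ ⋙ q') (θ : p ⟶ p') (τ : q ⟶ q')
    (h : ∀ X, l₂.map (θ.app X) ≫ μ'.hom.app X = μ.hom.app X ≫ τ.app (l₁.obj X)) (Y : D₁) :
    θ.app (r₁.obj Y) ≫ rightMateAt adj₁ adj₂ μ' Y =
      rightMateAt adj₁ adj₂ μ Y ≫ r₂.map (τ.app Y) := by
  apply (adj₂.homEquiv _ _).symm.injective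
  simp [homEquiv_counit, reassoc_of% h]

lemma rightMateAt_id {p : C₁ ⥤ C₁} {q : D₁ ⥤ D₁} (μ : p ⋙ l₁ ≅ l₁ ⋙ q) (θ : p ⟶ 𝟭 C₁)
    (τ : q ⟶ 𝟭 D₁)
    (h : ∀ X, μ.hom.app X ≫ τ.app (l₁.obj X) = l₁.map (θ.app X)) (Y : D₁) :
    rightMateAt adj₁ adj₁ μ Y ≫ r₁.map (τ.app Y) = θ.app (r₁.obj Y) := by
  apply (adj₁.homEquiv _ _).symm.injective
  simp [homEquiv_counit, ← h]

lemma rightMateAt_comp {p : C₁ ⥤ C₂} {q : D₁ ⥤ D₂} {p' : C₂ ⥤ C₃} {q' : D₂ ⥤ D₃}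
    {p'' : C₁ ⥤ C₃} {q'' : D₁ ⥤ D₃} (μ : p ⋙ l₂ ≅ l₁ ⋙ q) (μ' : p' ⋙ l₃ ≅ l₂ ⋙ q')
    (μ'' : p'' ⋙ l₃ ≅ l₁ ⋙ q'') (θ : p'' ⟶ p ⋙ p') (τ : q'' ⟶ q ⋙ q')
    (h : ∀ X, μ''.hom.app X ≫ τ.app (l₁.obj X) =
      l₃.map (θ.app X) ≫ μ'.hom.app (p.obj X) ≫ q'.map (μ.hom.app X)) (Y : D₁) :
    rightMateAt adj₁ adj₃ μ'' Y ≫ r₃.map (τ.app Y) =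
      θ.app (r₁.obj Y) ≫ p'.map (rightMateAt adj₁ adj₂ μ Y) ≫
        rightMateAt adj₂ adj₃ μ' (q.obj Y) := by
  apply (adj₃.homEquiv _ _).symm.injective
  have h₂ := μ'.hom.naturality (rightMateAt adj₁ adj₂ μ Y)
  have h₃ := τ.naturality (adj₁.counit.app Y)
  have h₄ := h (r₁.obj Y)
  have e := congrArg q'.map (rightMateAt_counit adj₁ adj₂ μ Y)
  simp only [Functor.comp_obj, Functor.id_obj, Functor.comp_map, Functor.map_comp] at h₂ h₃ h₄ e
  simp [homEquiv_counit, h₃, reassoc_of% h₂, reassoc_of% h₄, e]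

end Adjunction

end Mates

/-! ### Adjunctions between strong transformations with values in `Cat`. -/

namespace Pseudofunctor.StrongTrans

variable {B : Type u} [Bicategory.{w, v} B] {P Q : Pseudofunctor B Cat.{v₁, u₁}}

/-- The naturality isomorphism of a strong transformation, at an object. -/
def natAt (l : P ⟶ Q) {a b : B} (f : a ⟶ b) (X : P.obj a) :
    (l.app b).toFunctor.obj ((P.map f).toFunctor.obj X) ≅
      (Q.map f).toFunctor.obj ((l.app a).toFunctor.obj X) :=
  (Cat.Hom.toNatIso (l.naturality f)).app X

/-- This is the modification axiom for `η` at an object. The associators and unitors in it have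
identity components in `Cat`, by definition, and only need to be cancelled. -/
lemma unit_naturality_app {l : P ⟶ Q} {r : Q ⟶ P} (η : 𝟙 P ⟶ l ≫ r) {a b : B} (f : a ⟶ b)
    (X : P.obj a) :
    ((η.as.app b).toNatTrans.app ((P.map f).toFunctor.obj X) :
        (P.map f).toFunctor.obj X ⟶
          (r.app b).toFunctor.obj ((l.app b).toFunctor.obj ((P.map f).toFunctor.obj X))) ≫
      (r.app b).toFunctor.map (l.natAt f X).hom ≫
        (r.natAt f ((l.app a).toFunctor.obj X)).hom =
      (P.map f).toFunctor.map ((η.as.app a).toNatTrans.app X) := by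
  have h : ((η.as.app b).toNatTrans.app ((P.map f).toFunctor.obj X) :
        (P.map f).toFunctor.obj X ⟶
          (r.app b).toFunctor.obj ((l.app b).toFunctor.obj ((P.map f).toFunctor.obj X))) ≫ 𝟙 _ ≫
      (r.app b).toFunctor.map (l.natAt f X).hom ≫ 𝟙 _ ≫
        (r.natAt f ((l.app a).toFunctor.obj X)).hom ≫ 𝟙 _ =
      (𝟙 _ ≫ 𝟙 _) ≫ (P.map f).toFunctor.map ((η.as.app a).toNatTrans.app X) :=
    congr($(η.as.naturality f).toNatTrans.app X)
  simp only [Category.id_comp, Category.comp_id] at h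
  exact h

lemma counit_naturality_app {l : P ⟶ Q} {r : Q ⟶ P} (κ : r ≫ l ⟶ 𝟙 Q) {a b : B} (f : a ⟶ b)
    (X : Q.obj a) :
    (l.app b).toFunctor.map (r.natAt f X).hom ≫
        (l.natAt f ((r.app a).toFunctor.obj X)).hom ≫
      (Q.map f).toFunctor.map ((κ.as.app a).toNatTrans.app X) =
    (κ.as.app b).toNatTrans.app ((Q.map f).toFunctor.obj X) := by
  have h : (κ.as.app b).toNatTrans.app ((Q.map f).toFunctor.obj X) ≫ 𝟙 _ ≫ 𝟙 _ =
      (𝟙 _ ≫ (l.app b).toFunctor.map (r.natAt f X).hom ≫ 𝟙 _ ≫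
        (l.natAt f ((r.app a).toFunctor.obj X)).hom ≫ 𝟙 _) ≫
      (Q.map f).toFunctor.map ((κ.as.app a).toNatTrans.app X) :=
    congr($(κ.as.naturality f).toNatTrans.app X)
  simp only [Category.id_comp, Category.comp_id, Category.assoc] at h
  exact h.symm

/-- Modifications `𝟙 P ⟶ l ≫ r` are families of natural transformations that are compatible with
the naturality isomorphisms. -/
def mkUnit {l : P ⟶ Q} {r : Q ⟶ P}
    (η : ∀ a : B, 𝟭 (P.obj a) ⟶ (l.app a).toFunctor ⋙ (r.app a).toFunctor)
    (h : ∀ {a b : B} (f : a ⟶ b) (X : P.obj a),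
      (η b).app ((P.map f).toFunctor.obj X) ≫ (r.app b).toFunctor.map (l.natAt f X).hom ≫
        (r.natAt f ((l.app a).toFunctor.obj X)).hom = (P.map f).toFunctor.map ((η a).app X)) :
    𝟙 P ⟶ l ≫ r where
  as :=
  { app := fun a => NatTrans.toCatHom₂ (η a)
    naturality := fun {a b} f => by
      apply Cat.Hom₂.ext
      apply NatTrans.ext
      funext X
      change (η b).app ((P.map f).toFunctor.obj X) ≫ 𝟙 _ ≫
        (r.app b).toFunctor.map (l.natAt f X).hom ≫ 𝟙 _ ≫
        (r.natAt f ((l.app a).toFunctor.obj X)).hom ≫ 𝟙 _ =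
        (𝟙 _ ≫ 𝟙 _) ≫ (P.map f).toFunctor.map ((η a).app X)
      simp only [Category.id_comp, Category.comp_id]
      exact h f X }

/-- Modifications `r ≫ l ⟶ 𝟙 Q` are families of natural transformations that are compatible with
the naturality isomorphisms. -/
def mkCounit {l : P ⟶ Q} {r : Q ⟶ P}
    (κ : ∀ a : B, (r.app a).toFunctor ⋙ (l.app a).toFunctor ⟶ 𝟭 (Q.obj a))
    (h : ∀ {a b : B} (f : a ⟶ b) (X : Q.obj a),
      (l.app b).toFunctor.map (r.natAt f X).hom ≫
        (l.natAt f ((r.app a).toFunctor.obj X)).hom ≫ (Q.map f).toFunctor.map ((κ a).app X) =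
      (κ b).app ((Q.map f).toFunctor.obj X)) :
    r ≫ l ⟶ 𝟙 Q where
  as :=
  { app := fun a => NatTrans.toCatHom₂ (κ a)
    naturality := fun {a b} f => by
      apply Cat.Hom₂.ext
      apply NatTrans.ext
      funext X
      change (κ b).app ((Q.map f).toFunctor.obj X) ≫ 𝟙 _ ≫ 𝟙 _ =
        (𝟙 _ ≫ (l.app b).toFunctor.map (r.natAt f X).hom ≫ 𝟙 _ ≫
          (l.natAt f ((r.app a).toFunctor.obj X)).hom ≫ 𝟙 _) ≫
        (Q.map f).toFunctor.map ((κ a).app X)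
      simp only [Category.id_comp, Category.comp_id, Category.assoc]
      exact (h f X).symm }

/-- Adjunctions between strong transformations are componentwise adjunctions whose units and
counits are modifications. -/
def mkAdjunction {l : P ⟶ Q} {r : Q ⟶ P} (η : 𝟙 P ⟶ l ≫ r) (κ : r ≫ l ⟶ 𝟙 Q)
    (adj : ∀ a : B, (l.app a).toFunctor ⊣ (r.app a).toFunctor)
    (hη : ∀ a, (η.as.app a).toNatTrans = (adj a).unit)
    (hκ : ∀ a, (κ.as.app a).toNatTrans = (adj a).counit) :
    l ⊣ r where
  unit := η
  counit := κ
  left_triangle := by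
    refine homCategory.ext fun a => ?_
    have h := (adj a).toCat.left_triangle
    have e₁ : η.as.app a = (adj a).toCat.unit := Cat.Hom₂.ext (hη a)
    have e₂ : κ.as.app a = (adj a).toCat.counit := Cat.Hom₂.ext (hκ a)
    rw [← e₁, ← e₂] at h
    exact h
  right_triangle := by
    refine homCategory.ext fun a => ?_
    have h := (adj a).toCat.right_triangle
    have e₁ : η.as.app a = (adj a).toCat.unit := Cat.Hom₂.ext (hη a)
    have e₂ : κ.as.app a = (adj a).toCat.counit := Cat.Hom₂.ext (hκ a)
    rw [← e₁, ← e₂] at h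
    exact h

/-- A modification with universal components is the unit of an adjunction. -/
theorem nonempty_adjunction_of_unit {l : P ⟶ Q} {r : Q ⟶ P} (η : 𝟙 P ⟶ l ≫ r)
    (h : ∀ (a : B) (X : P.obj a) (Y : Q.obj a), Function.Bijective
      fun φ : (l.app a).toFunctor.obj X ⟶ Y =>
        ((η.as.app a).toNatTrans.app X : X ⟶ (r.app a).toFunctor.obj _) ≫
          (r.app a).toFunctor.map φ) :
    Nonempty (l ⊣ r) := by
  let adj (a : B) : (l.app a).toFunctor ⊣ (r.app a).toFunctor :=
    CategoryTheory.Adjunction.ofUniversalUnit (η.as.app a).toNatTrans (h a)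
  have hη (a : B) : (adj a).unit = (η.as.app a).toNatTrans :=
    CategoryTheory.Adjunction.ofUniversalUnit_unit _ _
  refine ⟨mkAdjunction η (mkCounit (fun a => (adj a).counit) fun {a b} f Y => ?_) adj
    (fun a => (hη a).symm) (fun a => rfl)⟩
  have hη' (a : B) (X : P.obj a) : (η.as.app a).toNatTrans.app X = (adj a).unit.app X := by
    rw [hη]
  refine (adj a).counit_compatible_of_unit (adj b) (Cat.Hom.toNatIso (l.naturality f))
    (Cat.Hom.toNatIso (r.naturality f)) (fun X => ?_) Y
  rw [← hη', ← hη']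
  exact unit_naturality_app η f X

/-- A modification with couniversal components is the counit of an adjunction. -/
theorem nonempty_adjunction_of_counit {l : P ⟶ Q} {r : Q ⟶ P} (κ : r ≫ l ⟶ 𝟙 Q)
    (h : ∀ (a : B) (X : P.obj a) (Y : Q.obj a), Function.Bijective
      fun φ : X ⟶ (r.app a).toFunctor.obj Y =>
        (l.app a).toFunctor.map φ ≫
          ((κ.as.app a).toNatTrans.app Y : (l.app a).toFunctor.obj _ ⟶ Y)) :
    Nonempty (l ⊣ r) := by
  let adj (a : B) : (l.app a).toFunctor ⊣ (r.app a).toFunctor :=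
    CategoryTheory.Adjunction.ofUniversalCounit (κ.as.app a).toNatTrans (h a)
  have hκ (a : B) : (adj a).counit = (κ.as.app a).toNatTrans :=
    CategoryTheory.Adjunction.ofUniversalCounit_counit _ _
  refine ⟨mkAdjunction (mkUnit (fun a => (adj a).unit) fun {a b} f X => ?_) κ adj
    (fun a => rfl) (fun a => (hκ a).symm)⟩
  have hκ' (a : B) (X : Q.obj a) : (κ.as.app a).toNatTrans.app X = (adj a).counit.app X := by
    rw [hκ]
  refine (adj a).unit_compatible_of_counit (adj b) (Cat.Hom.toNatIso (l.naturality f))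
    (Cat.Hom.toNatIso (r.naturality f)) (fun Y => ?_) X
  rw [← hκ', ← hκ']
  exact counit_naturality_app κ f Y

/-- The naturality isomorphism of a strong transformation, as an isomorphism of functors. -/
abbrev natIso (r : P ⟶ Q) {a b : B} (f : a ⟶ b) :
    (P.map f).toFunctor ⋙ (r.app b).toFunctor ≅ (r.app a).toFunctor ⋙ (Q.map f).toFunctor :=
  Cat.Hom.toNatIso (r.naturality f)

lemma natIso_naturality₂ (r : P ⟶ Q) {a b : B} {f g : a ⟶ b} (θ : f ⟶ g) (X : P.obj a) :
    (r.app b).toFunctor.map ((P.map₂ θ).toNatTrans.app X) ≫ (r.natIso g).hom.app X =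
      (r.natIso f).hom.app X ≫ (Q.map₂ θ).toNatTrans.app ((r.app a).toFunctor.obj X) :=
  congr($(r.naturality_naturality θ).toNatTrans.app X)

lemma natIso_id (r : P ⟶ Q) (a : B) (X : P.obj a) :
    (r.natIso (𝟙 a)).hom.app X ≫ (Q.mapId a).hom.toNatTrans.app ((r.app a).toFunctor.obj X) =
      (r.app a).toFunctor.map ((P.mapId a).hom.toNatTrans.app X) := by
  have h : (r.natIso (𝟙 a)).hom.app X ≫
        (Q.mapId a).hom.toNatTrans.app ((r.app a).toFunctor.obj X) =
      (r.app a).toFunctor.map ((P.mapId a).hom.toNatTrans.app X) ≫ 𝟙 _ ≫ 𝟙 _ :=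
    congr($(r.naturality_id a).toNatTrans.app X)
  rw [Category.comp_id] at h
  exact h.trans (Category.comp_id _)

lemma natIso_comp (r : P ⟶ Q) {a b c : B} (f : a ⟶ b) (g : b ⟶ c) (X : P.obj a) :
    (r.natIso (f ≫ g)).hom.app X ≫
        (Q.mapComp f g).hom.toNatTrans.app ((r.app a).toFunctor.obj X) =
      (r.app c).toFunctor.map ((P.mapComp f g).hom.toNatTrans.app X) ≫
        (r.natIso g).hom.app ((P.map f).toFunctor.obj X) ≫
          (Q.map g).toFunctor.map ((r.natIso f).hom.app X) := by
  have h : (r.natIso (f ≫ g)).hom.app X ≫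
        (Q.mapComp f g).hom.toNatTrans.app ((r.app a).toFunctor.obj X) =
      (r.app c).toFunctor.map ((P.mapComp f g).hom.toNatTrans.app X) ≫ 𝟙 _ ≫
        (r.natIso g).hom.app ((P.map f).toFunctor.obj X) ≫ 𝟙 _ ≫
          (Q.map g).toFunctor.map ((r.natIso f).hom.app X) ≫ 𝟙 _ :=
    congr($(r.naturality_comp f g).toNatTrans.app X)
  simp only [Category.comp_id, Category.id_comp] at h
  exact h

/-- Strong transformations, described by isomorphisms on objects. -/
noncomputable def mkOfNatIso (L : ∀ a : B, P.obj a ⥤ Q.obj a)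
    (σ : ∀ {a b : B} (f : a ⟶ b), (P.map f).toFunctor ⋙ L b ≅ L a ⋙ (Q.map f).toFunctor)
    (nat₂ : ∀ {a b : B} {f g : a ⟶ b} (θ : f ⟶ g) (X : P.obj a),
      (L b).map ((P.map₂ θ).toNatTrans.app X) ≫ (σ g).hom.app X =
        (σ f).hom.app X ≫ (Q.map₂ θ).toNatTrans.app ((L a).obj X))
    (id : ∀ (a : B) (X : P.obj a),
      (σ (𝟙 a)).hom.app X ≫ (Q.mapId a).hom.toNatTrans.app ((L a).obj X) =
        (L a).map ((P.mapId a).hom.toNatTrans.app X))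
    (comp : ∀ {a b c : B} (f : a ⟶ b) (g : b ⟶ c) (X : P.obj a),
      (σ (f ≫ g)).hom.app X ≫ (Q.mapComp f g).hom.toNatTrans.app ((L a).obj X) =
        (L c).map ((P.mapComp f g).hom.toNatTrans.app X) ≫
          (σ g).hom.app ((P.map f).toFunctor.obj X) ≫
            (Q.map g).toFunctor.map ((σ f).hom.app X)) : P ⟶ Q where
  app a := (L a).toCatHom
  naturality {a b} f := Cat.Hom.isoMk (F := (P.map f).toFunctor ⋙ L b)
    (G := L a ⋙ (Q.map f).toFunctor) (σ f)
  naturality_naturality θ := by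
    apply Cat.Hom₂.ext
    apply NatTrans.ext
    funext X
    exact nat₂ θ X
  naturality_id a := by
    apply Cat.Hom₂.ext
    apply NatTrans.ext
    funext X
    refine (id a X).trans (Eq.trans ?_ (congrArg _ (Category.comp_id _).symm))
    exact (Category.comp_id _).symm
  naturality_comp {a b c} f g := by
    apply Cat.Hom₂.ext
    apply NatTrans.ext
    funext X
    change (σ (f ≫ g)).hom.app X ≫ (Q.mapComp f g).hom.toNatTrans.app ((L a).obj X) =
        (L c).map ((P.mapComp f g).hom.toNatTrans.app X) ≫ 𝟙 _ ≫
          (σ g).hom.app ((P.map f).toFunctor.obj X) ≫ 𝟙 _ ≫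
            (Q.map g).toFunctor.map ((σ f).hom.app X) ≫ 𝟙 _
    simp only [Category.comp_id, Category.id_comp]
    exact comp f g X

/-- A strong transformation has a left adjoint as soon as its components have left adjoints that
satisfy the Beck-Chevalley condition. -/
theorem nonempty_leftAdjoint (r : Q ⟶ P) (L : ∀ a : B, P.obj a ⥤ Q.obj a)
    (adj : ∀ a : B, L a ⊣ (r.app a).toFunctor)
    (h : ∀ {a b : B} (f : a ⟶ b) (X : P.obj a),
      IsIso ((adj a).leftMateAt (adj b) (r.natIso f) X)) :
    Nonempty (LeftAdjoint r) := by
  let l : P ⟶ Q := mkOfNatIso L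
    (fun {a b} f => NatIso.ofComponents
      (fun X => @asIso _ _ _ _ ((adj a).leftMateAt (adj b) (r.natIso f) X) (h f X))
      fun g => (adj a).leftMateAt_naturality (adj b) (r.natIso f) g)
    (fun {a b f g} θ X => (adj a).leftMateAt_naturality₂ (adj b) _ _ (P.map₂ θ).toNatTrans
      (Q.map₂ θ).toNatTrans (fun Y => r.natIso_naturality₂ θ Y) X)
    (fun a X => (adj a).leftMateAt_id _ (P.mapId a).hom.toNatTrans
      (Q.mapId a).hom.toNatTrans (fun Y => r.natIso_id a Y) X)
    (fun {a b c} f g X => (adj a).leftMateAt_comp (adj b) (adj c) _ _ _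
      (P.mapComp f g).hom.toNatTrans (Q.mapComp f g).hom.toNatTrans
      (fun Y => r.natIso_comp f g Y) X)
  -- The naturality isomorphisms of `l` are the mates, so compatibility of the units is the defining
  -- property of a mate.
  let η : 𝟙 P ⟶ l ≫ r := mkUnit (fun a => (adj a).unit) fun {a b} f X => by
    have e := (adj a).unit_leftMateAt_assoc (adj b) (r.natIso f) X
      ((r.natIso f).hom.app ((L a).obj X))
    rw [Iso.inv_hom_id_app] at e
    exact e.trans (Category.comp_id _)
  obtain ⟨A⟩ := nonempty_adjunction_of_unit η fun a X Y => by
    have e := ((adj a).homEquiv X Y).bijective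
    rwa [show ⇑((adj a).homEquiv X Y) = fun φ => (adj a).unit.app X ≫ (r.app a).toFunctor.map φ
      from funext fun φ => (adj a).homEquiv_unit ..] at e
  exact ⟨⟨l, A⟩⟩

/-- A strong transformation has a right adjoint as soon as its components have right adjoints that
satisfy the Beck-Chevalley condition. -/
theorem nonempty_rightAdjoint (l : P ⟶ Q) (R : ∀ a : B, Q.obj a ⥤ P.obj a)
    (adj : ∀ a : B, (l.app a).toFunctor ⊣ R a)
    (h : ∀ {a b : B} (f : a ⟶ b) (Y : Q.obj a),
      IsIso ((adj a).rightMateAt (adj b) (l.natIso f) Y)) :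
    Nonempty (RightAdjoint l) := by
  let σ {a b : B} (f : a ⟶ b) : R a ⋙ (P.map f).toFunctor ≅ (Q.map f).toFunctor ⋙ R b :=
    NatIso.ofComponents
      (fun X => @asIso _ _ _ _ ((adj a).rightMateAt (adj b) (l.natIso f) X) (h f X))
      fun g => (adj a).rightMateAt_naturality (adj b) (l.natIso f) g
  -- The mates run against the direction required of the naturality isomorphisms of `r`, so every
  -- axiom is proved for `σ` first and then inverted.
  let r : Q ⟶ P := mkOfNatIso R (fun f => (σ f).symm)
    (fun {a b f g} θ Y => by
      have e : (P.map₂ θ).toNatTrans.app ((R a).obj Y) ≫ (σ g).hom.app Y =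
          (σ f).hom.app Y ≫ (R b).map ((Q.map₂ θ).toNatTrans.app Y) :=
        (adj a).rightMateAt_naturality₂ (adj b) _ _ (P.map₂ θ).toNatTrans
          (Q.map₂ θ).toNatTrans (fun X => l.natIso_naturality₂ θ X) Y
      rw [Iso.symm_hom, Iso.symm_hom, ← Iso.app_inv, ← Iso.app_inv, Iso.eq_inv_comp,
        ← Category.assoc, Iso.comp_inv_eq]
      exact e.symm)
    (fun a Y => by
      have e : (σ (𝟙 a)).hom.app Y ≫ (R a).map ((Q.mapId a).hom.toNatTrans.app Y) =
          (P.mapId a).hom.toNatTrans.app ((R a).obj Y) :=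
        (adj a).rightMateAt_id _ (P.mapId a).hom.toNatTrans (Q.mapId a).hom.toNatTrans
          (fun X => l.natIso_id a X) Y
      rw [Iso.symm_hom, ← Iso.app_inv, Iso.inv_comp_eq]
      exact e.symm)
    (fun {a b c} f g Y => by
      have e : (σ (f ≫ g)).hom.app Y ≫ (R c).map ((Q.mapComp f g).hom.toNatTrans.app Y) =
          (P.mapComp f g).hom.toNatTrans.app ((R a).obj Y) ≫
            (P.map g).toFunctor.map ((σ f).hom.app Y) ≫ (σ g).hom.app _ :=
        (adj a).rightMateAt_comp (adj b) (adj c) _ _ _ (P.mapComp f g).hom.toNatTrans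
          (Q.mapComp f g).hom.toNatTrans (fun X => l.natIso_comp f g X) Y
      have e' : (σ g).inv.app ((Q.map f).toFunctor.obj Y) ≫
          (P.map g).toFunctor.map ((σ f).inv.app Y) =
          inv ((P.map g).toFunctor.map ((σ f).hom.app Y) ≫ (σ g).hom.app _) := by
        rw [← cancel_epi ((P.map g).toFunctor.map ((σ f).hom.app Y) ≫ (σ g).hom.app _),
          IsIso.hom_inv_id, Category.assoc, Iso.hom_inv_id_app_assoc, ← Functor.map_comp,
          Iso.hom_inv_id_app]
        exact Functor.map_id _ _
      rw [Iso.symm_hom, Iso.symm_hom, Iso.symm_hom, e']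
      exact inv_comp_eq_comp_inv ((σ (f ≫ g)).app Y) e)
  let κ : r ≫ l ⟶ 𝟙 Q := mkCounit (fun a => (adj a).counit) fun {a b} f Y => by
    have e := (adj a).rightMateAt_counit (adj b) (l.natIso f) Y
    have e' : (l.app b).toFunctor.map ((σ f).inv.app Y) ≫ (l.app b).toFunctor.map
        ((adj a).rightMateAt (adj b) (l.natIso f) Y) = 𝟙 _ := by
      rw [← Functor.map_comp, ← Functor.map_id]
      exact congrArg _ ((σ f).inv_hom_id_app Y)
    refine (congrArg (fun t => _ ≫ t) e.symm).trans ?_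
    refine (Category.assoc _ _ _).symm.trans ((congrArg (fun t => t ≫ _) e').trans ?_)
    exact Category.id_comp _
  obtain ⟨A⟩ := nonempty_adjunction_of_counit κ fun a X Y => by
    have e := ((adj a).homEquiv X Y).symm.bijective
    rwa [show ⇑((adj a).homEquiv X Y).symm =
      fun φ => (l.app a).toFunctor.map φ ≫ (adj a).counit.app Y
      from funext fun φ => (adj a).homEquiv_counit ..] at e
  exact ⟨⟨r, A⟩⟩

end Pseudofunctor.StrongTrans
end CategoryTheory

/-! ### Calculus of restriction functors. -/

namespace Prederivator

variable (D : Prederivator.{u, v, w})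

section Restriction

variable {A B C E : Type u} [Category.{u} A] [Category.{u} B] [Category.{u} C] [Category.{u} E]

/-- The transformation of restriction functors induced by a natural transformation. -/
def resMap {f g : A ⥤ B} (α : f ⟶ g) : D.res f ⟶ D.res g :=
  (D.map₂ (Bicategory.Opposite.op2 (NatTrans.toCatHom₂ α))).toNatTrans

/-- Restriction along a composite. -/
def resComp (p : A ⥤ B) (f : B ⥤ C) : D.res f ⋙ D.res p ≅ D.res (p ⋙ f) :=
  Cat.Hom.toNatIso (D.mapComp f.toCatHom.op p.toCatHom.op).symm

/-- Restriction along an identity. -/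
def resId (A : Type u) [Category.{u} A] : D.res (𝟭 A) ≅ 𝟭 (D.val A) :=
  Cat.Hom.toNatIso (D.mapId (op (Cat.of A)))

lemma resMap_id (f : A ⥤ B) : D.resMap (𝟙 f) = 𝟙 (D.res f) :=
  congrArg Cat.Hom₂.toNatTrans (D.map₂_id f.toCatHom.op)

lemma resMap_comp {f g h : A ⥤ B} (α : f ⟶ g) (β : g ⟶ h) :
    D.resMap (α ≫ β) = D.resMap α ≫ D.resMap β :=
  congrArg Cat.Hom₂.toNatTrans (D.map₂_comp (Bicategory.Opposite.op2 (NatTrans.toCatHom₂ α))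
    (Bicategory.Opposite.op2 (NatTrans.toCatHom₂ β)))

/-- The isomorphism of restriction functors induced by a natural isomorphism. -/
def resIso {f g : A ⥤ B} (e : f ≅ g) : D.res f ≅ D.res g where
  hom := D.resMap e.hom
  inv := D.resMap e.inv
  hom_inv_id := by rw [← resMap_comp, e.hom_inv_id, resMap_id]
  inv_hom_id := by rw [← resMap_comp, e.inv_hom_id, resMap_id]

instance isIso_resMap {f g : A ⥤ B} (α : f ⟶ g) [IsIso α] : IsIso (D.resMap α) :=
  (D.resIso (asIso α)).isIso_hom

/-- The isomorphism of restrictions of an object induced by a composition of functors. -/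
def compAt (p : A ⥤ B) (f : B ⥤ C) (X : D.val C) :
    (D.res p).obj ((D.res f).obj X) ≅ (D.res (p ⋙ f)).obj X :=
  (D.resComp p f).app X

/-- Restriction of an object along an identity. -/
def idAt (X : D.val A) : (D.res (𝟭 A)).obj X ≅ X :=
  (D.resId A).app X

/-- The morphism between restrictions of an object induced by a natural transformation. -/
def mapAt {f g : A ⥤ B} (α : f ⟶ g) (X : D.val B) : (D.res f).obj X ⟶ (D.res g).obj X :=
  (D.resMap α).app X

instance isIso_mapAt {f g : A ⥤ B} (α : f ⟶ g) [IsIso α] (X : D.val B) : IsIso (D.mapAt α X) :=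
  inferInstanceAs (IsIso ((D.resMap α).app X))

@[simp]
lemma mapAt_id (f : A ⥤ B) (X : D.val B) : D.mapAt (𝟙 f) X = 𝟙 _ := by
  rw [mapAt, resMap_id, NatTrans.id_app]

lemma mapAt_comp {f g h : A ⥤ B} (α : f ⟶ g) (β : g ⟶ h) (X : D.val B) :
    D.mapAt (α ≫ β) X = D.mapAt α X ≫ D.mapAt β X := by
  rw [mapAt, resMap_comp, NatTrans.comp_app]
  rfl

lemma mapAt_naturality {f g : A ⥤ B} (α : f ⟶ g) {X Y : D.val B} (φ : X ⟶ Y) :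
    (D.res f).map φ ≫ D.mapAt α Y = D.mapAt α X ≫ (D.res g).map φ :=
  (D.resMap α).naturality φ

lemma compAt_naturality (p : A ⥤ B) (f : B ⥤ C) {X Y : D.val C} (φ : X ⟶ Y) :
    (D.res p).map ((D.res f).map φ) ≫ (D.compAt p f Y).hom =
      (D.compAt p f X).hom ≫ (D.res (p ⋙ f)).map φ :=
  (D.resComp p f).hom.naturality φ

lemma compAt_inv_naturality (p : A ⥤ B) (f : B ⥤ C) {X Y : D.val C} (φ : X ⟶ Y) :
    (D.res (p ⋙ f)).map φ ≫ (D.compAt p f Y).inv =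
      (D.compAt p f X).inv ≫ (D.res p).map ((D.res f).map φ) :=
  (D.resComp p f).inv.naturality φ

lemma idAt_naturality {X Y : D.val A} (φ : X ⟶ Y) :
    (D.res (𝟭 A)).map φ ≫ (D.idAt Y).hom = (D.idAt X).hom ≫ φ :=
  (D.resId A).hom.naturality φ

lemma idAt_inv_naturality {X Y : D.val A} (φ : X ⟶ Y) :
    φ ≫ (D.idAt Y).inv = (D.idAt X).inv ≫ (D.res (𝟭 A)).map φ :=
  (D.resId A).inv.naturality φ

/-- Passing to the opposite exchanges the two sides, so whiskering functors on the left corresponds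
to `map₂_whisker_right` of `D`. -/
lemma compAt_whiskerLeft (p : A ⥤ B) {f f' : B ⥤ C} (α : f ⟶ f') (X : D.val C) :
    (D.res p).map (D.mapAt α X) ≫ (D.compAt p f' X).hom =
      (D.compAt p f X).hom ≫ D.mapAt (Functor.whiskerLeft p α) X := by
  have h : D.mapAt (Functor.whiskerLeft p α) X = (D.compAt p f X).inv ≫
      (D.res p).map (D.mapAt α X) ≫ (D.compAt p f' X).hom :=
    congr($(D.map₂_whisker_right (Bicategory.Opposite.op2 (NatTrans.toCatHom₂ α))
      p.toCatHom.op).toNatTrans.app X)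
  rw [h, Iso.hom_inv_id_assoc]

lemma compAt_whiskerRight {p p' : A ⥤ B} (β : p ⟶ p') (f : B ⥤ C) (X : D.val C) :
    D.mapAt β ((D.res f).obj X) ≫ (D.compAt p' f X).hom =
      (D.compAt p f X).hom ≫ D.mapAt (Functor.whiskerRight β f) X := by
  have h : D.mapAt (Functor.whiskerRight β f) X = (D.compAt p f X).inv ≫
      D.mapAt β ((D.res f).obj X) ≫ (D.compAt p' f X).hom :=
    congr($(D.map₂_whisker_left f.toCatHom.op
      (Bicategory.Opposite.op2 (NatTrans.toCatHom₂ β))).toNatTrans.app X)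
  rw [h, Iso.hom_inv_id_assoc]

/-- This is compatibility of `D` with associators. The associator of functors is an identity, so its
image is `mapAt` of an identity and disappears. -/
lemma compAt_assoc (p : A ⥤ B) (q : B ⥤ C) (f : C ⥤ E) (X : D.val E) :
    (D.res p).map (D.compAt q f X).hom ≫ (D.compAt p (q ⋙ f) X).hom =
      (D.compAt p q ((D.res f).obj X)).hom ≫ (D.compAt (p ⋙ q) f X).hom := by
  have h : D.mapAt (𝟙 (p ⋙ q ⋙ f)) X = (D.compAt p (q ⋙ f) X).inv ≫
      (D.res p).map (D.compAt q f X).inv ≫ 𝟙 _ ≫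
        (D.compAt p q ((D.res f).obj X)).hom ≫ (D.compAt (p ⋙ q) f X).hom :=
    congr($(D.map₂_associator f.toCatHom.op q.toCatHom.op p.toCatHom.op).toNatTrans.app X)
  rw [mapAt_id, Category.id_comp, eq_comm, Iso.inv_comp_eq, ← Functor.mapIso_inv,
    Iso.inv_comp_eq] at h
  rw [h]
  exact (congrArg (fun t => _ ≫ t) (Category.comp_id _)).symm

/-- The adjunction in the 1-cell dual of `Cat` that is induced by an adjunction of functors. -/
def opAdj {l : A ⥤ B} {r : B ⥤ A} (adj : CategoryTheory.Adjunction l r) :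
    Bicategory.Adjunction (r.toCatHom.op) (l.toCatHom.op) where
  unit := Bicategory.Opposite.op2 (NatTrans.toCatHom₂ adj.unit)
  counit := Bicategory.Opposite.op2 (NatTrans.toCatHom₂ adj.counit)
  left_triangle := by
    apply congrArg Bicategory.Opposite.op2 (a₁ := Bicategory.Opposite.Hom2.unop2 _)
      (a₂ := Bicategory.Opposite.Hom2.unop2 _)
    apply Cat.Hom₂.ext
    apply NatTrans.ext
    funext X
    change adj.unit.app (r.obj X) ≫ (𝟙 _ ≫ 𝟙 _) ≫ r.map (adj.counit.app X) = 𝟙 _ ≫ 𝟙 _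
    simp
  right_triangle := by
    apply congrArg Bicategory.Opposite.op2 (a₁ := Bicategory.Opposite.Hom2.unop2 _)
      (a₂ := Bicategory.Opposite.Hom2.unop2 _)
    apply Cat.Hom₂.ext
    apply NatTrans.ext
    funext X
    change l.map (adj.unit.app X) ≫ (𝟙 _ ≫ 𝟙 _) ≫ adj.counit.app (l.obj X) = 𝟙 _ ≫ 𝟙 _
    simp

/-- Restriction turns an adjunction `l ⊣ r` into an adjunction `r^* ⊣ l^*`. -/
def resAdj {l : A ⥤ B} {r : B ⥤ A} (adj : CategoryTheory.Adjunction l r) :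
    CategoryTheory.Adjunction (D.res r) (D.res l) :=
  CategoryTheory.Adjunction.ofCat (D.toPseudofunctor.mapAdjunction (opAdj adj))

lemma resAdj_unit_app {l : A ⥤ B} {r : B ⥤ A} (adj : CategoryTheory.Adjunction l r)
    (X : D.val A) :
    (D.resAdj adj).unit.app X =
      (D.idAt X).inv ≫ D.mapAt adj.unit X ≫ (D.compAt l r X).inv :=
  rfl

lemma resAdj_counit_app {l : A ⥤ B} {r : B ⥤ A} (adj : CategoryTheory.Adjunction l r)
    (X : D.val B) :
    (D.resAdj adj).counit.app X =
      (D.compAt r l X).hom ≫ D.mapAt adj.counit X ≫ (D.idAt X).hom :=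
  rfl

/-- The transformation induced by a square, at an object. -/
def squareAt {p : E ⥤ A} {q : E ⥤ B} {f : A ⥤ C} {g : B ⥤ C} (α : p ⋙ f ⟶ q ⋙ g)
    (X : D.val C) :
    (D.res p).obj ((D.res f).obj X) ⟶ (D.res q).obj ((D.res g).obj X) :=
  (D.compAt p f X).hom ≫ D.mapAt α X ≫ (D.compAt q g X).inv

lemma resSquare_app {p : E ⥤ A} {q : E ⥤ B} {f : A ⥤ C} {g : B ⥤ C} (α : p ⋙ f ⟶ q ⋙ g)
    (X : D.val C) : (D.resSquare α).app X = D.squareAt α X :=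
  rfl

lemma squareAt_naturality {p : E ⥤ A} {q : E ⥤ B} {f : A ⥤ C} {g : B ⥤ C} (α : p ⋙ f ⟶ q ⋙ g)
    {X Y : D.val C} (φ : X ⟶ Y) :
    (D.res p).map ((D.res f).map φ) ≫ D.squareAt α Y =
      D.squareAt α X ≫ (D.res q).map ((D.res g).map φ) :=
  (D.resSquare α).naturality φ

/-- Whiskering a square with a functor. -/
lemma map_squareAt {E₁ : Type u} [Category.{u} E₁] (p₁ : E₁ ⥤ E) {p : E ⥤ A} {q : E ⥤ B}
    {f : A ⥤ C} {g : B ⥤ C} (α : p ⋙ f ⟶ q ⋙ g) (Y : D.val C) :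
    (D.res p₁).map (D.squareAt α Y) ≫ (D.compAt p₁ q ((D.res g).obj Y)).hom ≫
        (D.compAt (p₁ ⋙ q) g Y).hom =
      (D.compAt p₁ p ((D.res f).obj Y)).hom ≫ (D.compAt (p₁ ⋙ p) f Y).hom ≫
        D.mapAt (Functor.whiskerLeft p₁ α) Y := by
  have e : (D.res p₁).map (D.compAt q g Y).inv ≫ (D.res p₁).map (D.compAt q g Y).hom = 𝟙 _ := by
    rw [← Functor.map_comp, Iso.inv_hom_id, CategoryTheory.Functor.map_id]
  rw [← compAt_assoc, ← reassoc_of% @compAt_assoc]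
  simp only [squareAt, Functor.map_comp, Category.assoc, reassoc_of% e]
  rw [compAt_whiskerLeft]

end Restriction

end Prederivator

lemma CategoryTheory.Iso.bijective_comp {C : Type*} [Category* C] {W X Y Z : C} (x : W ≅ X)
    (y : Y ≅ Z) : Function.Bijective fun φ : X ⟶ Y => x.hom ≫ φ ≫ y.hom := by
  convert (x.symm.homCongr y).bijective using 1
  funext φ
  simp [Iso.homCongr]

namespace Prederivator

variable (D : Prederivator.{u, v, w})

/-! ### Left Kan extensions as universal morphisms, cofinality and pasting. -/

section LeftKanExtension

variable {A B C E : Type u} [Category.{u} A] [Category.{u} B] [Category.{u} C] [Category.{u} E]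

/-- The restriction along a square of a morphism `X ⟶ f^* Y`. -/
def baseChange {p : E ⥤ A} {q : E ⥤ B} {f : A ⥤ C} {g : B ⥤ C} (α : p ⋙ f ⟶ q ⋙ g)
    {X : D.val A} {Y : D.val C} (θ : X ⟶ (D.res f).obj Y) :
    (D.res p).obj X ⟶ (D.res q).obj ((D.res g).obj Y) :=
  (D.res p).map θ ≫ D.squareAt α Y

lemma baseChange_comp {p : E ⥤ A} {q : E ⥤ B} {f : A ⥤ C} {g : B ⥤ C} (α : p ⋙ f ⟶ q ⋙ g)
    {X : D.val A} {Y Z : D.val C} (θ : X ⟶ (D.res f).obj Y) (φ : Y ⟶ Z) :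
    D.baseChange α (θ ≫ (D.res f).map φ) =
      D.baseChange α θ ≫ (D.res q).map ((D.res g).map φ) := by
  simp [baseChange, squareAt_naturality]

/-- The morphism `θ : X ⟶ f^* Y` exhibits `Y` as a left Kan extension of `X` along `f`. -/
def IsLan (f : A ⥤ B) {X : D.val A} {Y : D.val B} (θ : X ⟶ (D.res f).obj Y) : Prop :=
  ∀ Z : D.val B, Function.Bijective fun φ : Y ⟶ Z => θ ≫ (D.res f).map φ

/-- The functor `J` is cofinal relative to `q` if restriction along `J` does not change the
morphisms into objects restricted along `q`. -/
def IsCofinal (J : E ⥤ A) (q : A ⥤ B) : Prop :=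
  ∀ (X : D.val A) (Z : D.val B), Function.Bijective fun ψ : X ⟶ (D.res q).obj Z =>
    (D.res J).map ψ ≫ (D.compAt J q Z).hom

variable {D}

lemma isLan_unit {f : A ⥤ B} {l : D.val A ⥤ D.val B}
    (adj : CategoryTheory.Adjunction l (D.res f)) (X : D.val A) :
    D.IsLan f (adj.unit.app X) := fun Z => by
  have e := (adj.homEquiv X Z).bijective
  rwa [show ⇑(adj.homEquiv X Z) = fun φ => adj.unit.app X ≫ (D.res f).map φ
    from funext fun φ => adj.homEquiv_unit ..] at e

/-- Universal objects are unique up to a unique isomorphism. With this criterion, "a comparison map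
is invertible" becomes "a morphism is universal", which does not refer to chosen adjoints. -/
lemma IsLan.comp_iff {f : A ⥤ B} {X : D.val A} {Y Y' : D.val B} {θ : X ⟶ (D.res f).obj Y}
    (h : D.IsLan f θ) (φ : Y ⟶ Y') :
    D.IsLan f (θ ≫ (D.res f).map φ) ↔ IsIso φ := by
  constructor
  · intro h'
    obtain ⟨ψ, hψ⟩ := (h' Y).2 θ
    dsimp only at hψ
    refine ⟨ψ, (h Y).1 ?_, (h' Y').1 ?_⟩
    · simpa using hψ
    · simp [reassoc_of% hψ]
  · intro hφ Z
    have e := (h Z).comp ((asIso φ).bijective_comp (Iso.refl Z))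
    convert e using 1
    funext ψ
    simp

lemma IsLan.of_iso {f g : A ⥤ B} (e : f ≅ g) {X X' : D.val A} {Y : D.val B}
    {θ : X ⟶ (D.res f).obj Y} (h : D.IsLan f θ) (x : X' ≅ X) :
    D.IsLan g (x.hom ≫ θ ≫ D.mapAt e.hom Y) := fun Z => by
  have h' := (x.bijective_comp (asIso (D.mapAt e.hom Z))).comp (h Z)
  convert h' using 1
  funext φ
  simp [mapAt_naturality]

/-- By Yoneda, since restriction along `f` is isomorphic to the identity. The case needed is an
endofunctor of the point. -/
lemma IsLan.isIso_of_iso_id {f : A ⥤ A} (e : f ≅ 𝟭 A) {X Y : D.val A} {θ : X ⟶ (D.res f).obj Y}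
    (h : D.IsLan f θ) : IsIso θ := by
  have h₁ : IsIso (θ ≫ D.mapAt e.hom Y ≫ (D.idAt Y).hom) := by
    refine (isIso_iff_coyoneda_map_bijective _).2 fun Z => ?_
    have h₂ := ((Iso.refl X).bijective_comp (asIso (D.mapAt e.hom Z) ≪≫ D.idAt Z)).comp (h Z)
    convert h₂ using 1
    funext φ
    simp [reassoc_of% @mapAt_naturality, idAt_naturality]
  exact IsIso.of_isIso_comp_right θ (D.mapAt e.hom Y ≫ (D.idAt Y).hom)

/-- The mate is the morphism by which the base-changed unit factors through the unit of `adjq`, so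
`IsLan.comp_iff` applies. This translates Der4 into a statement about `IsLan`. -/
lemma IsLan.baseChange_iff {p : E ⥤ A} {q : E ⥤ B} {f : A ⥤ C} {g : B ⥤ C} (α : p ⋙ f ⟶ q ⋙ g)
    {lf : D.val A ⥤ D.val C} {lq : D.val E ⥤ D.val B}
    (adjf : CategoryTheory.Adjunction lf (D.res f))
    (adjq : CategoryTheory.Adjunction lq (D.res q)) (X : D.val A) :
    D.IsLan q (D.baseChange α (adjf.unit.app X)) ↔ IsIso ((D.leftMate α adjf adjq).app X) := by
  rw [← (isLan_unit adjq ((D.res p).obj X)).comp_iff]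
  have h : adjq.unit.app ((D.res p).obj X) ≫ (D.res q).map ((D.leftMate α adjf adjq).app X) =
      D.baseChange α (adjf.unit.app X) := by
    simp [leftMate, baseChange, resSquare_app]
  rw [h]

-- Since `J^* ⊣ H^*`, restriction along `J` on morphisms into `q^* Z` is composition with the unit
-- at `q^* Z`, followed by transposition. That unit is the restriction along `adj.unit`, which
-- becomes invertible after whiskering with `q`.
variable (D) in
lemma isCofinal_of_adj {H : A ⥤ E} {J : E ⥤ A} (adj : CategoryTheory.Adjunction H J) (q : A ⥤ B)
    [IsIso (Functor.whiskerRight adj.unit q)] : D.IsCofinal J q := fun X Z => by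
  have h : IsIso ((D.resAdj adj).unit.app ((D.res q).obj Z)) := by
    have e := D.compAt_whiskerRight adj.unit q Z
    rw [resAdj_unit_app]
    have : IsIso (D.mapAt adj.unit ((D.res q).obj Z)) := by
      rw [← IsIso.eq_comp_inv] at e
      rw [e]
      infer_instance
    infer_instance
  let i : (D.res q).obj Z ≅ (D.res H).obj ((D.res J).obj ((D.res q).obj Z)) :=
    asIso ((D.resAdj adj).unit.app ((D.res q).obj Z))
  have h₁ : (fun ψ : X ⟶ (D.res q).obj Z => (D.res J).map ψ) =
      ((D.resAdj adj).homEquiv _ _).symm ∘ fun ψ => (Iso.refl X).hom ≫ ψ ≫ i.hom := by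
    funext ψ
    refine (((D.resAdj adj).homEquiv _ _).symm_apply_eq.2 ?_).symm
    rw [Adjunction.homEquiv_unit]
    refine (Category.id_comp _).trans ?_
    exact (D.resAdj adj).unit.naturality ψ
  have h₂ : Function.Bijective (fun ψ : X ⟶ (D.res q).obj Z => (D.res J).map ψ) := by
    rw [h₁]
    exact (Equiv.bijective _).comp ((Iso.refl X).bijective_comp i)
  have h₃ := ((Iso.refl _).bijective_comp (D.compAt J q Z)).comp h₂
  convert h₃ using 1
  funext ψ
  simp

/-- Cancellation: restriction along `J ⋙ K` is restriction along `K` followed by restriction along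
`J`. It makes `K` cofinal even when `K` itself has no adjoint. -/
lemma IsCofinal.of_comp {A' : Type u} [Category.{u} A'] {J : A' ⥤ E} {K : E ⥤ A} {q : A ⥤ B}
    (h : D.IsCofinal J (K ⋙ q)) (h' : D.IsCofinal (J ⋙ K) q) : D.IsCofinal K q := fun X Z => by
  rw [← Function.Bijective.of_comp_iff' (h _ Z)]
  have h₁ := ((D.compAt J K X).bijective_comp (Iso.refl _)).comp (h' X Z)
  refine (congrArg Function.Bijective (funext fun ψ => ?_)).mp h₁
  simp only [Function.comp_apply, Functor.map_comp, Category.assoc, Iso.refl_hom,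
    Category.comp_id, compAt_assoc, reassoc_of% @compAt_naturality]

lemma IsCofinal.isLan_iff {J : E ⥤ A} {q : A ⥤ B} (h : D.IsCofinal J q) {X : D.val A} {Y : D.val B}
    {θ : X ⟶ (D.res q).obj Y} :
    D.IsLan (J ⋙ q) ((D.res J).map θ ≫ (D.compAt J q Y).hom) ↔ D.IsLan q θ := by
  refine forall_congr' fun Z => ?_
  rw [← Function.Bijective.of_comp_iff' (h X Z)]
  refine iff_of_eq (congrArg _ (funext fun φ => ?_))
  simp [compAt_naturality]

/-- By `comm`, the pasting of `α` and `β` is the square `α'` whiskered with `K`, up to the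
isomorphisms `e₁` and `e₂`. As `K` is cofinal, whiskering with it preserves universality. In the
application `β` and `α'` are comma squares and `α` is the square under study. -/
lemma IsLan.pasting {E₁ E₀ E' : Type u} [Category.{u} E₁] [Category.{u} E₀] [Category.{u} E']
    {p : E ⥤ A} {q : E ⥤ B} {f : A ⥤ C} {g : B ⥤ C} (α : p ⋙ f ⟶ q ⋙ g)
    {p₁ : E₁ ⥤ E} {q₁ : E₁ ⥤ E₀} {c : E₀ ⥤ B} (β : p₁ ⋙ q ⟶ q₁ ⋙ c)
    {p' : E' ⥤ A} {q' : E' ⥤ E₀} (α' : p' ⋙ f ⟶ q' ⋙ c ⋙ g)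
    (K : E₁ ⥤ E') (hK : D.IsCofinal K q') (e₁ : p₁ ⋙ p ≅ K ⋙ p') (e₂ : K ⋙ q' ≅ q₁)
    (comm : ∀ x, α.app (p₁.obj x) ≫ g.map (β.app x) =
      f.map (e₁.hom.app x) ≫ α'.app (K.obj x) ≫ g.map (c.map (e₂.hom.app x)))
    {X : D.val A} {Y : D.val C} {θ : X ⟶ (D.res f).obj Y}
    (h : D.IsLan q' (D.baseChange α' θ)) :
    D.IsLan q₁ (D.baseChange β (D.baseChange α θ)) := by
  have h₁ := ((hK.isLan_iff).2 h).of_iso e₂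
    (D.compAt p₁ p X ≪≫ asIso (D.mapAt e₁.hom X) ≪≫ (D.compAt K p' X).symm)
  have h₂ := (h₁.comp_iff (D.compAt c g Y).inv).2 inferInstance
  suffices H : D.baseChange β (D.baseChange α θ) =
      ((D.compAt p₁ p X ≪≫ asIso (D.mapAt e₁.hom X) ≪≫ (D.compAt K p' X).symm).hom ≫
        ((D.res K).map (D.baseChange α' θ) ≫
          (D.compAt K q' ((D.res (c ⋙ g)).obj Y)).hom) ≫
          D.mapAt e₂.hom ((D.res (c ⋙ g)).obj Y)) ≫ (D.res q₁).map (D.compAt c g Y).inv by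
    rwa [H]
  have e : (D.res q₁).map (D.compAt c g Y).inv ≫ (D.res q₁).map (D.compAt c g Y).hom = 𝟙 _ := by
    rw [← Functor.map_comp, Iso.inv_hom_id, CategoryTheory.Functor.map_id]
  have comm' : Functor.whiskerLeft p₁ α ≫ Functor.whiskerRight β g =
      Functor.whiskerRight e₁.hom f ≫ Functor.whiskerLeft K α' ≫
        Functor.whiskerRight e₂.hom (c ⋙ g) := NatTrans.ext (funext comm)
  have s₁ : D.squareAt β ((D.res g).obj Y) ≫ (D.compAt q₁ c ((D.res g).obj Y)).hom ≫
      (D.compAt (q₁ ⋙ c) g Y).hom = (D.compAt p₁ q ((D.res g).obj Y)).hom ≫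
      (D.compAt (p₁ ⋙ q) g Y).hom ≫ D.mapAt (Functor.whiskerRight β g) Y := by
    simp only [squareAt, Category.assoc, Iso.inv_hom_id_assoc, compAt_whiskerRight]
  have s₂ := D.map_squareAt p₁ α Y
  have s₃ := D.map_squareAt K α' Y
  -- Both sides are brought to a common normal form: one restriction of `θ`, one composition
  -- isomorphism and one `mapAt` of the total 2-cell. The 2-cells are then compared by `comm'`.
  have hL : D.baseChange β (D.baseChange α θ) ≫ (D.res q₁).map (D.compAt c g Y).hom ≫
      (D.compAt q₁ (c ⋙ g) Y).hom = (D.compAt p₁ p X).hom ≫ (D.res (p₁ ⋙ p)).map θ ≫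
        (D.compAt (p₁ ⋙ p) f Y).hom ≫
          D.mapAt (Functor.whiskerLeft p₁ α ≫ Functor.whiskerRight β g) Y := by
    rw [compAt_assoc, mapAt_comp]
    simp only [baseChange, Category.assoc, s₁, Functor.map_comp, reassoc_of% s₂,
      reassoc_of% @compAt_naturality]
  have hR : ((D.compAt p₁ p X ≪≫ asIso (D.mapAt e₁.hom X) ≪≫ (D.compAt K p' X).symm).hom ≫
        ((D.res K).map (D.baseChange α' θ) ≫
          (D.compAt K q' ((D.res (c ⋙ g)).obj Y)).hom) ≫
          D.mapAt e₂.hom ((D.res (c ⋙ g)).obj Y)) ≫ (D.compAt q₁ (c ⋙ g) Y).hom =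
        (D.compAt p₁ p X).hom ≫ (D.res (p₁ ⋙ p)).map θ ≫ (D.compAt (p₁ ⋙ p) f Y).hom ≫
          D.mapAt (Functor.whiskerRight e₁.hom f ≫ Functor.whiskerLeft K α' ≫
            Functor.whiskerRight e₂.hom (c ⋙ g)) Y := by
    rw [mapAt_comp, mapAt_comp]
    simp only [baseChange, Category.assoc, Iso.trans_hom, Iso.symm_hom, asIso_hom,
      Functor.map_comp, compAt_whiskerRight, reassoc_of% s₃, reassoc_of% @compAt_naturality,
      Iso.inv_hom_id_assoc, ← reassoc_of% @mapAt_naturality, reassoc_of% @compAt_whiskerRight]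
  rw [← cancel_mono ((D.res q₁).map (D.compAt c g Y).hom ≫ (D.compAt q₁ (c ⋙ g) Y).hom), hL,
    comm', ← hR]
  simp only [Category.assoc, reassoc_of% e]

lemma IsDerivator.exists_lan (hD : D.IsDerivator) (f : A ⥤ B) :
    ∃ l : D.val A ⥤ D.val B, Nonempty (CategoryTheory.Adjunction l (D.res f)) :=
  (hD.der3 f).1.exists_leftAdjoint

/-- Der4 for an arbitrary left Kan extension: it differs from the unit of a chosen adjunction by an
isomorphism, and Der4 concerns that unit. -/
lemma IsDerivator.isLan_comma (hD : D.IsDerivator) {f : A ⥤ B} {X : D.val A} {Y : D.val B}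
    {θ : X ⟶ (D.res f).obj Y} (h : D.IsLan f θ) (b : B) :
    D.IsLan (Comma.snd f (Functor.fromPUnit.{u} b))
      (D.baseChange (Comma.natTrans f (Functor.fromPUnit.{u} b)) θ) := by
  obtain ⟨lf, ⟨adjf⟩⟩ := hD.exists_lan f
  obtain ⟨lq, ⟨adjq⟩⟩ := hD.exists_lan (Comma.snd f (Functor.fromPUnit.{u} b))
  obtain ⟨φ, hφ⟩ := (isLan_unit adjf X Y).2 θ
  dsimp only at hφ
  have hi : IsIso φ := by
    rw [← (isLan_unit adjf X).comp_iff, hφ]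
    exact h
  have h₁ := (IsLan.baseChange_iff (Comma.natTrans f (Functor.fromPUnit.{u} b)) adjf adjq X).2
    (by have := hD.der4_left f b lf lq adjf adjq; infer_instance)
  rw [← hφ, baseChange_comp, h₁.comp_iff]
  infer_instance

/-- The converse rests on Der2: the comparison `φ` from the actual extension has invertible values,
because both base changes are universal over each slice. -/
lemma IsDerivator.isLan_of_comma (hD : D.IsDerivator) {f : A ⥤ B} {X : D.val A} {Y : D.val B}
    {θ : X ⟶ (D.res f).obj Y}
    (h : ∀ b, D.IsLan (Comma.snd f (Functor.fromPUnit.{u} b))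
      (D.baseChange (Comma.natTrans f (Functor.fromPUnit.{u} b)) θ)) : D.IsLan f θ := by
  obtain ⟨lf, ⟨adjf⟩⟩ := hD.exists_lan f
  obtain ⟨φ, hφ⟩ := (isLan_unit adjf X Y).2 θ
  dsimp only at hφ
  rw [← hφ, (isLan_unit adjf X).comp_iff]
  refine hD.der2 B φ fun b => ?_
  rw [← (hD.isLan_comma (isLan_unit adjf X) b).comp_iff, ← baseChange_comp, hφ]
  exact h b

end LeftKanExtension

end Prederivator

namespace Prederivator

variable (D : Prederivator.{u, v, w})

/-! ### The dual theory of right Kan extensions. -/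

section RightKanExtension

variable {A B C E : Type u} [Category.{u} A] [Category.{u} B] [Category.{u} C] [Category.{u} E]

lemma compAt_inv_whiskerRight {p p' : A ⥤ B} (β : p ⟶ p') (f : B ⥤ C) (X : D.val C) :
    D.mapAt (Functor.whiskerRight β f) X ≫ (D.compAt p' f X).inv =
      (D.compAt p f X).inv ≫ D.mapAt β ((D.res f).obj X) := by
  rw [Iso.comp_inv_eq, Category.assoc, compAt_whiskerRight, Iso.inv_hom_id_assoc]

lemma compAt_inv_assoc (p : A ⥤ B) (q : B ⥤ C) (f : C ⥤ E) (X : D.val E) :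
    (D.compAt p (q ⋙ f) X).inv ≫ (D.res p).map (D.compAt q f X).inv =
      (D.compAt (p ⋙ q) f X).inv ≫ (D.compAt p q ((D.res f).obj X)).inv := by
  have e : (D.res p).map (D.compAt q f X).hom ≫ (D.res p).map (D.compAt q f X).inv = 𝟙 _ := by
    rw [← Functor.map_comp, Iso.hom_inv_id, CategoryTheory.Functor.map_id]
  have h := D.compAt_assoc p q f X
  rw [Iso.inv_comp_eq, ← cancel_epi ((D.res p).map (D.compAt q f X).hom), e, reassoc_of% h]
  simp

/-- The restriction along a square of a morphism `g^* Y ⟶ X`. -/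
def cobaseChange {p : E ⥤ A} {q : E ⥤ B} {f : A ⥤ C} {g : B ⥤ C} (α : p ⋙ f ⟶ q ⋙ g)
    {X : D.val B} {Y : D.val C} (κ : (D.res g).obj Y ⟶ X) :
    (D.res p).obj ((D.res f).obj Y) ⟶ (D.res q).obj X :=
  D.squareAt α Y ≫ (D.res q).map κ

lemma cobaseChange_comp {p : E ⥤ A} {q : E ⥤ B} {f : A ⥤ C} {g : B ⥤ C} (α : p ⋙ f ⟶ q ⋙ g)
    {X : D.val B} {Y Z : D.val C} (κ : (D.res g).obj Y ⟶ X) (φ : Z ⟶ Y) :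
    D.cobaseChange α ((D.res g).map φ ≫ κ) =
      (D.res p).map ((D.res f).map φ) ≫ D.cobaseChange α κ := by
  simp [cobaseChange, reassoc_of% @squareAt_naturality]

/-- The morphism `κ : f^* Y ⟶ X` exhibits `Y` as a right Kan extension of `X` along `f`. -/
def IsRan (f : A ⥤ B) {X : D.val A} {Y : D.val B} (κ : (D.res f).obj Y ⟶ X) : Prop :=
  ∀ Z : D.val B, Function.Bijective fun φ : Z ⟶ Y => (D.res f).map φ ≫ κ

/-- The functor `J` is coinitial relative to `q` if restriction along `J` does not change the
morphisms out of objects restricted along `q`. -/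
def IsCoinitial (J : E ⥤ A) (q : A ⥤ B) : Prop :=
  ∀ (X : D.val A) (Z : D.val B), Function.Bijective fun ψ : (D.res q).obj Z ⟶ X =>
    (D.compAt J q Z).inv ≫ (D.res J).map ψ

variable {D}

lemma isRan_counit {f : A ⥤ B} {r : D.val A ⥤ D.val B}
    (adj : CategoryTheory.Adjunction (D.res f) r) (X : D.val A) :
    D.IsRan f (adj.counit.app X) := fun Z => by
  have e := (adj.homEquiv Z X).symm.bijective
  rwa [show ⇑(adj.homEquiv Z X).symm = fun φ => (D.res f).map φ ≫ adj.counit.app X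
    from funext fun φ => adj.homEquiv_counit ..] at e

lemma IsRan.comp_iff {f : A ⥤ B} {X : D.val A} {Y Y' : D.val B} {κ : (D.res f).obj Y ⟶ X}
    (h : D.IsRan f κ) (φ : Y' ⟶ Y) :
    D.IsRan f ((D.res f).map φ ≫ κ) ↔ IsIso φ := by
  constructor
  · intro h'
    obtain ⟨ψ, hψ⟩ := (h' Y).2 κ
    dsimp only at hψ
    refine ⟨ψ, (h' Y').1 ?_, (h Y).1 ?_⟩
    · simp only [Functor.map_comp, Category.assoc, hψ]
      simp
    · simpa using hψ
  · intro hφ Z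
    have e := (h Z).comp ((Iso.refl Z).bijective_comp (asIso φ))
    convert e using 1
    funext ψ
    simp

lemma IsRan.of_iso {f g : A ⥤ B} (e : f ≅ g) {X X' : D.val A} {Y : D.val B}
    {κ : (D.res f).obj Y ⟶ X} (h : D.IsRan f κ) (x : X ≅ X') :
    D.IsRan g (D.mapAt e.inv Y ≫ κ ≫ x.hom) := fun Z => by
  have h' := ((asIso (D.mapAt e.inv Z)).bijective_comp x).comp (h Z)
  convert h' using 1
  funext φ
  simp [reassoc_of% @mapAt_naturality]

lemma IsRan.isIso_of_iso_id {f : A ⥤ A} (e : f ≅ 𝟭 A) {X Y : D.val A} {κ : (D.res f).obj Y ⟶ X}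
    (h : D.IsRan f κ) : IsIso κ := by
  have h₁ : IsIso (((D.idAt Y).inv ≫ D.mapAt e.inv Y) ≫ κ) := by
    refine (isIso_iff_yoneda_map_bijective _).2 fun Z => ?_
    have h₂ := (((D.idAt Z).symm ≪≫ asIso (D.mapAt e.inv Z)).bijective_comp (Iso.refl X)).comp (h Z)
    convert h₂ using 1
    funext φ
    simp [reassoc_of% @mapAt_naturality, reassoc_of% @idAt_inv_naturality]
  exact IsIso.of_isIso_comp_left ((D.idAt Y).inv ≫ D.mapAt e.inv Y) κ

lemma IsRan.cobaseChange_iff {p : E ⥤ A} {q : E ⥤ B} {f : A ⥤ C} {g : B ⥤ C}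
    (α : p ⋙ f ⟶ q ⋙ g) {rg : D.val B ⥤ D.val C} {rp : D.val E ⥤ D.val A}
    (adjg : CategoryTheory.Adjunction (D.res g) rg)
    (adjp : CategoryTheory.Adjunction (D.res p) rp) (X : D.val B) :
    D.IsRan p (D.cobaseChange α (adjg.counit.app X)) ↔
      IsIso ((D.rightMate α adjg adjp).app X) := by
  rw [← (isRan_counit adjp ((D.res q).obj X)).comp_iff]
  have h : (D.res p).map ((D.rightMate α adjg adjp).app X) ≫ adjp.counit.app ((D.res q).obj X) =
      D.cobaseChange α (adjg.counit.app X) := by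
    simp [rightMate, cobaseChange, resSquare_app]
  rw [h]

variable (D) in
lemma isCoinitial_of_adj {H : A ⥤ E} {J : E ⥤ A} (adj : CategoryTheory.Adjunction J H) (q : A ⥤ B)
    [IsIso (Functor.whiskerRight adj.counit q)] : D.IsCoinitial J q := fun X Z => by
  have h : IsIso ((D.resAdj adj).counit.app ((D.res q).obj Z)) := by
    have e := D.compAt_whiskerRight adj.counit q Z
    rw [resAdj_counit_app]
    have : IsIso (D.mapAt adj.counit ((D.res q).obj Z)) := by
      rw [← IsIso.eq_comp_inv] at e
      rw [e]
      infer_instance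
    infer_instance
  let i : (D.res H).obj ((D.res J).obj ((D.res q).obj Z)) ≅ (D.res q).obj Z :=
    asIso ((D.resAdj adj).counit.app ((D.res q).obj Z))
  have h₁ : (fun ψ : (D.res q).obj Z ⟶ X => (D.res J).map ψ) =
      ((D.resAdj adj).homEquiv _ _) ∘ fun ψ => i.hom ≫ ψ ≫ (Iso.refl X).hom := by
    funext ψ
    refine (((D.resAdj adj).homEquiv _ _).symm_apply_eq.1 ?_)
    rw [Adjunction.homEquiv_counit]
    refine ((D.resAdj adj).counit.naturality ψ).trans ?_
    exact congrArg (fun t => _ ≫ t) (Category.comp_id _).symm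
  have h₂ : Function.Bijective (fun ψ : (D.res q).obj Z ⟶ X => (D.res J).map ψ) := by
    rw [h₁]
    exact (Equiv.bijective _).comp (i.bijective_comp (Iso.refl X))
  have h₃ := ((D.compAt J q Z).symm.bijective_comp (Iso.refl _)).comp h₂
  convert h₃ using 1
  funext ψ
  simp

lemma IsCoinitial.of_comp {A' : Type u} [Category.{u} A'] {J : A' ⥤ E} {K : E ⥤ A} {q : A ⥤ B}
    (h : D.IsCoinitial J (K ⋙ q)) (h' : D.IsCoinitial (J ⋙ K) q) : D.IsCoinitial K q :=
    fun X Z => by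
  rw [← Function.Bijective.of_comp_iff' (h _ Z)]
  have h₁ := ((Iso.refl _).bijective_comp (D.compAt J K X).symm).comp (h' X Z)
  refine (congrArg Function.Bijective (funext fun ψ => ?_)).mp h₁
  simp only [Function.comp_apply, Functor.map_comp, Category.assoc, Iso.refl_hom, Iso.symm_hom,
    Category.id_comp, reassoc_of% @compAt_inv_assoc, compAt_inv_naturality]

lemma IsCoinitial.isRan_iff {J : E ⥤ A} {q : A ⥤ B} (h : D.IsCoinitial J q) {X : D.val A}
    {Y : D.val B} {κ : (D.res q).obj Y ⟶ X} :
    D.IsRan (J ⋙ q) ((D.compAt J q Y).inv ≫ (D.res J).map κ) ↔ D.IsRan q κ := by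
  refine forall_congr' fun Z => ?_
  rw [← Function.Bijective.of_comp_iff' (h X Z)]
  refine iff_of_eq (congrArg _ (funext fun φ => ?_))
  simp [reassoc_of% @compAt_inv_naturality]

/-- Dual to `IsLan.pasting`: here `β` is pasted along the leg `p`, so it is composed before `α`, and
the inverses of `e₁` and `e₂` occur. -/
lemma IsRan.pasting {E₁ E₀ E' : Type u} [Category.{u} E₁] [Category.{u} E₀] [Category.{u} E']
    {p : E ⥤ A} {q : E ⥤ B} {f : A ⥤ C} {g : B ⥤ C} (α : p ⋙ f ⟶ q ⋙ g)
    {p₁ : E₁ ⥤ E₀} {q₁ : E₁ ⥤ E} {c : E₀ ⥤ A} (β : p₁ ⋙ c ⟶ q₁ ⋙ p)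
    {p' : E' ⥤ E₀} {q' : E' ⥤ B} (α' : p' ⋙ c ⋙ f ⟶ q' ⋙ g)
    (K : E₁ ⥤ E') (hK : D.IsCoinitial K p') (e₁ : q₁ ⋙ q ≅ K ⋙ q') (e₂ : K ⋙ p' ≅ p₁)
    (comm : ∀ x, f.map (β.app x) ≫ α.app (q₁.obj x) =
      f.map (c.map (e₂.inv.app x)) ≫ α'.app (K.obj x) ≫ g.map (e₁.inv.app x))
    {X : D.val B} {Y : D.val C} {κ : (D.res g).obj Y ⟶ X}
    (h : D.IsRan p' (D.cobaseChange α' κ)) :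
    D.IsRan p₁ (D.cobaseChange β (D.cobaseChange α κ)) := by
  have h₁ := ((hK.isRan_iff).2 h).of_iso e₂
    (D.compAt K q' X ≪≫ asIso (D.mapAt e₁.inv X) ≪≫ (D.compAt q₁ q X).symm)
  have h₂ := (h₁.comp_iff (D.compAt c f Y).hom).2 inferInstance
  suffices H : D.cobaseChange β (D.cobaseChange α κ) =
      (D.res p₁).map (D.compAt c f Y).hom ≫ D.mapAt e₂.inv ((D.res (c ⋙ f)).obj Y) ≫
        ((D.compAt K p' ((D.res (c ⋙ f)).obj Y)).inv ≫
          (D.res K).map (D.cobaseChange α' κ)) ≫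
        (D.compAt K q' X ≪≫ asIso (D.mapAt e₁.inv X) ≪≫ (D.compAt q₁ q X).symm).hom by
    rwa [H]
  have e : (D.res p₁).map (D.compAt c f Y).inv ≫ (D.res p₁).map (D.compAt c f Y).hom = 𝟙 _ := by
    rw [← Functor.map_comp, Iso.inv_hom_id, CategoryTheory.Functor.map_id]
  have comm' : Functor.whiskerRight β f ≫ Functor.whiskerLeft q₁ α =
      Functor.whiskerRight e₂.inv (c ⋙ f) ≫ Functor.whiskerLeft K α' ≫
        Functor.whiskerRight e₁.inv g := NatTrans.ext (funext comm)
  have s₁ : (D.compAt (p₁ ⋙ c) f Y).inv ≫ (D.compAt p₁ c ((D.res f).obj Y)).inv ≫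
      D.squareAt β ((D.res f).obj Y) = D.mapAt (Functor.whiskerRight β f) Y ≫
      (D.compAt (q₁ ⋙ p) f Y).inv ≫ (D.compAt q₁ p ((D.res f).obj Y)).inv := by
    simp only [squareAt, Iso.inv_hom_id_assoc, reassoc_of% @compAt_inv_whiskerRight]
  have s {E₂ E₃ F G : Type u} [Category.{u} E₂] [Category.{u} E₃] [Category.{u} F] [Category.{u} G]
      (p₀ : E₂ ⥤ E₃) {a : E₃ ⥤ F} {b : E₃ ⥤ G} {f₀ : F ⥤ C} {g₀ : G ⥤ C} (σ : a ⋙ f₀ ⟶ b ⋙ g₀) :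
      (D.compAt (p₀ ⋙ a) f₀ Y).inv ≫ (D.compAt p₀ a ((D.res f₀).obj Y)).inv ≫
        (D.res p₀).map (D.squareAt σ Y) = D.mapAt (Functor.whiskerLeft p₀ σ) Y ≫
        (D.compAt (p₀ ⋙ b) g₀ Y).inv ≫ (D.compAt p₀ b ((D.res g₀).obj Y)).inv := by
    have := D.map_squareAt p₀ σ Y
    rw [← Category.assoc, ← Category.assoc, Iso.eq_comp_inv, Iso.eq_comp_inv]
    simp only [Category.assoc, this, Iso.inv_hom_id_assoc]
  have s₂ := s q₁ α
  have s₃ := s K α'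
  have hL : (D.compAt p₁ (c ⋙ f) Y).inv ≫ (D.res p₁).map (D.compAt c f Y).inv ≫
      D.cobaseChange β (D.cobaseChange α κ) =
        D.mapAt (Functor.whiskerRight β f ≫ Functor.whiskerLeft q₁ α) Y ≫
          (D.compAt (q₁ ⋙ q) g Y).inv ≫ (D.res (q₁ ⋙ q)).map κ ≫ (D.compAt q₁ q X).inv := by
    rw [reassoc_of% @compAt_inv_assoc, mapAt_comp]
    simp only [cobaseChange, Category.assoc, reassoc_of% s₁, Functor.map_comp, reassoc_of% s₂,
      compAt_inv_naturality]
  have hR : (D.compAt p₁ (c ⋙ f) Y).inv ≫ D.mapAt e₂.inv ((D.res (c ⋙ f)).obj Y) ≫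
        ((D.compAt K p' ((D.res (c ⋙ f)).obj Y)).inv ≫
          (D.res K).map (D.cobaseChange α' κ)) ≫
        (D.compAt K q' X ≪≫ asIso (D.mapAt e₁.inv X) ≪≫ (D.compAt q₁ q X).symm).hom =
        D.mapAt (Functor.whiskerRight e₂.inv (c ⋙ f) ≫ Functor.whiskerLeft K α' ≫
            Functor.whiskerRight e₁.inv g) Y ≫
          (D.compAt (q₁ ⋙ q) g Y).inv ≫ (D.res (q₁ ⋙ q)).map κ ≫ (D.compAt q₁ q X).inv := by
    rw [mapAt_comp, mapAt_comp]
    simp only [cobaseChange, Category.assoc, Iso.trans_hom, Iso.symm_hom, asIso_hom,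
      Functor.map_comp, reassoc_of% @mapAt_naturality, reassoc_of% @compAt_naturality,
      ← reassoc_of% @compAt_inv_whiskerRight]
    simp only [reassoc_of% s₃, ← reassoc_of% @mapAt_naturality, reassoc_of% @compAt_inv_whiskerRight,
      Iso.inv_hom_id_assoc]
  rw [← cancel_epi ((D.compAt p₁ (c ⋙ f) Y).inv ≫ (D.res p₁).map (D.compAt c f Y).inv)]
  simp only [Category.assoc, reassoc_of% e]
  rw [hL, comm', ← hR]
  simp only [Category.assoc]

lemma IsDerivator.exists_ran (hD : D.IsDerivator) (f : A ⥤ B) :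
    ∃ r : D.val A ⥤ D.val B, Nonempty (CategoryTheory.Adjunction (D.res f) r) :=
  (hD.der3 f).2.exists_rightAdjoint

lemma IsDerivator.isRan_comma (hD : D.IsDerivator) {f : A ⥤ B} {X : D.val A} {Y : D.val B}
    {κ : (D.res f).obj Y ⟶ X} (h : D.IsRan f κ) (b : B) :
    D.IsRan (Comma.fst (Functor.fromPUnit.{u} b) f)
      (D.cobaseChange (Comma.natTrans (Functor.fromPUnit.{u} b) f) κ) := by
  obtain ⟨rf, ⟨adjf⟩⟩ := hD.exists_ran f
  obtain ⟨rp, ⟨adjp⟩⟩ := hD.exists_ran (Comma.fst (Functor.fromPUnit.{u} b) f)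
  obtain ⟨φ, hφ⟩ := (isRan_counit adjf X Y).2 κ
  dsimp only at hφ
  have hi : IsIso φ := by
    rw [← (isRan_counit adjf X).comp_iff, hφ]
    exact h
  have h₁ := (IsRan.cobaseChange_iff (Comma.natTrans (Functor.fromPUnit.{u} b) f) adjf adjp X).2
    (by have := hD.der4_right f b rf rp adjf adjp; infer_instance)
  rw [← hφ, cobaseChange_comp, h₁.comp_iff]
  infer_instance

lemma IsDerivator.isRan_of_comma (hD : D.IsDerivator) {f : A ⥤ B} {X : D.val A} {Y : D.val B}
    {κ : (D.res f).obj Y ⟶ X}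
    (h : ∀ b, D.IsRan (Comma.fst (Functor.fromPUnit.{u} b) f)
      (D.cobaseChange (Comma.natTrans (Functor.fromPUnit.{u} b) f) κ)) : D.IsRan f κ := by
  obtain ⟨rf, ⟨adjf⟩⟩ := hD.exists_ran f
  obtain ⟨φ, hφ⟩ := (isRan_counit adjf X Y).2 κ
  dsimp only at hφ
  rw [← hφ, (isRan_counit adjf X).comp_iff]
  refine hD.der2 B φ fun b => ?_
  rw [← (hD.isRan_comma (isRan_counit adjf X) b).comp_iff, ← cobaseChange_comp, hφ]
  exact h b

end RightKanExtension

end Prederivator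

namespace Prederivator

/-! ### Slices of product functors. -/

section CommaProd

variable {A B M N : Type u} [Category.{u} A] [Category.{u} B] [Category.{u} M] [Category.{u} N]

lemma exists_eq_fromPUnit (c : Discrete PUnit.{u + 1} ⥤ B) : ∃ b, c = Functor.fromPUnit.{u} b :=
  ⟨c.obj ⟨PUnit.unit⟩, CategoryTheory.Functor.ext (fun _ => rfl) (by
    rintro ⟨⟨⟩⟩ ⟨⟨⟩⟩ f
    obtain rfl : f = 𝟙 _ := Subsingleton.elim _ _
    simp)⟩

/-- The section of `commaProdFst` that uses the second component of the target. -/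
@[simps obj map]
def commaProdSection (p : A ⥤ B) (c : Discrete PUnit.{u + 1} ⥤ B × M) :
    Comma p (c ⋙ CategoryTheory.Prod.fst B M) ⥤ Comma (Functor.prod p (𝟭 M)) c where
  obj x := ⟨(x.left, (c.obj x.right).2), x.right, (x.hom, 𝟙 (c.obj x.right).2)⟩
  map φ := ⟨(φ.left, (c.map φ.right).2), φ.right, Prod.ext φ.w
    ((Category.comp_id _).trans (Category.id_comp _).symm)⟩
  map_id x := CommaMorphism.ext (Prod.ext rfl (congrArg _root_.Prod.snd (c.map_id x.right) :)) rfl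
  map_comp φ ψ := CommaMorphism.ext
    (Prod.ext rfl (congrArg _root_.Prod.snd (c.map_comp φ.right ψ.right) :)) rfl

/-- The first component of a comma category of a product of functors. -/
@[simps]
def commaProdFst (p : A ⥤ B) (c : Discrete PUnit.{u + 1} ⥤ B × M) :
    Comma (Functor.prod p (𝟭 M)) c ⥤ Comma p (c ⋙ CategoryTheory.Prod.fst B M) where
  obj x := ⟨x.left.1, x.right, x.hom.1⟩
  map φ := ⟨φ.left.1, φ.right, congrArg _root_.Prod.fst φ.w⟩

/-- The adjunction of `commaProdFst` and `commaProdSection`. -/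
def commaProdAdj (p : A ⥤ B) (c : Discrete PUnit.{u + 1} ⥤ B × M) :
    CategoryTheory.Adjunction (commaProdFst p c) (commaProdSection p c) where
  unit :=
    { app := fun x => ⟨(𝟙 _, x.hom.2), 𝟙 _, Prod.ext
        (by
          change p.map (𝟙 x.left.1) ≫ x.hom.1 = x.hom.1 ≫ (c.map (𝟙 x.right)).1
          rw [c.map_id, p.map_id]
          exact (Category.id_comp _).trans (Category.comp_id _).symm)
        (by
          change x.hom.2 ≫ 𝟙 _ = x.hom.2 ≫ (c.map (𝟙 x.right)).2
          rw [c.map_id]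
          rfl)⟩
      naturality := fun x y φ => CommaMorphism.ext
        (Prod.ext ((Category.comp_id _).trans (Category.id_comp _).symm)
          (congrArg _root_.Prod.snd φ.w :))
        ((Category.comp_id _).trans (Category.id_comp _).symm) }
  counit :=
    { app := fun x => 𝟙 x
      naturality := fun x y φ => CommaMorphism.ext
        ((Category.comp_id _).trans (Category.id_comp _).symm)
        ((Category.comp_id _).trans (Category.id_comp _).symm) }
  left_triangle_components := fun x => CommaMorphism.ext (Category.id_comp _) (Category.id_comp _)
  right_triangle_components := fun x => CommaMorphism.ext
    (Prod.ext (Category.id_comp _)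
      (by
        change 𝟙 _ ≫ (c.map (𝟙 x.right)).2 = 𝟙 _
        rw [c.map_id]
        exact Category.id_comp _))
    (Category.id_comp _)

/-- Change of the second component in comma categories. -/
@[simps obj map]
def commaProdMap (p : A ⥤ B) (c : Discrete PUnit.{u + 1} ⥤ B × N) (f : N ⥤ M) :
    Comma (Functor.prod p (𝟭 N)) c ⥤ Comma (Functor.prod p (𝟭 M)) (c ⋙ Functor.prod (𝟭 B) f) where
  obj x := ⟨(x.left.1, f.obj x.left.2), x.right, (x.hom.1, f.map x.hom.2)⟩
  map {x y} φ := ⟨(φ.left.1, f.map φ.left.2), φ.right, Prod.ext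
    (congrArg _root_.Prod.fst φ.w :)
    (by
      change f.map φ.left.2 ≫ f.map y.hom.2 = f.map x.hom.2 ≫ f.map (c.map φ.right).2
      rw [← f.map_comp, ← f.map_comp]
      exact congrArg (fun t => f.map t.2) φ.w)⟩
  map_id x := CommaMorphism.ext (Prod.ext rfl (f.map_id _)) rfl
  map_comp φ ψ := CommaMorphism.ext (Prod.ext rfl (f.map_comp _ _)) rfl

/-- The sections `commaProdSection` are compatible with change of the second component. -/
def commaProdSectionIso (p : A ⥤ B) (c : Discrete PUnit.{u + 1} ⥤ B × N) (f : N ⥤ M) :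
    commaProdSection p (c ⋙ Functor.prod (𝟭 B) f) ≅ commaProdSection p c ⋙ commaProdMap p c f :=
  NatIso.ofComponents (fun x => Comma.isoMk (Iso.refl _) (Iso.refl _)
    (Prod.ext
      (by
        change p.map (𝟙 x.left) ≫ x.hom = x.hom ≫ (c.map (𝟙 x.right)).1
        rw [c.map_id, p.map_id]
        exact (Category.id_comp _).trans (Category.comp_id _).symm)
      (by
        change 𝟙 _ ≫ f.map (𝟙 _) = 𝟙 _ ≫ f.map (c.map (𝟙 x.right)).2
        rw [c.map_id]
        rfl)))
    (fun φ => CommaMorphism.ext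
      (Prod.ext ((Category.comp_id _).trans (Category.id_comp _).symm)
        ((Category.comp_id _).trans (Category.id_comp _).symm))
      ((Category.comp_id _).trans (Category.id_comp _).symm))

/-- The section of `commaProdSnd` that uses the second component of the source. -/
@[simps obj map]
def commaProdSection' (c : Discrete PUnit.{u + 1} ⥤ B × M) (p : A ⥤ B) :
    Comma (c ⋙ CategoryTheory.Prod.fst B M) p ⥤ Comma c (Functor.prod p (𝟭 M)) where
  obj x := ⟨x.left, (x.right, (c.obj x.left).2), (x.hom, 𝟙 (c.obj x.left).2)⟩
  map φ := ⟨φ.left, (φ.right, (c.map φ.left).2), Prod.ext φ.w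
    ((Category.comp_id _).trans (Category.id_comp _).symm)⟩
  map_id x := CommaMorphism.ext rfl (Prod.ext rfl (congrArg _root_.Prod.snd (c.map_id x.left) :))
  map_comp φ ψ := CommaMorphism.ext rfl
    (Prod.ext rfl (congrArg _root_.Prod.snd (c.map_comp φ.left ψ.left) :))

/-- The first component of a comma category of a product of functors. -/
@[simps]
def commaProdSnd (c : Discrete PUnit.{u + 1} ⥤ B × M) (p : A ⥤ B) :
    Comma c (Functor.prod p (𝟭 M)) ⥤ Comma (c ⋙ CategoryTheory.Prod.fst B M) p where
  obj x := ⟨x.left, x.right.1, x.hom.1⟩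
  map φ := ⟨φ.left, φ.right.1, congrArg _root_.Prod.fst φ.w⟩

/-- The adjunction of `commaProdSection'` and `commaProdSnd`. -/
def commaProdAdj' (c : Discrete PUnit.{u + 1} ⥤ B × M) (p : A ⥤ B) :
    CategoryTheory.Adjunction (commaProdSection' c p) (commaProdSnd c p) where
  unit :=
    { app := fun x => 𝟙 x
      naturality := fun x y φ => CommaMorphism.ext
        ((Category.comp_id _).trans (Category.id_comp _).symm)
        ((Category.comp_id _).trans (Category.id_comp _).symm) }
  counit :=
    { app := fun x => ⟨𝟙 _, (𝟙 _, x.hom.2), Prod.ext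
        (by
          change (c.map (𝟙 x.left)).1 ≫ x.hom.1 = x.hom.1 ≫ p.map (𝟙 x.right.1)
          rw [c.map_id, p.map_id]
          exact (Category.id_comp _).trans (Category.comp_id _).symm)
        (by
          change (c.map (𝟙 x.left)).2 ≫ x.hom.2 = 𝟙 _ ≫ x.hom.2
          rw [c.map_id]
          rfl)⟩
      naturality := fun x y φ => CommaMorphism.ext
        ((Category.comp_id _).trans (Category.id_comp _).symm)
        (Prod.ext ((Category.comp_id _).trans (Category.id_comp _).symm)
          (congrArg _root_.Prod.snd φ.w :)) }
  left_triangle_components := fun x => CommaMorphism.ext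
    (Category.id_comp _)
    (Prod.ext (Category.id_comp _)
      (by
        change (c.map (𝟙 x.left)).2 ≫ 𝟙 _ = 𝟙 _
        rw [c.map_id]
        exact Category.id_comp _))
  right_triangle_components := fun x => CommaMorphism.ext (Category.id_comp _) (Category.id_comp _)

/-- Change of the second component in comma categories. -/
@[simps obj map]
def commaProdMap' (c : Discrete PUnit.{u + 1} ⥤ B × N) (p : A ⥤ B) (f : N ⥤ M) :
    Comma c (Functor.prod p (𝟭 N)) ⥤ Comma (c ⋙ Functor.prod (𝟭 B) f) (Functor.prod p (𝟭 M)) where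
  obj x := ⟨x.left, (x.right.1, f.obj x.right.2), (x.hom.1, f.map x.hom.2)⟩
  map {x y} φ := ⟨φ.left, (φ.right.1, f.map φ.right.2), Prod.ext
    (congrArg _root_.Prod.fst φ.w :)
    (by
      change f.map (c.map φ.left).2 ≫ f.map y.hom.2 = f.map x.hom.2 ≫ f.map φ.right.2
      rw [← f.map_comp, ← f.map_comp]
      exact congrArg (fun t => f.map t.2) φ.w)⟩
  map_id x := CommaMorphism.ext rfl (Prod.ext rfl (f.map_id _))
  map_comp φ ψ := CommaMorphism.ext rfl (Prod.ext rfl (f.map_comp _ _))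

/-- The sections `commaProdSection'` are compatible with change of the second component. -/
def commaProdSectionIso' (c : Discrete PUnit.{u + 1} ⥤ B × N) (p : A ⥤ B) (f : N ⥤ M) :
    commaProdSection' (c ⋙ Functor.prod (𝟭 B) f) p ≅ commaProdSection' c p ⋙ commaProdMap' c p f :=
  NatIso.ofComponents (fun x => Comma.isoMk (Iso.refl _) (Iso.refl _)
    (Prod.ext
      (by
        change (c.map (𝟙 x.left)).1 ≫ x.hom = x.hom ≫ p.map (𝟙 x.right)
        rw [c.map_id, p.map_id]
        exact (Category.id_comp _).trans (Category.comp_id _).symm)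
      (by
        change f.map (c.map (𝟙 x.left)).2 ≫ f.map (𝟙 _) = 𝟙 _ ≫ 𝟙 _
        rw [c.map_id, ← f.map_comp, Category.comp_id, Category.comp_id]
        exact f.map_id _)))
    (fun φ => CommaMorphism.ext
      ((Category.comp_id _).trans (Category.id_comp _).symm)
      (Prod.ext ((Category.comp_id _).trans (Category.id_comp _).symm)
        ((Category.comp_id _).trans (Category.id_comp _).symm)))

end CommaProd

variable {D : Prederivator.{u, v, w}}

/-! ### Base change of Kan extensions along a product. -/

section

variable {A B M N : Type u} [Category.{u} A] [Category.{u} B] [Category.{u} M] [Category.{u} N]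

/-- This discharges the whiskering hypothesis of `isCofinal_of_adj` whenever `q` maps to the point,
so every right adjoint is cofinal there. -/
lemma isIso_of_discrete {F G : A ⥤ Discrete PUnit.{u + 1}} (α : F ⟶ G) : IsIso α :=
  NatIso.isIso_of_isIso_app _

/-- The sections from `(p / b)` into both slices are right adjoints, hence cofinal. They commute
with `commaProdMap` up to isomorphism, so cancellation applies. -/
lemma isCofinal_commaProdMap (p : A ⥤ B) (c : Discrete PUnit.{u + 1} ⥤ B × N) (f : N ⥤ M) :
    D.IsCofinal (commaProdMap p c f)
      (Comma.snd (Functor.prod p (𝟭 M)) (c ⋙ Functor.prod (𝟭 B) f)) := by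
  refine IsCofinal.of_comp (J := commaProdSection p c) ?_ ?_
  · have := isIso_of_discrete (Functor.whiskerRight (commaProdAdj p c).unit
      (commaProdMap p c f ⋙ Comma.snd (Functor.prod p (𝟭 M)) (c ⋙ Functor.prod (𝟭 B) f)))
    exact D.isCofinal_of_adj (commaProdAdj p c) _
  · let adj := (commaProdAdj p (c ⋙ Functor.prod (𝟭 B) f)).ofNatIsoRight
      (commaProdSectionIso p c f)
    have := isIso_of_discrete (Functor.whiskerRight adj.unit
      (Comma.snd (Functor.prod p (𝟭 M)) (c ⋙ Functor.prod (𝟭 B) f)))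
    exact D.isCofinal_of_adj adj _

/-- The square of functors that exchanges `p × -` and `- × f`. -/
abbrev prodSquare (p : A ⥤ B) (f : N ⥤ M) : Functor.prod (𝟭 A) f ⋙ Functor.prod p (𝟭 M) ⟶
    Functor.prod p (𝟭 N) ⋙ Functor.prod (𝟭 B) f :=
  𝟙 (Functor.prod (𝟭 A) f ⋙ Functor.prod p (𝟭 M))

/-- The square of functors that exchanges `- × f` and `p × -`. -/
abbrev prodSquare' (p : A ⥤ B) (f : N ⥤ M) : Functor.prod p (𝟭 N) ⋙ Functor.prod (𝟭 B) f ⟶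
    Functor.prod (𝟭 A) f ⋙ Functor.prod p (𝟭 M) :=
  𝟙 (Functor.prod p (𝟭 N) ⋙ Functor.prod (𝟭 B) f)

/-- This is the Beck-Chevalley condition behind `p_!`. It is checked over the slice at each object
of `B × N`, where pasting with the cofinal `commaProdMap` reduces it to Der4 at the image in `B ×
M`. -/
lemma IsDerivator.isLan_baseChange_prod (hD : D.IsDerivator) (p : A ⥤ B) (f : N ⥤ M)
    {X : D.val (A × M)} {Y : D.val (B × M)} {θ : X ⟶ (D.res (Functor.prod p (𝟭 M))).obj Y}
    (h : D.IsLan _ θ) :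
    D.IsLan (Functor.prod p (𝟭 N)) (D.baseChange (prodSquare p f) θ) := by
  refine hD.isLan_of_comma fun b => ?_
  refine IsLan.pasting (prodSquare p f) (Comma.natTrans _ _) (Comma.natTrans _ _)
    (commaProdMap p (Functor.fromPUnit.{u} b) f) (isCofinal_commaProdMap p _ f) (Iso.refl _)
    (Iso.refl _) ?_ ?_
  · intro x
    refine Prod.ext ?_ ?_
    · change 𝟙 _ ≫ x.hom.1 = p.map (𝟙 _) ≫ x.hom.1 ≫ 𝟙 _
      rw [p.map_id, Category.comp_id]
      rfl
    · change 𝟙 _ ≫ f.map x.hom.2 = 𝟙 _ ≫ f.map x.hom.2 ≫ f.map (𝟙 _)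
      rw [← f.map_comp, Category.comp_id]
  -- The composite of a point with a functor is a `fromPUnit` only up to propositional equality,
  -- while Der4 is stated for `fromPUnit`.
  · obtain ⟨b', hb⟩ := exists_eq_fromPUnit (Functor.fromPUnit.{u} b ⋙ Functor.prod (𝟭 B) f)
    rw [hb]
    exact hD.isLan_comma h b'

lemma isCoinitial_commaProdMap' (c : Discrete PUnit.{u + 1} ⥤ B × N) (p : A ⥤ B) (f : N ⥤ M) :
    D.IsCoinitial (commaProdMap' c p f)
      (Comma.fst (c ⋙ Functor.prod (𝟭 B) f) (Functor.prod p (𝟭 M))) := by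
  refine IsCoinitial.of_comp (J := commaProdSection' c p) ?_ ?_
  · have := isIso_of_discrete (Functor.whiskerRight (commaProdAdj' c p).counit
      (commaProdMap' c p f ⋙ Comma.fst (c ⋙ Functor.prod (𝟭 B) f) (Functor.prod p (𝟭 M))))
    exact D.isCoinitial_of_adj (commaProdAdj' c p) _
  · let adj := (commaProdAdj' (c ⋙ Functor.prod (𝟭 B) f) p).ofNatIsoLeft
      (commaProdSectionIso' c p f)
    have := isIso_of_discrete (Functor.whiskerRight adj.counit
      (Comma.fst (c ⋙ Functor.prod (𝟭 B) f) (Functor.prod p (𝟭 M))))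
    exact D.isCoinitial_of_adj adj _

lemma IsDerivator.isRan_cobaseChange_prod (hD : D.IsDerivator) (p : A ⥤ B) (f : N ⥤ M)
    {X : D.val (A × M)} {Y : D.val (B × M)} {κ : (D.res (Functor.prod p (𝟭 M))).obj Y ⟶ X}
    (h : D.IsRan _ κ) :
    D.IsRan (Functor.prod p (𝟭 N)) (D.cobaseChange (prodSquare' p f) κ) := by
  refine hD.isRan_of_comma fun b => ?_
  refine IsRan.pasting (prodSquare' p f) (Comma.natTrans _ _) (Comma.natTrans _ _)
    (commaProdMap' (Functor.fromPUnit.{u} b) p f) (isCoinitial_commaProdMap' _ p f) (Iso.refl _)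
    (Iso.refl _) ?_ ?_
  · intro x
    refine Prod.ext ?_ ?_
    · change x.hom.1 ≫ 𝟙 _ = 𝟙 _ ≫ x.hom.1 ≫ p.map (𝟙 _)
      rw [p.map_id]
      exact (Category.id_comp _).symm
    · change f.map x.hom.2 ≫ 𝟙 _ = f.map (𝟙 _) ≫ f.map x.hom.2 ≫ 𝟙 _
      rw [Category.comp_id, ← f.map_comp, Category.id_comp]
  · obtain ⟨b', hb⟩ := exists_eq_fromPUnit (Functor.fromPUnit.{u} b ⋙ Functor.prod (𝟭 B) f)
    rw [hb]
    exact hD.isRan_comma h b'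

end

end Prederivator

/-! ### Existence of Kan extension morphisms. -/

namespace Prederivator

variable {D : Prederivator.{u, v, w}}

lemma mapComp_conj_eqToHom (D : Prederivator.{u, v, w}) {a b b' c : (Cat.{u, u})ᵒᵖ} {f : a ⟶ b}
    {p : b ⟶ c} {g : a ⟶ b'} {q : b' ⟶ c} (h : f ≫ p = g ≫ q)
    (h' : D.map f ≫ D.map p = D.map g ≫ D.map q) :
    (D.mapComp f p).inv ≫ D.map₂ (eqToHom h) ≫ (D.mapComp g q).hom = eqToHom h' := by
  rw [PrelaxFunctor.map₂_eqToHom, D.mapComp_eq_eqToIso, D.mapComp_eq_eqToIso]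
  simp

section

variable {A B C E : Type u} [Category.{u} A] [Category.{u} B] [Category.{u} C] [Category.{u} E]

/-- It reconciles two descriptions of a commutative square: `restr` is strictly natural, with an
`eqToHom` as its naturality cell, whereas `squareAt` is built from `mapComp` and `map₂`. -/
lemma squareAt_eq_of_eqToHom {p : E ⥤ A} {q : E ⥤ B} {f : A ⥤ C} {g : B ⥤ C}
    (α : p ⋙ f ⟶ q ⋙ g)
    (h : f.toCatHom.op ≫ p.toCatHom.op = g.toCatHom.op ≫ q.toCatHom.op)
    (hα : Bicategory.Opposite.op2 (NatTrans.toCatHom₂ α) = eqToHom h)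
    (h' : D.map f.toCatHom.op ≫ D.map p.toCatHom.op = D.map g.toCatHom.op ≫ D.map q.toCatHom.op)
    (Y : D.val C) :
    D.squareAt α Y = (eqToHom h').toNatTrans.app Y := by
  have e := D.mapComp_conj_eqToHom h h'
  rw [← hα] at e
  exact congr($(e).toNatTrans.app Y)

end

/-- Der3 gives the components. The mate is invertible because composing the unit with it yields the
base-changed unit, which is again universal. -/
theorem IsDerivator.nonempty_leftKan (hD : D.IsDerivator) {A B : Cat.{u, u}} (p : A ⟶ B) :
    Nonempty (D.LeftKan p) := by
  choose l adj using fun a : (Cat.{u, u})ᵒᵖ =>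
    hD.exists_lan (Functor.prod p.toFunctor (𝟭 a.unop))
  refine Pseudofunctor.StrongTrans.nonempty_leftAdjoint (D.restr p) l (fun a => (adj a).some)
    fun {a b} f X => ?_
  have h := hD.isLan_baseChange_prod p.toFunctor f.unop.toFunctor (isLan_unit (adj a).some X)
  refine ((isLan_unit (adj b).some _).comp_iff _).1 ?_
  have e := (adj a).some.unit_leftMateAt (adj b).some ((D.restr p).natIso f) X
  refine cast (congrArg (D.IsLan _) (Eq.trans ?_ e.symm)) h
  exact congrArg (fun t => (D.res (Functor.prod (𝟭 A) f.unop.toFunctor)).map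
    ((adj a).some.unit.app X) ≫ t)
    (squareAt_eq_of_eqToHom (prodSquare p.toFunctor f.unop.toFunctor) rfl rfl _ _)

theorem IsDerivator.nonempty_rightKan (hD : D.IsDerivator) {A B : Cat.{u, u}} (p : A ⟶ B) :
    Nonempty (D.RightKan p) := by
  choose r adj using fun a : (Cat.{u, u})ᵒᵖ =>
    hD.exists_ran (Functor.prod p.toFunctor (𝟭 a.unop))
  refine Pseudofunctor.StrongTrans.nonempty_rightAdjoint (D.restr p) r (fun a => (adj a).some)
    fun {a b} f X => ?_
  have h := hD.isRan_cobaseChange_prod p.toFunctor f.unop.toFunctor (isRan_counit (adj a).some X)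
  refine ((isRan_counit (adj b).some _).comp_iff _).1 ?_
  have e := (adj a).some.rightMateAt_counit (adj b).some ((D.restr p).natIso f) X
  refine cast (congrArg (D.IsRan _) (Eq.trans ?_ e.symm)) h
  exact congrArg (fun t => t ≫ (D.res (Functor.prod (𝟭 A) f.unop.toFunctor)).map
    ((adj a).some.counit.app X))
    (squareAt_eq_of_eqToHom (prodSquare' p.toFunctor f.unop.toFunctor) rfl rfl _ _)

end Prederivator

/-! ### Strict transformations, and transport of adjunctions along isomorphisms. -/

namespace CategoryTheory.Pseudofunctor.StrongTrans

section Strict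

variable {B : Type u₁} [Bicategory.{w₁, v₁} B] {C : Type u₂} [Bicategory.{w₂, v₂} C]

/-- A strong transformation is strict if its naturality isomorphisms are identities. -/
def IsStrict {P Q : Pseudofunctor B C} [Bicategory.Strict C] (σ : P ⟶ Q) : Prop :=
  ∀ ⦃a b : B⦄ (f : a ⟶ b), ∃ h : P.map f ≫ σ.app b = σ.app a ≫ Q.map f,
    (σ.naturality f).hom = eqToHom h

variable [Bicategory.Strict C] {P Q R : Pseudofunctor B C}

lemma isStrict_id (P : Pseudofunctor B C) : (𝟙 P : P ⟶ P).IsStrict := fun _ _ f =>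
  ⟨(Strict.comp_id _).trans (Strict.id_comp _).symm, by
    simp [Strict.leftUnitor_eqToIso, Strict.rightUnitor_eqToIso]
    rfl⟩

lemma IsStrict.comp {σ : P ⟶ Q} {τ : Q ⟶ R} (hσ : σ.IsStrict) (hτ : τ.IsStrict) :
    (σ ≫ τ).IsStrict := fun a b f => by
  obtain ⟨h₁, e₁⟩ := hσ f
  obtain ⟨h₂, e₂⟩ := hτ f
  refine ⟨by simp only [comp_app]; rw [← Strict.assoc, h₁, Strict.assoc, h₂, Strict.assoc], ?_⟩
  have h {t₀ t₁ t₂ t₃ t₄ t₅ : P.obj a ⟶ R.obj b} (h₁ : t₀ = t₁) (h₂ : t₁ = t₂) (h₃ : t₂ = t₃)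
      (h₄ : t₃ = t₄) (h₅ : t₄ = t₅) (h₆ : t₀ = t₅) : eqToHom h₁ ≫ eqToHom h₂ ≫ eqToHom h₃ ≫ eqToHom h₄ ≫ eqToHom h₅ =
        eqToHom h₆ := by simp
  simp only [categoryStruct_comp_naturality_hom, e₁, e₂, Strict.associator_eqToIso,
    whiskerLeft_eqToHom, eqToHom_whiskerRight, eqToIso.hom, eqToIso.inv]
  exact h _ _ _ _ _ _

/-- Strict transformations with the same components are isomorphic. -/
def IsStrict.isoOfEq {σ τ : P ⟶ Q} (hσ : σ.IsStrict) (hτ : τ.IsStrict)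
    (h : ∀ a, σ.app a = τ.app a) : σ ≅ τ where
  hom := ⟨⟨fun a => eqToHom (h a), fun {a b} f => by
    obtain ⟨h₁, e₁⟩ := hσ f
    obtain ⟨h₂, e₂⟩ := hτ f
    rw [e₁, e₂]
    simp [whiskerLeft_eqToHom, eqToHom_whiskerRight]⟩⟩
  inv := ⟨⟨fun a => eqToHom (h a).symm, fun {a b} f => by
    obtain ⟨h₁, e₁⟩ := hσ f
    obtain ⟨h₂, e₂⟩ := hτ f
    rw [e₁, e₂]
    simp [whiskerLeft_eqToHom, eqToHom_whiskerRight]⟩⟩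
  hom_inv_id := homCategory.ext fun a => by
    exact (eqToHom_trans (h a) (h a).symm).trans (eqToHom_refl _ _)
  inv_hom_id := homCategory.ext fun a => by
    exact (eqToHom_trans (h a).symm (h a)).trans (eqToHom_refl _ _)

end Strict

variable {B : Type u} [Bicategory.{w, v} B] {P Q : Pseudofunctor B Cat.{v₁, u₁}}

/-- The adjunctions between the components of adjoint strong transformations. -/
def adjunctionApp {l : P ⟶ Q} {r : Q ⟶ P} (adj : Bicategory.Adjunction l r) (a : B) :
    CategoryTheory.Adjunction (l.app a).toFunctor (r.app a).toFunctor :=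
  CategoryTheory.Adjunction.ofCat
    { unit := adj.unit.as.app a
      counit := adj.counit.as.app a
      left_triangle := congr($(adj.left_triangle).as.app a)
      right_triangle := congr($(adj.right_triangle).as.app a) }

lemma bijective_unit_comp {l : P ⟶ Q} {r : Q ⟶ P} (adj : Bicategory.Adjunction l r) (a : B)
    (X : P.obj a) (Y : Q.obj a) : Function.Bijective fun φ : (l.app a).toFunctor.obj X ⟶ Y =>
      ((adj.unit.as.app a).toNatTrans.app X : X ⟶ (r.app a).toFunctor.obj _) ≫
        (r.app a).toFunctor.map φ := by
  have e := ((adjunctionApp adj a).homEquiv X Y).bijective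
  rwa [show ⇑((adjunctionApp adj a).homEquiv X Y) = fun φ =>
    (adjunctionApp adj a).unit.app X ≫ (r.app a).toFunctor.map φ
    from funext fun φ => (adjunctionApp adj a).homEquiv_unit ..] at e

lemma nonempty_adjunction_of_iso_right {l : P ⟶ Q} {r r' : Q ⟶ P} (adj : Bicategory.Adjunction l r)
    (e : r ≅ r') : Nonempty (Bicategory.Adjunction l r') := by
  refine nonempty_adjunction_of_unit (adj.unit ≫ l ◁ e.hom) fun a X Y => ?_
  have h := bijective_unit_comp adj a X Y
  let i : (r.app a).toFunctor.obj Y ≅ (r'.app a).toFunctor.obj Y :=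
    { hom := (e.hom.as.app a).toNatTrans.app Y
      inv := (e.inv.as.app a).toNatTrans.app Y
      hom_inv_id := congr(($(e.hom_inv_id).as.app a).toNatTrans.app Y)
      inv_hom_id := congr(($(e.inv_hom_id).as.app a).toNatTrans.app Y) }
  refine (congrArg Function.Bijective (funext fun φ => ?_)).mp
    (((Iso.refl X).bijective_comp i).comp h)
  have := (e.hom.as.app a).toNatTrans.naturality φ
  refine (Category.id_comp _).trans ((Category.assoc _ _ _).trans ?_)
  exact (congrArg (fun t => (adj.unit.as.app a).toNatTrans.app X ≫ t) this).trans
    (Category.assoc _ _ _).symm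

lemma nonempty_adjunction_of_iso_left {l l' : P ⟶ Q} {r : Q ⟶ P} (adj : Bicategory.Adjunction l r)
    (e : l ≅ l') : Nonempty (Bicategory.Adjunction l' r) := by
  refine nonempty_adjunction_of_counit (r ◁ e.inv ≫ adj.counit) fun a X Y => ?_
  have h := ((adjunctionApp adj a).homEquiv X Y).symm.bijective
  rw [show ⇑((adjunctionApp adj a).homEquiv X Y).symm =
      fun φ => (l.app a).toFunctor.map φ ≫ (adjunctionApp adj a).counit.app Y
      from funext fun φ => (adjunctionApp adj a).homEquiv_counit ..] at h
  let i : (l'.app a).toFunctor.obj X ≅ (l.app a).toFunctor.obj X :=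
    { hom := (e.inv.as.app a).toNatTrans.app X
      inv := (e.hom.as.app a).toNatTrans.app X
      hom_inv_id := congr(($(e.inv_hom_id).as.app a).toNatTrans.app X)
      inv_hom_id := congr(($(e.hom_inv_id).as.app a).toNatTrans.app X) }
  refine (congrArg Function.Bijective (funext fun φ => ?_)).mp
    ((i.bijective_comp (Iso.refl Y)).comp h)
  have := (e.inv.as.app a).toNatTrans.naturality φ
  refine (congrArg (fun t => _ ≫ t) (Category.comp_id _)).trans ?_
  refine (Category.assoc _ _ _).symm.trans ?_
  exact (congrArg (fun t => t ≫ (adj.counit.as.app a).toNatTrans.app Y) this.symm).trans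
    (Category.assoc _ _ _)

end CategoryTheory.Pseudofunctor.StrongTrans

/-! ### Evaluations, constant diagrams and the adjoint 5-tuple. -/

namespace Prederivator

open Pseudofunctor.StrongTrans

/-- The image of a compatible pair of 2-cells satisfies the modification axiom. The 1-cells `X`,
`X'`, `Y`, `Y'` are only equal to images under `D`, so that identities and composites of images are
covered as well. -/
lemma modification_square {B : Type u₁} [Bicategory.{w₁, v₁} B] {C : Type u₂} [Bicategory.{w₂, v₂} C] [Bicategory.Strict C]
    (D : StrictPseudofunctor B C) {a b a' b' : B} {f : a ⟶ b} {f' : a' ⟶ b'}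
    {x x' : a ⟶ a'} {y y' : b ⟶ b'} (μ : x ⟶ x') (ν : y ⟶ y') (h₁ : f ≫ y = x ≫ f')
    (h₂ : f ≫ y' = x' ≫ f') (h : f ◁ ν ≫ eqToHom h₂ = eqToHom h₁ ≫ μ ▷ f')
    {X X' : D.obj a ⟶ D.obj a'} {Y Y' : D.obj b ⟶ D.obj b'}
    (hX : X = D.map x) (hX' : D.map x' = X') (hY : Y = D.map y) (hY' : D.map y' = Y')
    (hh₁ : D.map f ≫ Y = X ≫ D.map f') (hh₂ : D.map f ≫ Y' = X' ≫ D.map f') :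
    D.map f ◁ (eqToHom hY ≫ D.map₂ ν ≫ eqToHom hY') ≫ eqToHom hh₂ =
      eqToHom hh₁ ≫ (eqToHom hX ≫ D.map₂ μ ≫ eqToHom hX') ▷ D.map f' := by
  subst hX hX' hY hY'
  have h' := congrArg D.map₂ h
  simp only [D.map₂_comp, D.map₂_whisker_right, D.map₂_whisker_left, D.mapComp_eq_eqToIso,
    PrelaxFunctor.map₂_eqToHom, eqToIso.hom, eqToIso.inv, Category.assoc, eqToHom_trans,
    eqToHom_trans_assoc] at h'
  have h'' := congrArg (fun t => eqToHom (D.map_comp f y).symm ≫ t ≫ eqToHom (D.map_comp x' f')) h'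
  simpa using h''

end Prederivator

namespace Prederivator

open Pseudofunctor.StrongTrans

variable (D : Prederivator.{u, v, w})

lemma isStrict_restr {A B : Cat.{u, u}} (p : A ⟶ B) : (D.restr p).IsStrict :=
  fun a b f => ⟨map_square D (f := (prodWith B).map f) (f' := (prodWith A).map f)
      (x := (Functor.prod p.toFunctor (𝟭 a.unop)).toCatHom.op)
      (y := (Functor.prod p.toFunctor (𝟭 b.unop)).toCatHom.op) rfl, rfl⟩

lemma isStrict_ev {A : Cat.{u, u}} (a : A) : (D.ev a).IsStrict :=
  fun M N f => ⟨map_square D (f := (prodWith A).map f) (f' := f)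
      (x := (CategoryTheory.Prod.sectR a M.unop).toCatHom.op)
      (y := (CategoryTheory.Prod.sectR a N.unop).toCatHom.op) rfl, rfl⟩

lemma isStrict_const (A : Cat.{u, u}) : (D.const A).IsStrict :=
  fun a b f => ⟨map_square D (f := f) (f' := (prodWith A).map f)
      (x := (CategoryTheory.Prod.snd A a.unop).toCatHom.op)
      (y := (CategoryTheory.Prod.snd A b.unop).toCatHom.op) rfl, rfl⟩

/-- The projection from `A × M` is left adjoint to the inclusion at a terminal object of `A`. -/
def sndAdjSectR {A M : Type u} [Category.{u} A] [Category.{u} M] {a : A}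
    (ha : Limits.IsTerminal a) :
    CategoryTheory.Adjunction (CategoryTheory.Prod.snd A M) (CategoryTheory.Prod.sectR a M) where
  unit :=
    { app := fun x => (ha.from x.1, 𝟙 x.2)
      naturality := fun _ _ _ => Prod.ext (ha.hom_ext _ _)
        ((Category.comp_id _).trans (Category.id_comp _).symm) }
  counit :=
    { app := fun m => 𝟙 m
      naturality := fun _ _ _ => (Category.comp_id _).trans (Category.id_comp _).symm }
  left_triangle_components := fun _ => Category.comp_id _
  right_triangle_components := fun _ => Prod.ext (ha.hom_ext _ _) (Category.comp_id _)

/-- The projection from `A × M` is right adjoint to the inclusion at an initial object of `A`. -/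
def sectRAdjSnd {A M : Type u} [Category.{u} A] [Category.{u} M] {a : A}
    (ha : Limits.IsInitial a) :
    CategoryTheory.Adjunction (CategoryTheory.Prod.sectR a M) (CategoryTheory.Prod.snd A M) where
  counit :=
    { app := fun x => (ha.to x.1, 𝟙 x.2)
      naturality := fun _ _ _ => Prod.ext (ha.hom_ext _ _)
        ((Category.comp_id _).trans (Category.id_comp _).symm) }
  unit :=
    { app := fun m => 𝟙 m
      naturality := fun _ _ _ => (Category.comp_id _).trans (Category.id_comp _).symm }
  right_triangle_components := fun _ => Category.comp_id _
  left_triangle_components := fun _ => Prod.ext (ha.hom_ext _ _) (Category.comp_id _)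

lemma bijective_resAdj_unit {A B : Type u} [Category.{u} A] [Category.{u} B] {l : A ⥤ B}
    {r : B ⥤ A} (adj : CategoryTheory.Adjunction l r) (X : D.val A) (Y : D.val B) :
    Function.Bijective fun φ : (D.res r).obj X ⟶ Y =>
      (D.resAdj adj).unit.app X ≫ (D.res l).map φ := by
  have e := ((D.resAdj adj).homEquiv X Y).bijective
  rwa [show ⇑((D.resAdj adj).homEquiv X Y) = fun φ =>
    (D.resAdj adj).unit.app X ≫ (D.res l).map φ
    from funext fun φ => (D.resAdj adj).homEquiv_unit ..] at e

/-- Restriction reverses the adjunction between the projection `A × M ⥤ M` and its right adjoint,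
the inclusion at a terminal object. The unit is a modification since the unit of that adjunction is
natural in `M`. -/
theorem nonempty_adjunction_ev_const {A : Cat.{u, u}} {a : A} (ha : Limits.IsTerminal a) :
    Nonempty (Bicategory.Adjunction (D.ev a) (D.const A)) := by
  let η : 𝟙 (D.shift A).toPseudofunctor ⟶ D.ev a ≫ D.const A :=
    ⟨{ app := fun M => (D.mapId (op (Cat.of (A × M.unop)))).inv ≫
          D.map₂ (Bicategory.Opposite.op2 (NatTrans.toCatHom₂ (sndAdjSectR (M := M.unop) ha).unit)) ≫
          (D.mapComp (CategoryTheory.Prod.sectR a M.unop).toCatHom.op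
            (CategoryTheory.Prod.snd A M.unop).toCatHom.op).hom
       naturality := fun {M N} f => by
        obtain ⟨h₁, e₁⟩ := isStrict_id (D.shift A).toPseudofunctor f
        obtain ⟨h₂, e₂⟩ := (D.isStrict_ev a).comp (D.isStrict_const A) f
        rw [e₁, e₂]
        simp only [D.mapId_eq_eqToIso, D.mapComp_eq_eqToIso, eqToIso.hom, eqToIso.inv]
        refine modification_square D (f := (prodWith A).map f) (f' := (prodWith A).map f)
          _ _ rfl rfl ?_ _ _ _ _ _ _
        refine (Category.comp_id _).trans (Eq.trans ?_ (Category.id_comp _).symm)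
        refine congrArg Bicategory.Opposite.op2 (Cat.Hom₂.ext (NatTrans.ext (funext fun x => ?_)))
        exact Prod.ext (ha.hom_ext _ _) (f.unop.toFunctor.map_id x.2) }⟩
  exact nonempty_adjunction_of_unit η fun M X Y =>
    D.bijective_resAdj_unit (sndAdjSectR (M := M.unop) ha) X Y

theorem nonempty_adjunction_const_ev {A : Cat.{u, u}} {a : A} (ha : Limits.IsInitial a) :
    Nonempty (Bicategory.Adjunction (D.const A) (D.ev a)) := by
  let η : 𝟙 D.toPseudofunctor ⟶ D.const A ≫ D.ev a :=
    ⟨{ app := fun M => (D.mapId M).inv ≫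
          D.map₂ (Bicategory.Opposite.op2 (NatTrans.toCatHom₂ (sectRAdjSnd (M := M.unop) ha).unit)) ≫
          (D.mapComp (CategoryTheory.Prod.snd A M.unop).toCatHom.op
            (CategoryTheory.Prod.sectR a M.unop).toCatHom.op).hom
       naturality := fun {M N} f => by
        obtain ⟨h₁, e₁⟩ := isStrict_id D.toPseudofunctor f
        obtain ⟨h₂, e₂⟩ := (D.isStrict_const A).comp (D.isStrict_ev a) f
        rw [e₁, e₂]
        simp only [D.mapId_eq_eqToIso, D.mapComp_eq_eqToIso, eqToIso.hom, eqToIso.inv]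
        refine modification_square D (f := f) (f' := f) _ _ rfl rfl ?_ _ _ _ _ _ _
        refine (Category.comp_id _).trans (Eq.trans ?_ (Category.id_comp _).symm)
        refine congrArg Bicategory.Opposite.op2 (Cat.Hom₂.ext (NatTrans.ext (funext fun x => ?_)))
        exact (f.unop.toFunctor.map_id x) }⟩
  exact nonempty_adjunction_of_unit η fun M X Y =>
    D.bijective_resAdj_unit (sectRAdjSnd (M := M.unop) ha) X Y

/-- The modification of restriction morphisms that is induced by a natural transformation. -/
def restrMap {A B : Cat.{u, u}} {p q : A ⥤ B} (α : p ⟶ q) :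
    D.restr p.toCatHom ⟶ D.restr q.toCatHom :=
  ⟨{ app := fun M => D.map₂ (Bicategory.Opposite.op2 (NatTrans.toCatHom₂
        (NatTrans.prod α (𝟙 (𝟭 M.unop)))))
     naturality := fun {M N} f => by
      obtain ⟨h₁, e₁⟩ := D.isStrict_restr p.toCatHom f
      obtain ⟨h₂, e₂⟩ := D.isStrict_restr q.toCatHom f
      rw [e₁, e₂]
      have h := modification_square D (f := (prodWith B).map f) (f' := (prodWith A).map f)
        (Bicategory.Opposite.op2 (NatTrans.toCatHom₂ (NatTrans.prod α (𝟙 (𝟭 M.unop)))))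
        (Bicategory.Opposite.op2 (NatTrans.toCatHom₂ (NatTrans.prod α (𝟙 (𝟭 N.unop)))))
        rfl rfl (by
          refine (Category.comp_id _).trans (Eq.trans ?_ (Category.id_comp _).symm)
          refine congrArg Bicategory.Opposite.op2
            (Cat.Hom₂.ext (NatTrans.ext (funext fun x => ?_)))
          exact Prod.ext rfl (f.unop.toFunctor.map_id x.2)) rfl rfl rfl rfl h₁ h₂
      simp only [eqToHom_refl, Category.id_comp, Category.comp_id] at h
      exact h }⟩

/-- Restriction along a composite. -/
def restrComp {A B C : Cat.{u, u}} (p : A ⟶ B) (q : B ⟶ C) :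
    D.restr q ≫ D.restr p ≅ D.restr (p ≫ q) :=
  IsStrict.isoOfEq ((D.isStrict_restr _).comp (D.isStrict_restr _)) (D.isStrict_restr _)
    fun _ => (D.map_comp _ _).symm

/-- Restriction followed by evaluation. -/
def restrEv {A B : Cat.{u, u}} (p : A ⟶ B) (a : A) :
    D.restr p ≫ D.ev a ≅ D.ev (p.toFunctor.obj a) :=
  IsStrict.isoOfEq ((D.isStrict_restr _).comp (D.isStrict_ev _)) (D.isStrict_ev _)
    -- The two functors `M ⥤ B × M` agree definitionally on objects. On morphisms they agree through
    -- `p.map_id`.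
    fun M => (D.map_comp _ _).symm.trans (congrArg D.map (congrArg Quiver.Hom.op
      (congrArg Functor.toCatHom (CategoryTheory.Functor.ext (fun _ => rfl) (fun _ _ f =>
        Eq.trans (b := (𝟙 _, f)) (Prod.ext (p.toFunctor.map_id a) rfl)
          (by
            change _ = 𝟙 _ ≫ (CategoryTheory.Prod.sectR (p.toFunctor.obj a) M.unop).map f ≫ 𝟙 _
            rw [Category.id_comp, Category.comp_id]
            rfl))))))

/-- Evaluation is the composition of restriction to a point with the evaluation of constant
diagrams on the terminal category. -/
def evIso {A : Cat.{u, u}} (a : A) :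
    D.restr (A := Cat.of (Discrete PUnit.{u + 1})) (Functor.fromPUnit.{u} a).toCatHom ≫
      D.ev (A := Cat.of (Discrete PUnit.{u + 1})) ⟨PUnit.unit⟩ ≅ D.ev a :=
  D.restrEv _ _

variable {D}

/-- Evaluation factors as restriction to a point followed by evaluation on `D^𝟙`. The first has a
left Kan extension as left adjoint, the second has the constant diagram morphism, because the only
object of the point is initial. -/
theorem IsDerivator.nonempty_leftAdjoint_ev (hD : D.IsDerivator) {A : Cat.{u, u}} (a : A) :
    Nonempty (Bicategory.LeftAdjoint (D.ev a)) := by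
  obtain ⟨L⟩ := hD.nonempty_leftKan (A := Cat.of (Discrete PUnit.{u + 1}))
    (Functor.fromPUnit.{u} a).toCatHom
  obtain ⟨adj⟩ := D.nonempty_adjunction_const_ev (A := Cat.of (Discrete PUnit.{u + 1}))
    (a := ⟨PUnit.unit⟩) (Limits.IsInitial.ofUniqueHom (fun _ => ⟨⟨Subsingleton.elim _ _⟩⟩)
      fun _ _ => ULift.ext _ _ rfl)
  obtain ⟨adj'⟩ := nonempty_adjunction_of_iso_right (adj.comp L.adj) (D.evIso a)
  exact ⟨⟨_, adj'⟩⟩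

theorem IsDerivator.nonempty_rightAdjoint_ev (hD : D.IsDerivator) {A : Cat.{u, u}} (a : A) :
    Nonempty (Bicategory.RightAdjoint (D.ev a)) := by
  obtain ⟨R⟩ := hD.nonempty_rightKan (A := Cat.of (Discrete PUnit.{u + 1}))
    (Functor.fromPUnit.{u} a).toCatHom
  obtain ⟨adj⟩ := D.nonempty_adjunction_ev_const (A := Cat.of (Discrete PUnit.{u + 1}))
    (a := ⟨PUnit.unit⟩) (Limits.IsTerminal.ofUniqueHom (fun _ => ⟨⟨Subsingleton.elim _ _⟩⟩)
      fun _ _ => ULift.ext _ _ rfl)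
  obtain ⟨adj'⟩ := nonempty_adjunction_of_iso_left (R.adj.comp adj) (D.evIso a)
  exact ⟨⟨_, adj'⟩⟩

/-- The object `1` of `[1]` is terminal. -/
def isTerminalOne : Limits.IsTerminal (C := ULift.{u} (Fin 2)) (ULift.up 1) :=
  Limits.IsTerminal.ofUniqueHom (fun x => homOfLE (show x.down ≤ 1 from Fin.le_last _))
    fun _ _ => Subsingleton.elim _ _

/-- The object `0` of `[1]` is initial. -/
def isInitialZero : Limits.IsInitial (C := ULift.{u} (Fin 2)) (ULift.up 0) :=
  Limits.IsInitial.ofUniqueHom (fun x => homOfLE (show 0 ≤ x.down from Fin.zero_le _))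
    fun _ _ => Subsingleton.elim _ _

theorem IsDerivator.nonempty_adjointFiveTuple (hD : D.IsDerivator) :
    Nonempty D.AdjointFiveTuple := by
  obtain ⟨L⟩ := hD.nonempty_leftAdjoint_ev (A := arrow.{u}) (ULift.up 1)
  obtain ⟨R⟩ := hD.nonempty_rightAdjoint_ev (A := arrow.{u}) (ULift.up 0)
  obtain ⟨a₁⟩ := D.nonempty_adjunction_ev_const (A := arrow.{u}) isTerminalOne
  obtain ⟨a₀⟩ := D.nonempty_adjunction_const_ev (A := arrow.{u}) isInitialZero
  exact ⟨⟨L.left, R.right, L.adj, a₁, a₀, R.adj⟩⟩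

end Prederivator

/-! ### Empty slices, and Kan extensions along fully faithful functors. -/

namespace Prederivator

variable {D : Prederivator.{u, v, w}}

section

variable {A B E : Type u} [Category.{u} A] [Category.{u} B] [Category.{u} E]

lemma isIso_res_map_comp_iff (p : A ⥤ B) (f : B ⥤ E) {X Y : D.val E} (φ : X ⟶ Y) :
    IsIso ((D.res (p ⋙ f)).map φ) ↔ IsIso ((D.res p).map ((D.res f).map φ)) :=
  (NatIso.isIso_map_iff (D.resComp p f) φ).symm

lemma isIso_res_map_iff {f g : A ⥤ B} (e : f ≅ g) {X Y : D.val B} (φ : X ⟶ Y) :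
    IsIso ((D.res f).map φ) ↔ IsIso ((D.res g).map φ) :=
  NatIso.isIso_map_iff (D.resIso e) φ

namespace IsDerivator

/-- Der1 for the empty family identifies `D(∅)` with the terminal category. -/
lemma unique_hom_of_isEmpty (hD : D.IsDerivator) [IsEmpty E] :
    Nonempty (D.val E) ∧ ∀ X Y : D.val E, Nonempty (Unique (X ⟶ Y)) := by
  let F : PEmpty.{u + 1} → Type u := PEmpty.elim
  let _ : ∀ i, Category.{u} (F i) := fun i => i.elim
  have h := hD.der1 PEmpty.{u + 1} F
  let f : E ⥤ Σ i, F i :=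
    { obj := isEmptyElim, map := fun {x} => isEmptyElim x
      map_id := isEmptyElim, map_comp := fun {x} => isEmptyElim x }
  let g : (Σ i, F i) ⥤ E :=
    { obj := fun x => x.1.elim, map := fun {x} => x.1.elim
      map_id := fun x => x.1.elim, map_comp := fun {x} => x.1.elim }
  let e : f ⋙ g ≅ 𝟭 E := NatIso.ofComponents (fun x => isEmptyElim x) fun {x} => isEmptyElim x
  let P := Functor.pi' fun i => D.res (CategoryTheory.Sigma.incl (C := F) i)
  have key (X Y : D.val (Σ i, F i)) : Nonempty (Unique (X ⟶ Y)) :=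
    ⟨⟨⟨P.preimage fun i => i.elim⟩, fun φ => P.map_injective (funext fun i => i.elim)⟩⟩
  refine ⟨⟨(D.res f).obj (P.objPreimage fun i => i.elim)⟩, fun X Y => ?_⟩
  -- Der1 concerns one particular empty category, the empty coproduct; the equivalence given by `f`
  -- and `g` transports the conclusion to `E`.
  let i (X : D.val E) : (D.res f).obj ((D.res g).obj X) ≅ X :=
    D.compAt f g X ≪≫ asIso (D.mapAt e.hom X) ≪≫ D.idAt X
  have hi {X Y : D.val E} (φ : X ⟶ Y) :
      (D.res f).map ((D.res g).map φ) ≫ (i Y).hom = (i X).hom ≫ φ := by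
    simp [i, reassoc_of% @compAt_naturality, reassoc_of% @mapAt_naturality, idAt_naturality]
  obtain ⟨u⟩ := key ((D.res g).obj X) ((D.res g).obj Y)
  refine ⟨⟨⟨(i X).inv ≫ (D.res f).map u.default ≫ (i Y).hom⟩, fun φ => ?_⟩⟩
  refine (Iso.eq_inv_comp _).2 ?_
  exact (hi φ).symm.trans (congrArg (fun t => (D.res f).map t ≫ (i Y).hom) (u.uniq _))

/-- Maps `Y ⟶ Z` correspond to maps in the value of `D` at an empty category, and these are unique.
-/
lemma isInitial_of_isLan (hD : D.IsDerivator) [IsEmpty E] {q : E ⥤ A} {X : D.val E} {Y : D.val A}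
    {θ : X ⟶ (D.res q).obj Y} (h : D.IsLan q θ) : Nonempty (Limits.IsInitial Y) := by
  have h' (Z : D.val A) : Nonempty (Unique (Y ⟶ Z)) :=
    (hD.unique_hom_of_isEmpty.2 X _).map fun u =>
      @Equiv.unique _ _ u (Equiv.ofBijective _ (h Z))
  let _ := fun Z => (h' Z).some
  exact ⟨Limits.IsInitial.ofUnique Y⟩

lemma isTerminal_of_isRan (hD : D.IsDerivator) [IsEmpty E] {q : E ⥤ A} {X : D.val E} {Y : D.val A}
    {κ : (D.res q).obj Y ⟶ X} (h : D.IsRan q κ) : Nonempty (Limits.IsTerminal Y) := by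
  have h' (Z : D.val A) : Nonempty (Unique (Z ⟶ Y)) :=
    (hD.unique_hom_of_isEmpty.2 _ X).map fun u =>
      @Equiv.unique _ _ u (Equiv.ofBijective _ (h Z))
  let _ := fun Z => (h' Z).some
  exact ⟨Limits.IsTerminal.ofUnique Y⟩

/-- A left Kan extension is initial at objects which are not reached by the functor. -/
lemma isInitial_of_isEmpty_hom (hD : D.IsDerivator) {f : A ⥤ B} {X : D.val A} {Y : D.val B}
    {θ : X ⟶ (D.res f).obj Y} (h : D.IsLan f θ) (b : B) (hb : ∀ a, IsEmpty (f.obj a ⟶ b)) :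
    Nonempty (Limits.IsInitial ((D.res (Functor.fromPUnit.{u} b)).obj Y)) := by
  have : IsEmpty (Comma f (Functor.fromPUnit.{u} b)) := ⟨fun x => (hb x.left).false x.hom⟩
  exact hD.isInitial_of_isLan (hD.isLan_comma h b)

/-- A right Kan extension is terminal at objects which do not reach the functor. -/
lemma isTerminal_of_isEmpty_hom (hD : D.IsDerivator) {f : A ⥤ B} {X : D.val A} {Y : D.val B}
    {κ : (D.res f).obj Y ⟶ X} (h : D.IsRan f κ) (b : B) (hb : ∀ a, IsEmpty (b ⟶ f.obj a)) :
    Nonempty (Limits.IsTerminal ((D.res (Functor.fromPUnit.{u} b)).obj Y)) := by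
  have : IsEmpty (Comma (Functor.fromPUnit.{u} b) f) := ⟨fun x => (hb x.right).false x.hom⟩
  exact hD.isTerminal_of_isRan (hD.isRan_comma h b)

lemma exists_isTerminal (hD : D.IsDerivator) (A : Type u) [Category.{u} A] :
    ∃ Y : D.val A, Nonempty (Limits.IsTerminal Y) := by
  obtain ⟨⟨X⟩, -⟩ := hD.unique_hom_of_isEmpty (E := Discrete PEmpty.{u + 1})
  obtain ⟨r, ⟨adj⟩⟩ := hD.exists_ran (Functor.empty.{u} A)
  exact ⟨_, hD.isTerminal_of_isRan (isRan_counit adj X)⟩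

/-- Left Kan extensions along fully faithful functors are extensions. -/
lemma isIso_of_isLan (hD : D.IsDerivator) {f : A ⥤ B} [f.Full] [f.Faithful] {X : D.val A}
    {Y : D.val B} {θ : X ⟶ (D.res f).obj Y} (h : D.IsLan f θ) : IsIso θ := by
  refine hD.der2 A θ fun a => ?_
  let c := Functor.fromPUnit.{u} (f.obj a)
  -- For fully faithful `f` the slice over `f a` has the terminal object `(a, 𝟙)`, with maps into it
  -- given by `f.preimage`. So `J` is a right adjoint, hence cofinal, and the extension at `f a` is
  -- read off at `a`.
  let J : Discrete PUnit.{u + 1} ⥤ Comma f c := (Functor.const _).obj ⟨a, ⟨PUnit.unit⟩, 𝟙 _⟩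
  let adj : CategoryTheory.Adjunction (Comma.snd f c) J :=
    { unit :=
        { app := fun x => ⟨f.preimage x.hom, ⟨⟨Subsingleton.elim _ _⟩⟩,
            (Category.comp_id _).trans ((f.map_preimage _).trans (Category.comp_id _).symm)⟩
          naturality := fun x y φ => CommaMorphism.ext
            (f.map_injective (by
              change f.map (φ.left ≫ f.preimage y.hom) = f.map (f.preimage x.hom ≫ 𝟙 _)
              rw [f.map_comp, f.map_preimage, Category.comp_id, f.map_preimage]
              exact φ.w.trans (Category.comp_id _)))
            (ULift.ext _ _ rfl) }
      counit :=
        { app := fun x => ⟨⟨Subsingleton.elim _ _⟩⟩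
          naturality := fun _ _ _ => ULift.ext _ _ rfl }
      left_triangle_components := fun _ => ULift.ext _ _ rfl
      right_triangle_components := fun _ => CommaMorphism.ext
        (by
          change f.preimage (𝟙 _) ≫ 𝟙 _ = 𝟙 _
          rw [Category.comp_id, f.preimage_id]) (ULift.ext _ _ rfl) }
  have := isIso_of_discrete (Functor.whiskerRight adj.unit (Comma.snd f c))
  have h₁ := (D.isCofinal_of_adj adj (Comma.snd f c)).isLan_iff.2 (hD.isLan_comma h (f.obj a))
  have h₂ := h₁.isIso_of_iso_id
    (NatIso.ofComponents (fun _ => eqToIso (Subsingleton.elim _ _)) fun _ => ULift.ext _ _ rfl)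
  have s := D.map_squareAt J (Comma.natTrans f c) Y
  have hJ : IsIso (Functor.whiskerLeft J (Comma.natTrans f c)) := by
    have : ∀ x, IsIso ((Functor.whiskerLeft J (Comma.natTrans f c)).app x) := fun x =>
      inferInstanceAs (IsIso (𝟙 (f.obj a)))
    exact NatIso.isIso_of_isIso_app _
  -- The comma 2-cell is an identity at the terminal object, so up to isomorphisms the base change
  -- restricted along `J` is the value of `θ` at `a`.
  have h₃ : IsIso ((D.res J).map ((D.res (Comma.fst f c)).map θ) ≫
      (D.compAt J (Comma.fst f c) ((D.res f).obj Y)).hom ≫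
        (D.compAt (J ⋙ Comma.fst f c) f Y).hom ≫
          D.mapAt (Functor.whiskerLeft J (Comma.natTrans f c)) Y) := by
    rw [← s]
    have : IsIso (((D.res J).map (D.baseChange (Comma.natTrans f c) θ) ≫
      (D.compAt J (Comma.snd f c) ((D.res c).obj Y)).hom) ≫
        (D.compAt (J ⋙ Comma.snd f c) c Y).hom) := inferInstance
    simpa [baseChange] using this
  have h₄ : IsIso ((D.res J).map ((D.res (Comma.fst f c)).map θ)) :=
    IsIso.of_isIso_comp_right _ ((D.compAt J (Comma.fst f c) ((D.res f).obj Y)).hom ≫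
        (D.compAt (J ⋙ Comma.fst f c) f Y).hom ≫
          D.mapAt (Functor.whiskerLeft J (Comma.natTrans f c)) Y)
  rw [← isIso_res_map_comp_iff] at h₄
  refine (isIso_res_map_iff ?_ θ).1 h₄
  exact NatIso.ofComponents (fun _ => Iso.refl _)
    fun _ => (Category.comp_id _).trans (Category.id_comp _).symm

/-- Right Kan extensions along fully faithful functors are extensions. -/
lemma isIso_of_isRan (hD : D.IsDerivator) {f : A ⥤ B} [f.Full] [f.Faithful] {X : D.val A}
    {Y : D.val B} {κ : (D.res f).obj Y ⟶ X} (h : D.IsRan f κ) : IsIso κ := by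
  refine hD.der2 A κ fun a => ?_
  let c := Functor.fromPUnit.{u} (f.obj a)
  let J : Discrete PUnit.{u + 1} ⥤ Comma c f := (Functor.const _).obj ⟨⟨PUnit.unit⟩, a, 𝟙 _⟩
  let adj : CategoryTheory.Adjunction J (Comma.fst c f) :=
    { counit :=
        { app := fun x => ⟨⟨⟨Subsingleton.elim _ _⟩⟩, f.preimage x.hom,
            (Category.id_comp _).trans ((f.map_preimage x.hom).symm.trans
              (Category.id_comp (f.map (f.preimage x.hom))).symm)⟩
          naturality := fun x y φ => CommaMorphism.ext (ULift.ext _ _ rfl)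
            (f.map_injective (by
              change f.map (𝟙 _ ≫ f.preimage y.hom) = f.map (f.preimage x.hom ≫ φ.right)
              rw [f.map_comp _ φ.right, f.map_preimage, Category.id_comp, f.map_preimage]
              exact (Category.id_comp _).symm.trans φ.w)) }
      unit :=
        { app := fun x => ⟨⟨Subsingleton.elim _ _⟩⟩
          naturality := fun _ _ _ => ULift.ext _ _ rfl }
      right_triangle_components := fun _ => ULift.ext _ _ rfl
      left_triangle_components := fun _ => CommaMorphism.ext (ULift.ext _ _ rfl)
        (by
          change 𝟙 _ ≫ f.preimage (𝟙 _) = 𝟙 _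
          rw [Category.id_comp, f.preimage_id]) }
  have := isIso_of_discrete (Functor.whiskerRight adj.counit (Comma.fst c f))
  have h₁ := (D.isCoinitial_of_adj adj (Comma.fst c f)).isRan_iff.2 (hD.isRan_comma h (f.obj a))
  have h₂ := h₁.isIso_of_iso_id
    (NatIso.ofComponents (fun _ => eqToIso (Subsingleton.elim _ _)) fun _ => ULift.ext _ _ rfl)
  have s := D.map_squareAt J (Comma.natTrans c f) Y
  have hJ : IsIso (Functor.whiskerLeft J (Comma.natTrans c f)) := by
    have : ∀ x, IsIso ((Functor.whiskerLeft J (Comma.natTrans c f)).app x) := fun x =>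
      inferInstanceAs (IsIso (𝟙 (f.obj a)))
    exact NatIso.isIso_of_isIso_app _
  have h₃ : IsIso ((D.res J).map (D.squareAt (Comma.natTrans c f) Y)) := by
    rw [← Category.assoc, ← Iso.eq_comp_inv, ← Iso.eq_comp_inv] at s
    rw [s]
    infer_instance
  have h₄ : IsIso ((D.res J).map ((D.res (Comma.snd c f)).map κ)) := by
    have h₅ : IsIso (((D.compAt J (Comma.fst c f) ((D.res c).obj Y)).inv ≫
        (D.res J).map (D.squareAt (Comma.natTrans c f) Y)) ≫
          (D.res J).map ((D.res (Comma.snd c f)).map κ)) := by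
      rw [Category.assoc, ← Functor.map_comp]
      exact h₂
    exact IsIso.of_isIso_comp_left ((D.compAt J (Comma.fst c f) ((D.res c).obj Y)).inv ≫
        (D.res J).map (D.squareAt (Comma.natTrans c f) Y)) _
  rw [← isIso_res_map_comp_iff] at h₄
  refine (isIso_res_map_iff ?_ κ).1 h₄
  exact NatIso.ofComponents (fun _ => Iso.refl _)
    fun _ => (Category.comp_id _).trans (Category.id_comp _).symm

end IsDerivator

end

end Prederivator

/-! ### Zero objects, and pointedness from an extension of the 5-tuple. -/

namespace CategoryTheory

lemma Limits.isZero_of_isInitial_of_isTerminal {C : Type*} [Category* C] {X : C}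
    (hi : Limits.IsInitial X) (ht : Limits.IsTerminal X) : Limits.IsZero X where
  unique_to Y := ⟨⟨⟨hi.to Y⟩, fun _ => hi.hom_ext _ _⟩⟩
  unique_from Y := ⟨⟨⟨ht.from Y⟩, fun _ => ht.hom_ext _ _⟩⟩

/-- Both objects are zero objects. This is how pointedness enters the cone and the fiber: at the
corner `(0,1)` or at an end of `[1]`, one value is initial and the other is terminal. -/
lemma Limits.isIso_of_isInitial_of_isTerminal {C : Type*} [Category* C]
    [Limits.HasZeroObject C] {X Y : C} (hX : Limits.IsInitial X) (hY : Limits.IsTerminal Y)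
    (f : X ⟶ Y) : IsIso f := by
  have h₁ := (Limits.isZero_zero C).of_iso (hX.uniqueUpToIso (Limits.isZero_zero C).isInitial)
  have h₂ := (Limits.isZero_zero C).of_iso (hY.uniqueUpToIso (Limits.isZero_zero C).isTerminal)
  rw [h₁.eq_of_src f (h₁.iso h₂).hom]
  infer_instance

lemma Adjunction.nonempty_isTerminal_obj {C D : Type*} [Category* C] [Category* D] {l : C ⥤ D}
    {r : D ⥤ C} (adj : CategoryTheory.Adjunction l r) {Y : D} (h : Limits.IsTerminal Y) :
    Nonempty (Limits.IsTerminal (r.obj Y)) :=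
  ⟨Limits.IsTerminal.ofUniqueHom (fun X => adj.homEquiv X Y (h.from _)) fun X _ =>
    ((adj.homEquiv X Y).symm_apply_eq.1 (h.hom_ext _ _))⟩

end CategoryTheory

namespace Prederivator

open Pseudofunctor.StrongTrans

variable {D : Prederivator.{u, v, w}}

/-- The inclusions `M ⥤ A × M` at an object of `A` commute with the inclusions of objects. -/
def fromPUnitSectRIso {A M : Type u} [Category.{u} A] [Category.{u} M] (a : A) (m : M) :
    Functor.fromPUnit.{u} m ⋙ CategoryTheory.Prod.sectR a M ≅ Functor.fromPUnit.{u} (a, m) :=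
  NatIso.ofComponents (fun _ => Iso.refl _)
    fun _ => (Category.comp_id _).trans (Category.id_comp _).symm

/-- The values of a left adjoint of `1^*` at `0`. -/
lemma IsDerivator.isInitial_lan_one (hD : D.IsDerivator)
    {l : D.toPseudofunctor ⟶ (D.shift arrow.{u}).toPseudofunctor}
    (adj : Bicategory.Adjunction l D.ev₁) (M : Cat.{u, u}) (m : M) (X : D.val M) :
    Nonempty (Limits.IsInitial ((D.res (Functor.fromPUnit.{u} ((ULift.up 0, m) : arrow.{u} × M))).obj
      ((l.app (op M)).toFunctor.obj X))) :=
  hD.isInitial_of_isEmpty_hom (f := CategoryTheory.Prod.sectR (ULift.up 1 : arrow.{u}) M)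
    (isLan_unit (adjunctionApp adj (op M)) X) _
    fun _ => ⟨fun g => absurd (show (1 : Fin 2) ≤ 0 from leOfHom (X := ULift.{u} (Fin 2)) g.1)
      (by decide)⟩

/-- The values of a right adjoint of `0^*` at `1`. -/
lemma IsDerivator.isTerminal_ran_zero (hD : D.IsDerivator)
    {r : D.toPseudofunctor ⟶ (D.shift arrow.{u}).toPseudofunctor}
    (adj : Bicategory.Adjunction D.ev₀ r) (M : Cat.{u, u}) (m : M) (X : D.val M) :
    Nonempty (Limits.IsTerminal ((D.res (Functor.fromPUnit.{u} ((ULift.up 1, m) : arrow.{u} × M))).obj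
      ((r.app (op M)).toFunctor.obj X))) :=
  hD.isTerminal_of_isEmpty_hom (f := CategoryTheory.Prod.sectR (ULift.up 0 : arrow.{u}) M)
    (isRan_counit (adjunctionApp adj (op M)) X) _
    fun _ => ⟨fun g => absurd (show (1 : Fin 2) ≤ 0 from leOfHom (X := ULift.{u} (Fin 2)) g.1)
      (by decide)⟩

/-- A derivator is pointed as soon as `1_!` has a left adjoint. -/
theorem IsDerivator.isPointed_of_extension (hD : D.IsDerivator) {T : D.AdjointFiveTuple}
    (E : T.Extension) : D.IsPointed := by
  obtain ⟨t, ⟨ht⟩⟩ := hD.exists_isTerminal (Discrete PUnit.{u + 1})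
  let A := Discrete PUnit.{u + 1}
  -- Both `1_!` and `0^*` are right adjoints, so they carry the terminal object `t` to terminal
  -- objects. Only the additional left adjoint is needed.
  obtain ⟨h₁⟩ := (adjunctionApp E.adjOuterLeft (op (Cat.of A))).nonempty_isTerminal_obj ht
  obtain ⟨h₂⟩ := (adjunctionApp T.adjConst (op (Cat.of A))).nonempty_isTerminal_obj h₁
  obtain ⟨h₃⟩ := hD.isInitial_lan_one T.adjLan₁ (Cat.of A) ⟨PUnit.unit⟩ t
  let x : D.val (ULift.{u} (Fin 2) × A) := (T.lan₁.app (op (Cat.of A))).toFunctor.obj t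
  let z : D.val A := (D.res (CategoryTheory.Prod.sectR (ULift.up 0 : ULift.{u} (Fin 2)) A)).obj x
  let e : 𝟭 A ≅ Functor.fromPUnit.{u} (⟨PUnit.unit⟩ : A) :=
    NatIso.ofComponents (fun _ => eqToIso (Subsingleton.elim (α := Discrete PUnit.{u + 1}) _ _))
      fun _ => ULift.ext _ _ rfl
  let e' := fromPUnitSectRIso (ULift.up 0 : ULift.{u} (Fin 2)) (⟨PUnit.unit⟩ : A)
  -- The value of `x` at the object `(0, *)` is initial and the restriction of `x` along `* ↦ (0,
  -- *)` is terminal; this identifies the two.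
  let i : (D.res (Functor.fromPUnit.{u} ((ULift.up 0, ⟨PUnit.unit⟩) : ULift.{u} (Fin 2) × A))).obj
      x ≅ z :=
    (asIso (D.mapAt e'.hom x)).symm ≪≫ (D.compAt _ _ x).symm ≪≫ (asIso (D.mapAt e.hom z)).symm ≪≫
      D.idAt z
  exact (Limits.isZero_of_isInitial_of_isTerminal (h₃.ofIso i) h₂).hasZeroObject

end Prederivator

/-! ### The formal universal properties of cone and fiber. -/

namespace CategoryTheory.Adjunction

section

variable {C D : Type*} [Category* C] [Category* D] {l : C ⥤ D} {r : D ⥤ C}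
  (adj : CategoryTheory.Adjunction l r)

/-- Only `Y` has to be local: transposing `l.map φ` gives `φ` followed by the unit at `Y`. -/
lemma bijective_map_of_isIso_unit (X Y : C) [IsIso (adj.unit.app Y)] :
    Function.Bijective fun φ : X ⟶ Y => l.map φ := by
  let y : Y ≅ r.obj (l.obj Y) := asIso (adj.unit.app Y)
  have h := (adj.homEquiv X (l.obj Y)).symm.bijective.comp ((Iso.refl X).bijective_comp y)
  convert h using 1
  funext φ
  simp [y, homEquiv_counit]

lemma bijective_map_of_isIso_counit (X Y : D) [IsIso (adj.counit.app X)] :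
    Function.Bijective fun φ : X ⟶ Y => r.map φ := by
  let x : l.obj (r.obj X) ≅ X := asIso (adj.counit.app X)
  have h := (adj.homEquiv (r.obj X) Y).bijective.comp (x.bijective_comp (Iso.refl Y))
  convert h using 1
  funext φ
  simp [x, homEquiv_unit]

end

section

variable {A S Q V : Type*} [Category* A] [Category* S] [Category* Q] [Category* V]

/-- Universality of the unit of the cone, formulated for adjunctions `i ⊣ R`, `L ⊣ ι`, `b ⊣ r`
and `E ⊣ e`. -/
lemma bijective_cone_unit {i : S ⥤ A} {R : A ⥤ S} {L : S ⥤ Q} {ι : Q ⥤ S} {b : Q ⥤ A} {r : A ⥤ Q}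
    {e : A ⥤ V} {E : V ⥤ A} (adj₁ : CategoryTheory.Adjunction i R)
    (adj₂ : CategoryTheory.Adjunction L ι) (adj₃ : CategoryTheory.Adjunction b r)
    (adj₄ : CategoryTheory.Adjunction E e) (γ : ι ⋙ i ⟶ b) (f : A) (X : V)
    [IsIso (adj₁.counit.app f)] [IsIso (adj₁.unit.app (ι.obj (r.obj (E.obj X))))]
    [IsIso (adj₄.unit.app X)] [IsIso (adj₄.counit.app (b.obj (L.obj (R.obj f))))]
    [IsIso (γ.app (r.obj (E.obj X)))] [IsIso (adj₃.counit.app (E.obj X))] :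
    Function.Bijective fun φ : e.obj (b.obj (L.obj (R.obj f))) ⟶ X =>
      inv (adj₁.counit.app f) ≫ i.map (adj₂.unit.app (R.obj f)) ≫ γ.app (L.obj (R.obj f)) ≫
        inv (adj₄.counit.app (b.obj (L.obj (R.obj f)))) ≫ E.map φ := by
  -- Maps `e b L R f ⟶ X` are maps `b L R f ⟶ E X`, since `b L R f` lies in the essential image of
  -- `E`.
  have h₁ := ((asIso (adj₄.counit.app (b.obj (L.obj (R.obj f))))).symm.bijective_comp
    (Iso.refl (E.obj X))).comp (adj₄.bijective_map_of_isIso_unit _ X)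
  have h₂ := (adj₂.homEquiv _ _).bijective.comp ((adj₃.homEquiv _ _).bijective.comp h₁)
  -- On an object pulled back by `r`, the restriction through `ι` and `i` agrees with `b` via `γ`,
  -- and `b r` is the identity there.
  let j : (ι ⋙ i).obj (r.obj (E.obj X)) ≅ E.obj X :=
    asIso (γ.app (r.obj (E.obj X))) ≪≫ asIso (adj₃.counit.app (E.obj X))
  -- Applying `i` loses nothing on maps into `ι r E X`, because this object lies in the essential
  -- image of `R`.
  have h₃ := ((asIso (adj₁.counit.app f)).symm.bijective_comp j).comp
    ((adj₁.bijective_map_of_isIso_unit _ (ι.obj (r.obj (E.obj X)))).comp h₂)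
  convert h₃ using 1
  funext φ
  have n (ψ : L.obj (R.obj f) ⟶ r.obj (E.obj X)) : i.map (ι.map ψ) ≫ γ.app (r.obj (E.obj X)) =
    γ.app _ ≫ b.map ψ := γ.naturality ψ
  simp only [Function.comp_apply, Iso.symm_hom, Iso.refl_hom, Category.comp_id, asIso_inv,
    adj₂.homEquiv_unit, Functor.map_comp, Category.assoc]
  congr 2
  change _ = i.map (ι.map _) ≫ γ.app (r.obj (E.obj X)) ≫ adj₃.counit.app (E.obj X)
  rw [reassoc_of% n]
  refine congrArg (fun t => _ ≫ t) ?_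
  exact ((adj₃.homEquiv_counit _ _ _).symm.trans (Equiv.symm_apply_apply _ _)).symm

/-- Universality of the counit of the fiber, formulated for adjunctions `L ⊣ i`, `ι ⊣ R`, `r ⊣ b`
and `e ⊣ E`. -/
lemma bijective_fiber_counit {i : S ⥤ A} {R : S ⥤ Q} {L : A ⥤ S} {ι : Q ⥤ S} {b : Q ⥤ A}
    {r : A ⥤ Q} {e : A ⥤ V} {E : V ⥤ A} (adj₁ : CategoryTheory.Adjunction L i)
    (adj₂ : CategoryTheory.Adjunction ι R) (adj₃ : CategoryTheory.Adjunction r b)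
    (adj₄ : CategoryTheory.Adjunction e E) (γ : b ⟶ ι ⋙ i) (f : A) (X : V)
    [IsIso (adj₁.unit.app f)] [IsIso (adj₁.counit.app (ι.obj (r.obj (E.obj X))))]
    [IsIso (adj₄.counit.app X)] [IsIso (adj₄.unit.app (b.obj (R.obj (L.obj f))))]
    [IsIso (γ.app (r.obj (E.obj X)))] [IsIso (adj₃.unit.app (E.obj X))] :
    Function.Bijective fun φ : X ⟶ e.obj (b.obj (R.obj (L.obj f))) =>
      E.map φ ≫ inv (adj₄.unit.app (b.obj (R.obj (L.obj f)))) ≫ γ.app (R.obj (L.obj f)) ≫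
        i.map (adj₂.counit.app (L.obj f)) ≫ inv (adj₁.unit.app f) := by
  have h₁ := ((Iso.refl (E.obj X)).bijective_comp
    (asIso (adj₄.unit.app (b.obj (R.obj (L.obj f))))).symm).comp
      (adj₄.bijective_map_of_isIso_counit X _)
  have h₂ := (adj₂.homEquiv _ _).symm.bijective.comp ((adj₃.homEquiv _ _).symm.bijective.comp h₁)
  let j : E.obj X ≅ (ι ⋙ i).obj (r.obj (E.obj X)) :=
    asIso (adj₃.unit.app (E.obj X)) ≪≫ asIso (γ.app (r.obj (E.obj X)))
  have h₃ := (j.bijective_comp (asIso (adj₁.unit.app f)).symm).comp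
    ((adj₁.bijective_map_of_isIso_counit (ι.obj (r.obj (E.obj X))) _).comp h₂)
  convert h₃ using 1
  funext φ
  have n (ψ : r.obj (E.obj X) ⟶ R.obj (L.obj f)) : γ.app (r.obj (E.obj X)) ≫ i.map (ι.map ψ) =
    b.map ψ ≫ γ.app _ := (γ.naturality ψ).symm
  simp only [Function.comp_apply, Iso.symm_hom, Iso.refl_hom, Category.id_comp, asIso_inv,
    adj₂.homEquiv_counit, Functor.map_comp, Category.assoc]
  change _ = (adj₃.unit.app (E.obj X) ≫ γ.app (r.obj (E.obj X))) ≫ i.map (ι.map _) ≫ _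
  rw [Category.assoc, reassoc_of% n]
  have e := (adj₃.homEquiv_unit _ _ _).symm.trans (Equiv.apply_symm_apply (adj₃.homEquiv _ _)
    (E.map φ ≫ inv (adj₄.unit.app (b.obj (R.obj (L.obj f))))))
  refine (Category.assoc _ _ _).symm.trans (Eq.trans ?_ (Category.assoc _ _ _))
  exact congrArg (fun t => t ≫ _) e.symm

end

end CategoryTheory.Adjunction

/-! ### Invertible modifications. -/

namespace CategoryTheory.Pseudofunctor.StrongTrans

variable {B : Type u} [Bicategory.{w, v} B] {P Q : Pseudofunctor B Cat.{v₁, u₁}}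

/-- The inverses of the components satisfy the modification axiom, as follows by cancelling the
components of `m` on both sides. -/
lemma isIso_of_isIso_app {σ τ : P ⟶ Q} (m : σ ⟶ τ)
    (h : ∀ a X, IsIso ((m.as.app a).toNatTrans.app X)) : IsIso m := by
  have h' (a : B) : IsIso (m.as.app a) := by
    have := fun X => h a X
    have : IsIso (m.as.app a).toNatTrans := NatIso.isIso_of_isIso_app _
    exact ⟨NatTrans.toCatHom₂ (inv (m.as.app a).toNatTrans),
      Cat.Hom₂.ext (IsIso.hom_inv_id (m.as.app a).toNatTrans),
      Cat.Hom₂.ext (IsIso.inv_hom_id (m.as.app a).toNatTrans)⟩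
  refine ⟨⟨⟨fun a => inv (m.as.app a), fun {a b} f => ?_⟩⟩, homCategory.ext fun a => ?_,
    homCategory.ext fun a => ?_⟩
  · have e := m.as.naturality f
    rw [← cancel_epi (P.map f ◁ m.as.app b), ← cancel_mono (m.as.app a ▷ Q.map f)]
    simp only [Category.assoc, ← whiskerLeft_comp_assoc, IsIso.hom_inv_id]
    simp [← comp_whiskerRight, e]
  · exact IsIso.hom_inv_id (m.as.app a)
  · exact IsIso.inv_hom_id (m.as.app a)

lemma isIso_app {σ τ : P ⟶ Q} (m : σ ⟶ τ) [IsIso m] (a : B) (X : P.obj a) :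
    IsIso ((m.as.app a).toNatTrans.app X) :=
  ⟨((inv m).as.app a).toNatTrans.app X, congr(($(IsIso.hom_inv_id m).as.app a).toNatTrans.app X),
    congr(($(IsIso.inv_hom_id m).as.app a).toNatTrans.app X)⟩

lemma inv_app {σ τ : P ⟶ Q} (m : σ ⟶ τ) [IsIso m] (a : B) (X : P.obj a)
    [IsIso ((m.as.app a).toNatTrans.app X)] :
    ((inv m).as.app a).toNatTrans.app X = inv ((m.as.app a).toNatTrans.app X) :=
  (IsIso.inv_eq_of_hom_inv_id congr(($(IsIso.hom_inv_id m).as.app a).toNatTrans.app X)).symm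

end CategoryTheory.Pseudofunctor.StrongTrans

namespace CategoryTheory.Functor

instance full_prod_id {A B M : Type*} [Category* A] [Category* B] [Category* M] (p : A ⥤ B)
    [p.Full] : (Functor.prod p (𝟭 M)).Full where
  map_surjective f := ⟨(p.preimage f.1, f.2), Prod.ext (p.map_preimage _) rfl⟩

instance faithful_prod_id {A B M : Type*} [Category* A] [Category* B] [Category* M] (p : A ⥤ B)
    [p.Faithful] : (Functor.prod p (𝟭 M)).Faithful where
  map_injective h := Prod.ext (p.map_injective (congrArg _root_.Prod.fst h :))
    (congrArg _root_.Prod.snd h :)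

instance faithful_sectR {A M : Type*} [Category* A] [Category* M] (a : A) :
    (CategoryTheory.Prod.sectR a M).Faithful where
  map_injective h := (congrArg _root_.Prod.snd h :)

end CategoryTheory.Functor

/-! ### The shapes: rows and columns of the square. -/

namespace Prederivator

open Pseudofunctor.StrongTrans

/-- The product with an identity functor, applied to an adjunction. -/
def prodAdj {A B : Type u} [Category.{u} A] [Category.{u} B] {l : A ⥤ B} {r : B ⥤ A}
    (adj : CategoryTheory.Adjunction l r) (M : Type u) [Category.{u} M] :
    CategoryTheory.Adjunction (Functor.prod l (𝟭 M)) (Functor.prod r (𝟭 M)) where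
  unit :=
    { app := fun x => (adj.unit.app x.1, 𝟙 x.2)
      naturality := fun _ _ f => Prod.ext (adj.unit.naturality f.1)
        ((Category.comp_id _).trans (Category.id_comp _).symm) }
  counit :=
    { app := fun x => (adj.counit.app x.1, 𝟙 x.2)
      naturality := fun _ _ f => Prod.ext (adj.counit.naturality f.1)
        ((Category.comp_id _).trans (Category.id_comp _).symm) }
  left_triangle_components := fun x =>
    Prod.ext (adj.left_triangle_components x.1) (Category.comp_id _)
  right_triangle_components := fun x =>
    Prod.ext (adj.right_triangle_components x.1) (Category.comp_id _)

section Poset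

variable {P Q : Type} [Preorder P] [Preorder Q]

instance isThin_poset : Quiver.IsThin (poset.{u} P) :=
  inferInstanceAs (Quiver.IsThin (ULift.{u} P))

instance full_sectR_poset (a : poset.{u} P) (M : Type u) [Category.{u} M] :
    (CategoryTheory.Prod.sectR a M).Full where
  map_surjective f := ⟨f.2, Prod.ext (Subsingleton.elim _ _) rfl⟩

lemma full_posetMap {f : P → Q} (hf : Monotone f) (h : ∀ a b, f a ≤ f b → a ≤ b) :
    (posetMap.{u} f hf).toFunctor.Full where
  map_surjective {a b} g := ⟨homOfLE (X := ULift.{u} P)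
    (h a.down b.down (leOfHom (X := ULift.{u} Q) g)), Subsingleton.elim _ _⟩

instance faithful_posetMap {f : P → Q} (hf : Monotone f) :
    (posetMap.{u} f hf).toFunctor.Faithful where
  map_injective _ := Subsingleton.elim _ _

instance full_arrowToSpan : arrowToSpan.{u}.toFunctor.Full :=
  full_posetMap _ fun _ _ h => h.1

instance faithful_arrowToSpan : arrowToSpan.{u}.toFunctor.Faithful :=
  faithful_posetMap _

instance full_arrowToCospan : arrowToCospan.{u}.toFunctor.Full :=
  full_posetMap _ fun _ _ h => h.2

instance faithful_arrowToCospan : arrowToCospan.{u}.toFunctor.Faithful :=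
  faithful_posetMap _

instance full_spanIncl : spanIncl.{u}.toFunctor.Full :=
  full_posetMap _ fun _ _ h => h

instance faithful_spanIncl : spanIncl.{u}.toFunctor.Faithful :=
  faithful_posetMap _

instance full_cospanIncl : cospanIncl.{u}.toFunctor.Full :=
  full_posetMap _ fun _ _ h => h

instance faithful_cospanIncl : cospanIncl.{u}.toFunctor.Faithful :=
  faithful_posetMap _

/-- A pointwise inequality between monotone maps as a natural transformation. -/
def posetTrans {f g : poset.{u} P ⟶ poset.{u} Q}
    (h : ∀ a, (f.toFunctor.obj a).down ≤ (g.toFunctor.obj a).down) : f.toFunctor ⟶ g.toFunctor where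
  app a := homOfLE (X := ULift.{u} Q) (h a)
  naturality _ _ _ := Subsingleton.elim _ _

/-- A Galois connection as an adjunction. -/
def posetAdj {f : P → Q} {g : Q → P} (hf : Monotone f) (hg : Monotone g)
    (h : GaloisConnection f g) :
    CategoryTheory.Adjunction (posetMap.{u} f hf).toFunctor (posetMap.{u} g hg).toFunctor where
  unit :=
    { app := fun a => homOfLE (X := ULift.{u} P) (h.le_u_l a.down)
      naturality := fun _ _ _ => Subsingleton.elim _ _ }
  counit :=
    { app := fun a => homOfLE (X := ULift.{u} Q) (h.l_u_le a.down)
      naturality := fun _ _ _ => Subsingleton.elim _ _ }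
  left_triangle_components := fun _ => Subsingleton.elim _ _
  right_triangle_components := fun _ => Subsingleton.elim _ _

/-- The functor `k ↦ (k, 1)` into the square. -/
def arrowToSquareFst : arrow.{u} ⟶ square.{u} :=
  posetMap (fun k => (k, 1)) fun _ _ h => ⟨h, le_rfl⟩

/-- The functor `k ↦ (0, k)` into the square. -/
def arrowToSquareSnd : arrow.{u} ⟶ square.{u} :=
  posetMap (fun k => (0, k)) fun _ _ h => ⟨le_rfl, h⟩

/-- The first projection of the square. -/
def squareFst : square.{u} ⟶ arrow.{u} :=
  posetMap _root_.Prod.fst fun _ _ h => h.1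

/-- The second projection of the square. -/
def squareSnd : square.{u} ⟶ arrow.{u} :=
  posetMap _root_.Prod.snd fun _ _ h => h.2

/-- The first projection of the square is left adjoint to `k ↦ (k, 1)`. -/
def squareFstAdj :
    CategoryTheory.Adjunction squareFst.{u}.toFunctor arrowToSquareFst.{u}.toFunctor :=
  posetAdj _ _ fun x _ => ⟨fun h => ⟨h, Fin.le_last x.2⟩, fun h => h.1⟩

/-- The second projection of the square is right adjoint to `k ↦ (0, k)`. -/
def squareSndAdj :
    CategoryTheory.Adjunction arrowToSquareSnd.{u}.toFunctor squareSnd.{u}.toFunctor :=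
  posetAdj _ _ fun _ x => ⟨fun h => h.2, fun h => ⟨Fin.zero_le x.1, h⟩⟩

/-- The vertical morphisms from the upper to the lower row of the square. -/
def rowTrans : (arrowToSpan.{u} ≫ spanIncl.{u}).toFunctor ⟶ arrowToSquareFst.{u}.toFunctor :=
  posetTrans (f := arrowToSpan.{u} ≫ spanIncl.{u}) fun _ => ⟨le_rfl, Fin.zero_le _⟩

/-- The horizontal morphisms from the left to the right column of the square. -/
def columnTrans :
    arrowToSquareSnd.{u}.toFunctor ⟶ (arrowToCospan.{u} ≫ cospanIncl.{u}).toFunctor :=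
  posetTrans (g := arrowToCospan.{u} ≫ cospanIncl.{u}) fun _ => ⟨Fin.zero_le _, le_rfl⟩

lemma span_eq (x : span.{u}) :
    (∃ k, x = arrowToSpan.{u}.toFunctor.obj k) ∨ x = ULift.up ⟨(0, 1), by decide⟩ := by
  obtain ⟨⟨⟨a, b⟩, h⟩⟩ := x
  by_cases hb : b = 0
  · subst hb
    exact Or.inl ⟨ULift.up a, rfl⟩
  · obtain rfl : b = 1 := by omega
    obtain rfl : a = 0 := by
      by_contra ha
      obtain rfl : a = 1 := by omega
      exact h rfl
    exact Or.inr rfl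

lemma cospan_eq (x : cospan.{u}) :
    (∃ k, x = arrowToCospan.{u}.toFunctor.obj k) ∨ x = ULift.up ⟨(0, 1), by decide⟩ := by
  obtain ⟨⟨⟨a, b⟩, h⟩⟩ := x
  by_cases ha : a = 1
  · subst ha
    exact Or.inl ⟨ULift.up b, rfl⟩
  · obtain rfl : a = 0 := by omega
    obtain rfl : b = 1 := by
      by_contra hb
      obtain rfl : b = 0 := by omega
      exact h rfl
    exact Or.inr rfl

lemma arrow_eq (x : arrow.{u}) : x = ULift.up 0 ∨ x = ULift.up 1 := by
  obtain ⟨k⟩ := x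
  by_cases hk : k = 0
  · exact Or.inl (congrArg _ hk)
  · exact Or.inr (congrArg _ (by omega))

end Poset

end Prederivator

/-! ### The cone as left adjoint of `1_!`. -/

namespace Prederivator

open Pseudofunctor.StrongTrans

variable {D : Prederivator.{u, v, w}}

section

variable {A B : Type u} [Category.{u} A] [Category.{u} B]

/-- The inclusions of objects are compatible with functors. -/
def fromPUnitCompIso (f : A ⥤ B) (a : A) :
    Functor.fromPUnit.{u} a ⋙ f ≅ Functor.fromPUnit.{u} (f.obj a) :=
  NatIso.ofComponents (fun _ => Iso.refl _)
    fun _ => (Category.comp_id _).trans ((f.map_id _).trans (Category.id_comp _).symm)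

variable (D) in
/-- The value of a restricted object. -/
noncomputable def resObjIso (f : A ⥤ B) (a : A) (Y : D.val B) :
    (D.res (Functor.fromPUnit.{u} a)).obj ((D.res f).obj Y) ≅
      (D.res (Functor.fromPUnit.{u} (f.obj a))).obj Y :=
  D.compAt _ f Y ≪≫ asIso (D.mapAt (fromPUnitCompIso f a).hom Y)

lemma isIso_at_obj (f : A ⥤ B) (a : A) {X Y : D.val B} (φ : X ⟶ Y)
    (h : IsIso ((D.res f).map φ)) :
    IsIso ((D.res (Functor.fromPUnit.{u} (f.obj a))).map φ) := by
  rw [← isIso_res_map_iff (fromPUnitCompIso f a), isIso_res_map_comp_iff]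
  infer_instance

/-- By a triangle identity. With Der2, it handles the objects in the image of `f` when a unit is
tested pointwise. -/
lemma isIso_res_map_unit {f : A ⥤ B} {R : D.val A ⥤ D.val B}
    (adj : CategoryTheory.Adjunction (D.res f) R) (Z : D.val B)
    (h' : IsIso (adj.counit.app ((D.res f).obj Z))) : IsIso ((D.res f).map (adj.unit.app Z)) := by
  have h := adj.left_triangle_components Z
  have : IsIso ((D.res f).map (adj.unit.app Z) ≫ adj.counit.app ((D.res f).obj Z)) := by
    rw [h]
    exact IsIso.id _
  exact IsIso.of_isIso_comp_right _ (adj.counit.app ((D.res f).obj Z))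

lemma isIso_res_map_counit {f : A ⥤ B} {L : D.val A ⥤ D.val B}
    (adj : CategoryTheory.Adjunction L (D.res f)) (Z : D.val B)
    (h' : IsIso (adj.unit.app ((D.res f).obj Z))) : IsIso ((D.res f).map (adj.counit.app Z)) := by
  have h := adj.right_triangle_components Z
  have : IsIso (adj.unit.app ((D.res f).obj Z) ≫ (D.res f).map (adj.counit.app Z)) := by
    rw [h]
    exact IsIso.id _
  exact IsIso.of_isIso_comp_left (adj.unit.app ((D.res f).obj Z)) _

end

section Cone

variable {l : D.toPseudofunctor ⟶ (D.shift arrow.{u}).toPseudofunctor}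

/-- The components of `1_! ⊣ 1^*`. -/
def lanOneAdj (adj : Bicategory.Adjunction l D.ev₁) (M : Cat.{u, u}) : CategoryTheory.Adjunction (C := D.val M) (D := D.val (arrow.{u} × M))
    (l.app (op M)).toFunctor (D.res (CategoryTheory.Prod.sectR (ULift.up 1 : arrow.{u}) M)) :=
  adjunctionApp adj (op M)

lemma IsDerivator.isIso_lanOne_unit (hD : D.IsDerivator) (adj : Bicategory.Adjunction l D.ev₁)
    (M : Cat.{u, u}) (X : D.val M) :
    IsIso ((lanOneAdj adj M).unit.app X) :=
  @isIso_of_isLan _ _ _ _ _ hD _ (full_sectR_poset.{u} (P := Fin 2) (ULift.up 1) M)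
    (Functor.faithful_sectR _) _ _ _ (isLan_unit (lanOneAdj adj M) X)

/-- The span pulled back from `1_! X` is right Kan extended from the upper row. On the row the
extension is an extension in the strict sense. At `(0,1)` the source is the value of `1_! X` at 0,
which is initial, and the target is terminal, since `(0,1)` maps to no object of the row. -/
lemma IsDerivator.isIso_span_unit (hD : D.IsDerivator) (hp : D.IsPointed)
    (adj : Bicategory.Adjunction l D.ev₁) (M : Cat.{u, u})
    {R : D.val (arrow.{u} × M) ⥤ D.val (span.{u} × M)}
    (adj₁ : CategoryTheory.Adjunction (D.res (Functor.prod arrowToSpan.{u}.toFunctor (𝟭 M))) R)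
    (X : D.val M) :
    IsIso (adj₁.unit.app ((D.res (Functor.prod spanIncl.{u}.toFunctor (𝟭 M))).obj
      ((D.res (Functor.prod squareFst.{u}.toFunctor (𝟭 M))).obj
        ((l.app (op M)).toFunctor.obj X)))) := by
  have : Limits.HasZeroObject (D.val (Discrete PUnit.{u + 1})) := hp
  let x : D.val (arrow.{u} × M) := (l.app (op M)).toFunctor.obj X
  let y := (D.res (Functor.prod squareFst.{u}.toFunctor (𝟭 M))).obj x
  let z := (D.res (Functor.prod spanIncl.{u}.toFunctor (𝟭 M))).obj y
  have hc := hD.isIso_of_isRan (isRan_counit adj₁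
    ((D.res (Functor.prod arrowToSpan.{u}.toFunctor (𝟭 M))).obj z))
  have hu := isIso_res_map_unit adj₁ z hc
  refine hD.der2 _ _ ?_
  rintro ⟨p, m⟩
  obtain ⟨k, rfl⟩ | rfl := span_eq p
  · exact isIso_at_obj (Functor.prod arrowToSpan.{u}.toFunctor (𝟭 M)) (k, m) _ hu
  · obtain ⟨h₁⟩ := hD.isInitial_lan_one adj M m X
    obtain ⟨h₂⟩ := hD.isTerminal_of_isEmpty_hom (isRan_counit adj₁
      ((D.res (Functor.prod arrowToSpan.{u}.toFunctor (𝟭 M))).obj z))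
      ((ULift.up ⟨(0, 1), by decide⟩, m) : span.{u} × M)
      fun a => ⟨fun g => absurd (show (1 : Fin 2) ≤ 0 from
        (leOfHom (X := ULift.{u} {x : Fin 2 × Fin 2 // x ≠ (1, 1)}) g.1).2) (by decide)⟩
    refine Limits.isIso_of_isInitial_of_isTerminal (h₁.ofIso ?_) h₂ _
    exact (D.resObjIso (Functor.prod spanIncl.{u}.toFunctor (𝟭 M))
      ((ULift.up ⟨(0, 1), by decide⟩, m) : span.{u} × M) y ≪≫
      D.resObjIso (Functor.prod squareFst.{u}.toFunctor (𝟭 M)) _ x).symm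

/-- The lower row of the cocartesian square is in the image of `1_!`: its value at 0 is the value of
`i_* f` at `(0,1)`, which is terminal, while the source of the counit is initial there. -/
lemma IsDerivator.isIso_lanOne_counit (hD : D.IsDerivator) (hp : D.IsPointed)
    (adj : Bicategory.Adjunction l D.ev₁) (M : Cat.{u, u})
    {R : D.val (arrow.{u} × M) ⥤ D.val (span.{u} × M)}
    (adj₁ : CategoryTheory.Adjunction (D.res (Functor.prod arrowToSpan.{u}.toFunctor (𝟭 M))) R)
    {L : D.val (span.{u} × M) ⥤ D.val (square.{u} × M)}
    (adj₂ : CategoryTheory.Adjunction L (D.res (Functor.prod spanIncl.{u}.toFunctor (𝟭 M))))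
    (f : D.val (arrow.{u} × M)) :
    IsIso ((lanOneAdj adj M).counit.app
      ((D.res (Functor.prod arrowToSquareFst.{u}.toFunctor (𝟭 M))).obj (L.obj (R.obj f)))) := by
  have : Limits.HasZeroObject (D.val (Discrete PUnit.{u + 1})) := hp
  let y := (D.res (Functor.prod arrowToSquareFst.{u}.toFunctor (𝟭 M))).obj (L.obj (R.obj f))
  have h := hD.isIso_lanOne_unit adj M
    ((D.res (CategoryTheory.Prod.sectR (ULift.up 1 : arrow.{u}) M)).obj y)
  have hu := isIso_res_map_counit (lanOneAdj adj M) y h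
  have h₂ := hD.isIso_of_isLan (isLan_unit adj₂ (R.obj f))
  refine hD.der2 _ _ ?_
  rintro ⟨k, m⟩
  obtain rfl | rfl := arrow_eq k
  · obtain ⟨h₁⟩ := hD.isInitial_lan_one adj M m
      ((D.res (CategoryTheory.Prod.sectR (ULift.up 1 : arrow.{u}) M)).obj y)
    obtain ⟨h₂⟩ := hD.isTerminal_of_isEmpty_hom (isRan_counit adj₁ f)
      ((ULift.up ⟨(0, 1), by decide⟩, m) : span.{u} × M)
      fun a => ⟨fun g => absurd (show (1 : Fin 2) ≤ 0 from
        (leOfHom (X := ULift.{u} {x : Fin 2 × Fin 2 // x ≠ (1, 1)}) g.1).2) (by decide)⟩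
    refine Limits.isIso_of_isInitial_of_isTerminal h₁ (h₂.ofIso ?_) _
    exact (D.res _).mapIso (asIso (adj₂.unit.app (R.obj f))) ≪≫
      D.resObjIso (Functor.prod spanIncl.{u}.toFunctor (𝟭 M)) _ (L.obj (R.obj f)) ≪≫
      (D.resObjIso (Functor.prod arrowToSquareFst.{u}.toFunctor (𝟭 M)) (ULift.up 0, m) _).symm
  · exact isIso_at_obj (CategoryTheory.Prod.sectR (ULift.up 1 : arrow.{u}) M) m _ hu

end Cone

end Prederivator

namespace Prederivator

open Pseudofunctor.StrongTrans

variable {D : Prederivator.{u, v, w}}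

/-- For 2-cells that are invertible only after composition with `f`, such as the step from one row
of the square to the other followed by the first projection. -/
lemma isIso_mapAt_res {A B C : Type u} [Category.{u} A] [Category.{u} B] [Category.{u} C]
    {p p' : A ⥤ B} (β : p ⟶ p') (f : B ⥤ C) (h : IsIso (Functor.whiskerRight β f))
    (X : D.val C) : IsIso (D.mapAt β ((D.res f).obj X)) := by
  have e := D.compAt_whiskerRight β f X
  rw [← IsIso.eq_comp_inv] at e
  rw [e]
  infer_instance

lemma isIso_resAdj_counit {A B : Type u} [Category.{u} A] [Category.{u} B] {l : A ⥤ B} {r : B ⥤ A}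
    (adj : CategoryTheory.Adjunction l r) (h : IsIso adj.counit) (X : D.val B) :
    IsIso ((D.resAdj adj).counit.app X) := by
  rw [resAdj_counit_app]
  infer_instance

lemma isIso_resAdj_unit {A B : Type u} [Category.{u} A] [Category.{u} B] {l : A ⥤ B} {r : B ⥤ A}
    (adj : CategoryTheory.Adjunction l r) (h : IsIso adj.unit) (X : D.val A) :
    IsIso ((D.resAdj adj).unit.app X) := by
  rw [resAdj_unit_app]
  infer_instance

lemma isIso_trans_of_eq {P : Type} [PartialOrder P] {E M : Type u} [Category.{u} E] [Category.{u} M]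
    {F G : E ⥤ ULift.{u} P × M} (α : F ⟶ G) (h₁ : ∀ x, (F.obj x).1 = (G.obj x).1)
    (h₂ : ∀ x, IsIso (α.app x).2) : IsIso α := by
  have : ∀ x, IsIso (α.app x) := fun x => by
    have h₃ := h₂ x
    refine (isIso_prod_iff (f := α.app x)).2 ⟨⟨eqToHom (h₁ x).symm, Subsingleton.elim _ _, Subsingleton.elim _ _⟩, h₃⟩
  exact NatIso.isIso_of_isIso_app _

variable (D) in
/-- The transformation from the upper row to the lower row of squares. -/
def rowRestr : D.restr spanIncl.{u} ≫ D.restr arrowToSpan.{u} ⟶ D.restr arrowToSquareFst.{u} :=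
  (D.restrComp arrowToSpan.{u} spanIncl.{u}).hom ≫ D.restrMap rowTrans.{u}

lemma isIso_rowRestr (M : Cat.{u, u}) (g : D.val (arrow.{u} × M)) :
    IsIso (((D.rowRestr).as.app (op M)).toNatTrans.app
      ((D.res (Functor.prod squareFst.{u}.toFunctor (𝟭 M))).obj g)) := by
  have h₁ := isIso_app (D.restrComp arrowToSpan.{u} spanIncl.{u}).hom (op M)
    ((D.res (Functor.prod squareFst.{u}.toFunctor (𝟭 M))).obj g)
  have h₂ := isIso_mapAt_res (D := D) (NatTrans.prod rowTrans.{u} (𝟙 (𝟭 M)))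
    (Functor.prod squareFst.{u}.toFunctor (𝟭 M))
    (isIso_trans_of_eq (P := Fin 2) _ (fun _ => rfl) fun x => IsIso.id (C := M) x.2) g
  exact IsIso.comp_isIso' h₁ h₂

/-- The identities and brackets on the right are those to which a component of the unit `η` in
`nonempty_cone_adjunction` unfolds; they come from associators and unitors. -/
lemma comp_eq_of_eq_left {E : Type*} [Category* E] {x₀ x₁ x₂ x₃ x₄ x₅ : E} {a a' : x₀ ⟶ x₁}
    (ha : a' = a) (b : x₁ ⟶ x₂) (c : x₂ ⟶ x₃) {d d' : x₃ ⟶ x₄} (hd : d' = d) (e : x₄ ⟶ x₅) :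
    a ≫ b ≫ c ≫ d ≫ e = (a' ≫ (𝟙 _ ≫ b ≫ 𝟙 _ ≫ c) ≫ 𝟙 _ ≫ d' ≫ 𝟙 _) ≫ e := by
  simp [ha, hd]

/-- In a pointed derivator, the cone morphism is left adjoint to `1_!`. -/
theorem IsDerivator.nonempty_cone_adjunction (hD : D.IsDerivator) (hp : D.IsPointed)
    {l : D.toPseudofunctor ⟶ (D.shift arrow.{u}).toPseudofunctor}
    (adj : Bicategory.Adjunction l D.ev₁) (c : D.ConeData) :
    Nonempty (Bicategory.Adjunction c.cone l) := by
  let R := c.toSpan.right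
  let L := c.toSquare.left
  have i₁ : IsIso c.toSpan.adj.counit := isIso_of_isIso_app _ fun M X =>
    hD.isIso_of_isRan (f := Functor.prod arrowToSpan.{u}.toFunctor (𝟭 M.unop))
      (isRan_counit (adjunctionApp c.toSpan.adj M) X)
  have i₄ : IsIso ((R ≫ L ≫ D.restr arrowToSquareFst.{u}) ◁ adj.counit) :=
    isIso_of_isIso_app _ fun M X => hD.isIso_lanOne_counit hp adj M.unop
      (adjunctionApp c.toSpan.adj M) (adjunctionApp c.toSquare.adj M) X
  -- The unit sends `f` to the upper row of its cocartesian square, then down to the lower row,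
  -- which is identified with `1_! 1^*` of itself. It is a modification because it is assembled from
  -- modifications.
  let η : 𝟙 _ ⟶ ((R ≫ L ≫ D.restr arrowToSquareFst.{u}) ≫ D.ev₁) ≫ l :=
    inv c.toSpan.adj.counit ≫ R ◁ ((λ_ _).inv ≫ c.toSquare.adj.unit ▷ D.restr arrowToSpan.{u} ≫
      (α_ _ _ _).hom ≫ L ◁ D.rowRestr) ≫ (ρ_ _).inv ≫
      inv ((R ≫ L ≫ D.restr arrowToSquareFst.{u}) ◁ adj.counit) ≫ (α_ _ _ _).inv
  have H : Nonempty (Bicategory.Adjunction ((R ≫ L ≫ D.restr arrowToSquareFst.{u}) ≫ D.ev₁) l) := by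
    refine nonempty_adjunction_of_unit η fun M f X => ?_
    have j₁ : IsIso ((adjunctionApp c.toSpan.adj M).counit.app f) := isIso_app c.toSpan.adj.counit M f
    have j₂ := hD.isIso_span_unit hp adj M.unop (adjunctionApp c.toSpan.adj M) X
    have j₃ := hD.isIso_lanOne_unit adj M.unop X
    have j₄ := hD.isIso_lanOne_counit hp adj M.unop
      (adjunctionApp c.toSpan.adj M) (adjunctionApp c.toSquare.adj M) f
    have j₅ := isIso_rowRestr M.unop ((l.app M).toFunctor.obj X)
    have j₆ := isIso_resAdj_counit (D := D) (prodAdj squareFstAdj.{u} M.unop)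
      (isIso_trans_of_eq (P := Fin 2) _ (fun _ => rfl) fun x => IsIso.id (C := M.unop) x.2)
      ((l.app M).toFunctor.obj X)
    have h := @CategoryTheory.Adjunction.bijective_cone_unit _ _ _ _ _ _ _ _ _ _ _ _ _ _ _ _ (adjunctionApp c.toSpan.adj M) (adjunctionApp c.toSquare.adj M)
      (D.resAdj (prodAdj squareFstAdj.{u} M.unop)) (lanOneAdj adj M.unop)
      ((D.rowRestr).as.app M).toNatTrans f X j₁ j₂ j₃ j₄ j₅ j₆
    refine (congrArg Function.Bijective (funext fun φ => ?_)).mp h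
    have e₁ := @inv_app _ _ _ _ _ _ c.toSpan.adj.counit i₁ M f j₁
    have e₂ := @inv_app _ _ _ _ _ _ ((R ≫ L ≫ D.restr arrowToSquareFst.{u}) ◁ adj.counit) i₄ M f j₄
    exact comp_eq_of_eq_left e₁ ((D.res (Functor.prod arrowToSpan.{u}.toFunctor (𝟭 M.unop))).map
        ((c.toSquare.adj.unit.as.app M).toNatTrans.app ((R.app M).toFunctor.obj f)))
      ((D.rowRestr.as.app M).toNatTrans.app ((L.app M).toFunctor.obj ((R.app M).toFunctor.obj f)))
      e₂ ((l.app M).toFunctor.map φ)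
  obtain ⟨a⟩ := H
  refine nonempty_adjunction_of_iso_left a ?_
  -- The value at 1 of the lower row is the value of the square at `(1,1)`.
  exact α_ _ _ _ ≪≫ whiskerLeftIso R (α_ _ _ _ ≪≫ whiskerLeftIso L (D.restrEv _ _))

end Prederivator

/-! ### The fiber as right adjoint of `0_*`. -/

namespace Prederivator

open Pseudofunctor.StrongTrans

variable {D : Prederivator.{u, v, w}}

section Fiber

variable {r : D.toPseudofunctor ⟶ (D.shift arrow.{u}).toPseudofunctor}

/-- The components of `0^* ⊣ 0_*`. -/
def ranZeroAdj (adj : Bicategory.Adjunction D.ev₀ r) (M : Cat.{u, u}) :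
    CategoryTheory.Adjunction (C := D.val (arrow.{u} × M)) (D := D.val M)
      (D.res (CategoryTheory.Prod.sectR (ULift.up 0 : arrow.{u}) M)) (r.app (op M)).toFunctor :=
  adjunctionApp adj (op M)

lemma IsDerivator.isIso_ranZero_counit (hD : D.IsDerivator) (adj : Bicategory.Adjunction D.ev₀ r)
    (M : Cat.{u, u}) (X : D.val M) :
    IsIso ((ranZeroAdj adj M).counit.app X) :=
  @isIso_of_isRan _ _ _ _ _ hD _ (full_sectR_poset.{u} (P := Fin 2) (ULift.up 0) M)
    (Functor.faithful_sectR _) _ _ _ (isRan_counit (ranZeroAdj adj M) X)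

/-- Dual to `isIso_span_unit`: at the corner `(0,1)` the left Kan extension from the right column is
initial, while the value of `0_* X` at 1 is terminal. -/
lemma IsDerivator.isIso_cospan_counit (hD : D.IsDerivator) (hp : D.IsPointed)
    (adj : Bicategory.Adjunction D.ev₀ r) (M : Cat.{u, u})
    {L : D.val (arrow.{u} × M) ⥤ D.val (cospan.{u} × M)}
    (adj₁ : CategoryTheory.Adjunction L (D.res (Functor.prod arrowToCospan.{u}.toFunctor (𝟭 M))))
    (X : D.val M) :
    IsIso (adj₁.counit.app ((D.res (Functor.prod cospanIncl.{u}.toFunctor (𝟭 M))).obj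
      ((D.res (Functor.prod squareSnd.{u}.toFunctor (𝟭 M))).obj
        ((r.app (op M)).toFunctor.obj X)))) := by
  have : Limits.HasZeroObject (D.val (Discrete PUnit.{u + 1})) := hp
  let x : D.val (arrow.{u} × M) := (r.app (op M)).toFunctor.obj X
  let y := (D.res (Functor.prod squareSnd.{u}.toFunctor (𝟭 M))).obj x
  let z := (D.res (Functor.prod cospanIncl.{u}.toFunctor (𝟭 M))).obj y
  have hc := hD.isIso_of_isLan (isLan_unit adj₁
    ((D.res (Functor.prod arrowToCospan.{u}.toFunctor (𝟭 M))).obj z))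
  have hu := isIso_res_map_counit adj₁ z hc
  refine hD.der2 _ _ ?_
  rintro ⟨p, m⟩
  obtain ⟨k, rfl⟩ | rfl := cospan_eq p
  · exact isIso_at_obj (Functor.prod arrowToCospan.{u}.toFunctor (𝟭 M)) (k, m) _ hu
  · obtain ⟨h₁⟩ := hD.isTerminal_ran_zero adj M m X
    obtain ⟨h₂⟩ := hD.isInitial_of_isEmpty_hom (isLan_unit adj₁
      ((D.res (Functor.prod arrowToCospan.{u}.toFunctor (𝟭 M))).obj z))
      ((ULift.up ⟨(0, 1), by decide⟩, m) : cospan.{u} × M)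
      fun a => ⟨fun g => absurd (show (1 : Fin 2) ≤ 0 from
        (leOfHom (X := ULift.{u} {x : Fin 2 × Fin 2 // x ≠ (0, 0)}) g.1).1) (by decide)⟩
    refine Limits.isIso_of_isInitial_of_isTerminal h₂ (h₁.ofIso ?_) _
    exact (D.resObjIso (Functor.prod cospanIncl.{u}.toFunctor (𝟭 M))
      ((ULift.up ⟨(0, 1), by decide⟩, m) : cospan.{u} × M) y ≪≫
      D.resObjIso (Functor.prod squareSnd.{u}.toFunctor (𝟭 M)) _ x).symm

/-- The left column of the cartesian square is in the image of `0_*`: its value at 1 is the corner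
`(0,1)`, where the left Kan extension is initial, and the target of the unit is terminal there. -/
lemma IsDerivator.isIso_ranZero_unit (hD : D.IsDerivator) (hp : D.IsPointed)
    (adj : Bicategory.Adjunction D.ev₀ r) (M : Cat.{u, u})
    {L : D.val (arrow.{u} × M) ⥤ D.val (cospan.{u} × M)}
    (adj₁ : CategoryTheory.Adjunction L (D.res (Functor.prod arrowToCospan.{u}.toFunctor (𝟭 M))))
    {R : D.val (cospan.{u} × M) ⥤ D.val (square.{u} × M)}
    (adj₂ : CategoryTheory.Adjunction (D.res (Functor.prod cospanIncl.{u}.toFunctor (𝟭 M))) R)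
    (f : D.val (arrow.{u} × M)) :
    IsIso ((ranZeroAdj adj M).unit.app
      ((D.res (Functor.prod arrowToSquareSnd.{u}.toFunctor (𝟭 M))).obj (R.obj (L.obj f)))) := by
  have : Limits.HasZeroObject (D.val (Discrete PUnit.{u + 1})) := hp
  let y := (D.res (Functor.prod arrowToSquareSnd.{u}.toFunctor (𝟭 M))).obj (R.obj (L.obj f))
  have h := hD.isIso_ranZero_counit adj M
    ((D.res (CategoryTheory.Prod.sectR (ULift.up 0 : arrow.{u}) M)).obj y)
  have hu := isIso_res_map_unit (ranZeroAdj adj M) y h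
  have h₂ := hD.isIso_of_isRan (isRan_counit adj₂ (L.obj f))
  refine hD.der2 _ _ ?_
  rintro ⟨k, m⟩
  obtain rfl | rfl := arrow_eq k
  · exact isIso_at_obj (CategoryTheory.Prod.sectR (ULift.up 0 : arrow.{u}) M) m _ hu
  · obtain ⟨h₁⟩ := hD.isTerminal_ran_zero adj M m
      ((D.res (CategoryTheory.Prod.sectR (ULift.up 0 : arrow.{u}) M)).obj y)
    obtain ⟨h₂⟩ := hD.isInitial_of_isEmpty_hom (isLan_unit adj₁ f)
      ((ULift.up ⟨(0, 1), by decide⟩, m) : cospan.{u} × M)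
      fun a => ⟨fun g => absurd (show (1 : Fin 2) ≤ 0 from
        (leOfHom (X := ULift.{u} {x : Fin 2 × Fin 2 // x ≠ (0, 0)}) g.1).1) (by decide)⟩
    refine Limits.isIso_of_isInitial_of_isTerminal (h₂.ofIso ?_) h₁ _
    exact (D.res _).mapIso (asIso (adj₂.counit.app (L.obj f))).symm ≪≫
      D.resObjIso (Functor.prod cospanIncl.{u}.toFunctor (𝟭 M)) _ (R.obj (L.obj f)) ≪≫
      (D.resObjIso (Functor.prod arrowToSquareSnd.{u}.toFunctor (𝟭 M)) (ULift.up 1, m) _).symm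

variable (D) in
/-- The transformation from the left column to the right column of squares. -/
def columnRestr :
    D.restr arrowToSquareSnd.{u} ⟶ D.restr cospanIncl.{u} ≫ D.restr arrowToCospan.{u} :=
  D.restrMap columnTrans.{u} ≫ (D.restrComp arrowToCospan.{u} cospanIncl.{u}).inv

lemma isIso_columnRestr (M : Cat.{u, u}) (g : D.val (arrow.{u} × M)) :
    IsIso (((D.columnRestr).as.app (op M)).toNatTrans.app
      ((D.res (Functor.prod squareSnd.{u}.toFunctor (𝟭 M))).obj g)) := by
  have h₁ := isIso_app (D.restrComp arrowToCospan.{u} cospanIncl.{u}).inv (op M)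
    ((D.res (Functor.prod squareSnd.{u}.toFunctor (𝟭 M))).obj g)
  have h₂ := isIso_mapAt_res (D := D) (NatTrans.prod columnTrans.{u} (𝟙 (𝟭 M)))
    (Functor.prod squareSnd.{u}.toFunctor (𝟭 M))
    (isIso_trans_of_eq (P := Fin 2) _ (fun _ => rfl) fun x => IsIso.id (C := M) x.2) g
  exact IsIso.comp_isIso' h₂ h₁

lemma comp_eq_of_eq_right {E : Type*} [Category* E] {x₀ x₁ x₂ x₃ x₄ x₅ : E} (e : x₀ ⟶ x₁)
    {d d' : x₁ ⟶ x₂} (hd : d' = d) (c : x₂ ⟶ x₃) (b : x₃ ⟶ x₄) {a a' : x₄ ⟶ x₅} (ha : a' = a) :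
    e ≫ d ≫ c ≫ b ≫ a = e ≫ 𝟙 _ ≫ d' ≫ 𝟙 _ ≫ (c ≫ 𝟙 _ ≫ b ≫ 𝟙 _) ≫ a' := by
  simp [ha, hd]

/-- In a pointed derivator, the fiber morphism is right adjoint to `0_*`. -/
theorem IsDerivator.nonempty_fiber_adjunction (hD : D.IsDerivator) (hp : D.IsPointed)
    (adj : Bicategory.Adjunction D.ev₀ r) (c : D.FiberData) :
    Nonempty (Bicategory.Adjunction r c.fiber) := by
  let L := c.toCospan.left
  let R := c.toSquare.right
  have i₁ : IsIso c.toCospan.adj.unit := isIso_of_isIso_app _ fun M X =>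
    hD.isIso_of_isLan (f := Functor.prod arrowToCospan.{u}.toFunctor (𝟭 M.unop))
      (isLan_unit (D := D) (f := Functor.prod arrowToCospan.{u}.toFunctor (𝟭 M.unop))
        (adjunctionApp c.toCospan.adj M) X)
  have i₄ : IsIso ((L ≫ R ≫ D.restr arrowToSquareSnd.{u}) ◁ adj.unit) :=
    isIso_of_isIso_app _ fun M X => hD.isIso_ranZero_unit hp adj M.unop
      (adjunctionApp c.toCospan.adj M) (adjunctionApp c.toSquare.adj M) X
  -- The counit identifies `0_*` of the fiber with the left column of the cartesian square, moves to
  -- the right column and returns to `f`.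
  let κ : ((L ≫ R ≫ D.restr arrowToSquareSnd.{u}) ≫ D.ev₀) ≫ r ⟶ 𝟙 _ :=
    (α_ _ _ _).hom ≫ inv ((L ≫ R ≫ D.restr arrowToSquareSnd.{u}) ◁ adj.unit) ≫ (ρ_ _).hom ≫
      L ◁ (R ◁ D.columnRestr ≫ (α_ _ _ _).inv ≫ c.toSquare.adj.counit ▷ D.restr arrowToCospan.{u} ≫
        (λ_ _).hom) ≫ inv c.toCospan.adj.unit
  have H : Nonempty (Bicategory.Adjunction r
      ((L ≫ R ≫ D.restr arrowToSquareSnd.{u}) ≫ D.ev₀)) := by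
    refine nonempty_adjunction_of_counit κ fun M X f => ?_
    have j₁ : IsIso ((adjunctionApp c.toCospan.adj M).unit.app f) :=
      isIso_app c.toCospan.adj.unit M f
    have j₂ := hD.isIso_cospan_counit hp adj M.unop (adjunctionApp c.toCospan.adj M) X
    have j₃ := hD.isIso_ranZero_counit adj M.unop X
    have j₄ := hD.isIso_ranZero_unit hp adj M.unop
      (adjunctionApp c.toCospan.adj M) (adjunctionApp c.toSquare.adj M) f
    have j₅ := isIso_columnRestr M.unop ((r.app M).toFunctor.obj X)
    have j₆ := isIso_resAdj_unit (D := D) (prodAdj squareSndAdj.{u} M.unop)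
      (isIso_trans_of_eq (P := Fin 2) _ (fun _ => rfl) fun x => IsIso.id (C := M.unop) x.2)
      ((r.app M).toFunctor.obj X)
    have h := @CategoryTheory.Adjunction.bijective_fiber_counit _ _ _ _ _ _ _ _ _ _ _ _ _ _ _ _
      (adjunctionApp c.toCospan.adj M) (adjunctionApp c.toSquare.adj M)
      (D.resAdj (prodAdj squareSndAdj.{u} M.unop)) (ranZeroAdj adj M.unop)
      ((D.columnRestr).as.app M).toNatTrans f X j₁ j₂ j₃ j₄ j₅ j₆
    refine (congrArg Function.Bijective (funext fun φ => ?_)).mp h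
    have e₁ := @inv_app _ _ _ _ _ _ c.toCospan.adj.unit i₁ M f j₁
    have e₂ := @inv_app _ _ _ _ _ _ ((L ≫ R ≫ D.restr arrowToSquareSnd.{u}) ◁ adj.unit) i₄ M f j₄
    exact comp_eq_of_eq_right ((r.app M).toFunctor.map φ) e₂
      ((D.columnRestr.as.app M).toNatTrans.app
        ((R.app M).toFunctor.obj ((L.app M).toFunctor.obj f)))
      ((D.res (Functor.prod arrowToCospan.{u}.toFunctor (𝟭 M.unop))).map
        ((c.toSquare.adj.counit.as.app M).toNatTrans.app ((L.app M).toFunctor.obj f))) e₁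
  obtain ⟨a⟩ := H
  refine nonempty_adjunction_of_iso_right a ?_
  exact α_ _ _ _ ≪≫ whiskerLeftIso L (α_ _ _ _ ≪≫ whiskerLeftIso R (D.restrEv _ _))

end Fiber

end Prederivator

theorem mainTheorem9 (D : Prederivator.{u, v, w}) (hD : D.IsDerivator) :
    -- the adjoint 5-tuple, the cone morphism and the fiber morphism exist
    Nonempty D.AdjointFiveTuple ∧ Nonempty D.ConeData ∧ Nonempty D.FiberData ∧
    -- `D` is pointed if and only if the 5-tuple extends to an adjoint 7-tuple
    (∀ T : D.AdjointFiveTuple, D.IsPointed ↔ Nonempty T.Extension) ∧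
    -- if `D` is pointed, the cone and the fiber morphism give such an extension
    (D.IsPointed → ∀ (T : D.AdjointFiveTuple) (c : D.ConeData) (f : D.FiberData),
      ∃ E : T.Extension, E.outerLeft = c.cone ∧ E.outerRight = f.fiber) ∧
    -- and every extension is of this form, up to invertible modifications
    (∀ (T : D.AdjointFiveTuple) (E : T.Extension) (c : D.ConeData) (f : D.FiberData),
      Nonempty (E.outerLeft ≅ c.cone) ∧ Nonempty (E.outerRight ≅ f.fiber)) := by
  obtain ⟨a₁⟩ := hD.nonempty_rightKan Prederivator.arrowToSpan.{u}
  obtain ⟨a₂⟩ := hD.nonempty_leftKan Prederivator.spanIncl.{u}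
  obtain ⟨b₁⟩ := hD.nonempty_leftKan Prederivator.arrowToCospan.{u}
  obtain ⟨b₂⟩ := hD.nonempty_rightKan Prederivator.cospanIncl.{u}
  refine ⟨hD.nonempty_adjointFiveTuple, ⟨⟨a₁, a₂⟩⟩, ⟨⟨b₁, b₂⟩⟩, fun T => ⟨fun hp => ?_, fun ⟨E⟩ =>
    hD.isPointed_of_extension E⟩, fun hp T c f => ?_, fun T E c f => ?_⟩
  · obtain ⟨α⟩ := hD.nonempty_cone_adjunction hp T.adjLan₁ ⟨a₁, a₂⟩
    obtain ⟨β⟩ := hD.nonempty_fiber_adjunction hp T.adjEv₀ ⟨b₁, b₂⟩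
    exact ⟨⟨_, _, α, β⟩⟩
  · obtain ⟨α⟩ := hD.nonempty_cone_adjunction hp T.adjLan₁ c
    obtain ⟨β⟩ := hD.nonempty_fiber_adjunction hp T.adjEv₀ f
    exact ⟨⟨_, _, α, β⟩, rfl, rfl⟩
  -- Any extension forces pointedness, so cone and fiber are adjoints of the same morphisms, and
  -- uniqueness of adjoints applies.
  · have hp := hD.isPointed_of_extension E
    obtain ⟨α⟩ := hD.nonempty_cone_adjunction hp T.adjLan₁ c
    obtain ⟨β⟩ := hD.nonempty_fiber_adjunction hp T.adjEv₀ f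
    exact ⟨⟨(Bicategory.conjugateIsoEquiv α E.adjOuterLeft).symm (Iso.refl _)⟩,
      ⟨(Bicategory.conjugateIsoEquiv E.adjOuterRight β) (Iso.refl _)⟩⟩
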